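/- **Setting.** Let $d\ge 1$ and let $\Omega\subset\mathbb R^d$ be a polygonal domain, i.e. a bounded connected open set with Lipschitz boundary $\Gamma=\partial\Omega$ contained in finitely many hyperplanes. Let $\gamma$ be the trace operator on $V=H^1(\Omega)$, let $\kappa>0$, $\mu>0$, $T>0$, and set $$a(u,v)=\int_\Omega\nabla u\cdot\nabla v\,dx+\kappa\int_\Gamma(\gamma u)(\gamma v)\,d\sigma,\qquad (u,v)=\int_\Omega uv\,dx+\mu\int_\Gamma(\gamma u)(\gamma v)\,d\sigma .$$ $H^{1/2}(\Gamma)=\gamma(H^1(\Omega))$ carries the norm $\|g\|_{H^{1/2}(\Gamma)}=\inf\{\|v\|_{H^1(\Omega)}:\gamma v=g\}$, and $\|g\|_{H^{-1/2}(\Gamma)}=\sup\{|(g,\psi)_{L_2(\Gamma)}|:\|\psi\|_{H^{1/2}(\Gamma)}\le1\}$ for $g\in L_2(\Gamma)$. Let $(\mathcal T_i)_i$ be a family of (finite, conforming, simplicial) triangulations of $\Omega$ that is quasi-uniform: for some $\rho>0$, every $d$-simplex of every $\mathcal T_i$ contains a ball of radius $\rho h$, where $h=h_i$ is the maximal diameter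 of the simplices of $\mathcal T_i$. Let $V_h\subset V$ be the space of continuous functions on $\overline\Omega$ that are affine on each $d$-simplex of $\mathcal T_i$, and let the Ritz projection $R_h:V\to V_h$ be defined by $a(R_hw,v_h)=a(w,v_h)$ for all $v_h\in V_h$. **$H^2$-regularity condition.** There is a constant $C_2<\infty$ such that for all $g_\Omega\in L_2(\Omega)$ and $g_\Gamma\in H^{1/2}(\Gamma)$ the weak solution $\phi\in H^1(\Omega)$ of $-\Delta\phi=g_\Omega$ in $\Omega$, $\partial_\nu\phi+\kappa\phi=g_\Gamma$ on $\Gamma$ (that is, $a(\phi,v)=(g_\Omega,v)_{L_2(\Omega)}+(g_\Gamma,\gamma v)_{L_2(\Gamma)}$ for all $v\in V$) is in $H^2(\Omega)$ and satisfies $$\|\phi\|_{H^2(\Omega)}^2\le C_2\bigl(\|g_\Omega\|_{L_2(\Omega)}^2+\|g_\Gamma\|_{H^{1/2}(\Gamma)}^2\bigr).$$ **Theorem.** Assume the $H^2$-regularity condition. Let $u\in C([0,T],L_2(\Omega)\oplus L_2(\Gamma))\cap L_2(0,T;V)$ be a weak solution of the heat equation with Wentzell boundary conditions $$\partial_tu=\Delta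 u\ \text{ in }\Omega,\qquad \mu\,\partial_tu=-\kappa u-\partial_\nu u\ \text{ on }\Gamma ,$$ i.e. $(u(t),v)+\int_0^ta(u(s),v)\,ds=(u(0),v)$ for all $v\in V$ and $0\le t\le T$, and let $u$ have the regularity $u\in H^1(0,T;H^2(\Omega))$. Then there is a constant $C$, independent of $i$ (hence of $h$) and of $t$, such that for every $i$ the solution $u_h:[0,T]\to V_h$ of the semi-discretisation $$(\dot u_h(t),v_h)+a(u_h(t),v_h)=0\quad\text{for all }v_h\in V_h,\ 0<t\le T,\qquad u_h(0)=R_hu(0),$$ satisfies $$\|u_h(t)-u(t)\|_{L_2(\Omega)}^2+\mu\,\|\gamma(u_h(t)-u(t))\|_{H^{-1/2}(\Gamma)}^2\le C\,h^4\qquad\text{for all }0\le t\le T .$$ -/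

import Mathlib

open MeasureTheory Set Filter Topology
open scoped ENNReal NNReal ContDiff InnerProductSpace

noncomputable section

namespace WentzellFEM

/-! ### Polygonal domains and their triangulations -/

/-- Near every boundary point, `Ω` is the open region strictly above the graph of a Lipschitz
function `ψ` over the hyperplane orthogonal to a unit vector `e`. (Only the values of `ψ` on the
hyperplane orthogonal to `e` matter.) -/
def HasLipschitzBoundary {d : ℕ} (Ω : Set (EuclideanSpace ℝ (Fin d))) : Prop :=
  ∀ x ∈ frontier Ω, ∃ (r : ℝ) (e : EuclideanSpace ℝ (Fin d))
    (ψ : EuclideanSpace ℝ (Fin d) → ℝ) (L : ℝ≥0),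
    0 < r ∧ ‖e‖ = 1 ∧ LipschitzWith L ψ ∧
    ∀ y ∈ Metric.ball x r, (y ∈ Ω ↔ ψ (y - ⟪y, e⟫_ℝ • e) < ⟪y, e⟫_ℝ)

/-- A polygonal (polyhedral) domain: a bounded Lipschitz domain whose boundary lies in finitely
many hyperplanes. -/
structure IsPolygonalDomain {d : ℕ} (Ω : Set (EuclideanSpace ℝ (Fin d))) : Prop where
  isOpen : IsOpen Ω
  isConnected : IsConnected Ω
  isBounded : Bornology.IsBounded Ω
  lipschitz : HasLipschitzBoundary Ω
  flat : ∃ F : Finset (EuclideanSpace ℝ (Fin d) × ℝ), (∀ p ∈ F, p.1 ≠ 0) ∧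
    frontier Ω ⊆ ⋃ p ∈ F, {x | ⟪p.1, x⟫_ℝ = p.2}

/-- A (conforming, finite) triangulation of `Ω`: a finite simplicial complex with underlying
space `closure Ω` all of whose faces are faces of `d`-dimensional simplices. -/
structure IsTriangulation {d : ℕ} (Ω : Set (EuclideanSpace ℝ (Fin d)))
    (K : Geometry.SimplicialComplex ℝ (EuclideanSpace ℝ (Fin d))) : Prop where
  finite : K.faces.Finite
  space_eq : K.space = closure Ω
  pure : ∀ s ∈ K.faces, ∃ t ∈ K.faces, s ⊆ t ∧ t.card = d + 1

/-- The maximal meshwidth `h`: the largest diameter of a simplex of the triangulation. -/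
def meshWidth {d : ℕ} (K : Geometry.SimplicialComplex ℝ (EuclideanSpace ℝ (Fin d))) : ℝ :=
  sSup ((fun s : Finset (EuclideanSpace ℝ (Fin d)) =>
    Metric.diam (convexHull ℝ (s : Set (EuclideanSpace ℝ (Fin d))))) '' K.faces)

/-- A family of triangulations is quasi-uniform if every element of every triangulation of the
family contains a ball of radius `ρ h`, with `ρ > 0` the same for the whole family. -/
def IsQuasiUniform {d : ℕ} {ι : Type*}
    (𝒯 : ι → Geometry.SimplicialComplex ℝ (EuclideanSpace ℝ (Fin d))) : Prop :=
  ∃ ρ : ℝ, 0 < ρ ∧ ∀ i, ∀ s ∈ (𝒯 i).faces, s.card = d + 1 →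
    ∃ x, Metric.closedBall x (ρ * meshWidth (𝒯 i)) ⊆
      convexHull ℝ (s : Set (EuclideanSpace ℝ (Fin d)))

/-! ### Function spaces on the domain and on its boundary -/

/-- `L₂(Ω)`. -/
abbrev L2Bulk {d : ℕ} (Ω : Set (EuclideanSpace ℝ (Fin d))) : Type :=
  Lp ℝ 2 (volume.restrict Ω)

/-- The surface measure `σ` on the boundary `Γ = ∂Ω`. -/
def surfaceMeasure {d : ℕ} (Ω : Set (EuclideanSpace ℝ (Fin d))) :
    Measure (EuclideanSpace ℝ (Fin d)) :=
  (Measure.euclideanHausdorffMeasure (d - 1)).restrict (frontier Ω)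

/-- `L₂(Γ)`. -/
abbrev L2Bdry {d : ℕ} (Ω : Set (EuclideanSpace ℝ (Fin d))) : Type :=
  Lp ℝ 2 (surfaceMeasure Ω)

/-- The classical partial derivative `∂ᵢ φ`. -/
def pderiv {d : ℕ} (i : Fin d) (φ : EuclideanSpace ℝ (Fin d) → ℝ)
    (x : EuclideanSpace ℝ (Fin d)) : ℝ :=
  fderiv ℝ φ x (EuclideanSpace.single i 1)

/-- `w` is the weak partial derivative `∂ᵢ u` in `Ω`. -/
def IsWeakDeriv {d : ℕ} {Ω : Set (EuclideanSpace ℝ (Fin d))} (i : Fin d)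
    (u w : L2Bulk Ω) : Prop :=
  ∀ φ : EuclideanSpace ℝ (Fin d) → ℝ, ContDiff ℝ ∞ φ → HasCompactSupport φ → tsupport φ ⊆ Ω →
    ∫ x in Ω, u x * pderiv i φ x = -∫ x in Ω, w x * φ x

theorem isWeakDeriv_iff {d : ℕ} {Ω : Set (EuclideanSpace ℝ (Fin d))} (i : Fin d)
    (u w : L2Bulk Ω) : IsWeakDeriv i u w ↔
      ∀ ψ ψ' : L2Bulk Ω, (∃ φ : EuclideanSpace ℝ (Fin d) → ℝ, ContDiff ℝ ∞ φ ∧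
        HasCompactSupport φ ∧ tsupport φ ⊆ Ω ∧ ψ =ᵐ[volume.restrict Ω] φ ∧
        ψ' =ᵐ[volume.restrict Ω] pderiv i φ) →
      ⟪ψ', u⟫_ℝ + ⟪ψ, w⟫_ℝ = 0 := by
  have key : ∀ (v ψ : L2Bulk Ω) (φ : EuclideanSpace ℝ (Fin d) → ℝ),
      ψ =ᵐ[volume.restrict Ω] φ → ⟪ψ, v⟫_ℝ = ∫ x in Ω, v x * φ x := by
    intro v ψ φ h
    rw [L2.inner_def]
    refine integral_congr_ae ?_
    filter_upwards [h] with x hx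
    simp [hx]
  constructor
  · rintro H ψ ψ' ⟨φ, h1, h2, h3, h4, h5⟩
    rw [key _ _ _ h4, key _ _ _ h5, H φ h1 h2 h3]
    ring
  · intro H φ h1 h2 h3
    have c1 : Continuous φ := h1.continuous
    have c2 : Continuous (pderiv i φ) :=
      (h1.continuous_fderiv (by simp)).clm_apply continuous_const
    have s2 : HasCompactSupport (pderiv i φ) := by
      refine (h2.fderiv (𝕜 := ℝ)).mono fun x hx => ?_
      contrapose! hx
      simp only [Function.mem_support, not_not] at hx ⊢
      simp [pderiv, hx]
    have m1 : MemLp φ 2 (volume.restrict Ω) := (c1.memLp_of_hasCompactSupport h2).restrict Ω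
    have m2 : MemLp (pderiv i φ) 2 (volume.restrict Ω) :=
      (c2.memLp_of_hasCompactSupport s2).restrict Ω
    have := H m1.toLp m2.toLp ⟨φ, h1, h2, h3, m1.coeFn_toLp, m2.coeFn_toLp⟩
    rw [key _ _ _ m1.coeFn_toLp, key _ _ _ m2.coeFn_toLp] at this
    linarith

/-- The Sobolev space `H¹(Ω)`: functions `u ∈ L₂(Ω)` together with their weak partial derivatives
`∂ᵢ u ∈ L₂(Ω)`; its norm is `(‖u‖² + ∑ᵢ ‖∂ᵢ u‖²)^{1/2}`. -/
def H1 {d : ℕ} (Ω : Set (EuclideanSpace ℝ (Fin d))) :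
    Submodule ℝ (WithLp 2 (L2Bulk Ω × PiLp 2 (fun _ : Fin d => L2Bulk Ω))) where
  carrier := {p | ∀ i, IsWeakDeriv i p.fst (p.snd i)}
  zero_mem' := by
    intro i
    rw [isWeakDeriv_iff]
    intro ψ ψ' _
    simp
  add_mem' := by
    intro p q hp hq i
    have hp := (isWeakDeriv_iff i _ _).1 (hp i)
    have hq := (isWeakDeriv_iff i _ _).1 (hq i)
    rw [isWeakDeriv_iff]
    intro ψ ψ' h
    have h1 := hp ψ ψ' h
    have h2 := hq ψ ψ' h
    simp only [WithLp.add_fst, WithLp.add_snd, PiLp.add_apply, inner_add_right]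
    linarith
  smul_mem' := by
    intro c p hp i
    have hp := (isWeakDeriv_iff i _ _).1 (hp i)
    rw [isWeakDeriv_iff]
    intro ψ ψ' h
    have h1 := hp ψ ψ' h
    simp only [WithLp.smul_fst, WithLp.smul_snd, PiLp.smul_apply, inner_smul_right]
    linear_combination c * h1

instance {d : ℕ} (Ω : Set (EuclideanSpace ℝ (Fin d))) : CompleteSpace (H1 Ω) := by
  have hc : IsClosed (H1 Ω : Set (WithLp 2 (L2Bulk Ω × PiLp 2 (fun _ : Fin d => L2Bulk Ω)))) := by
    have : (H1 Ω : Set (WithLp 2 (L2Bulk Ω × PiLp 2 (fun _ : Fin d => L2Bulk Ω)))) =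
        {p | ∀ i, IsWeakDeriv i p.fst (p.snd i)} := rfl
    rw [this]
    simp only [isWeakDeriv_iff, Set.ofPred_forall]
    refine isClosed_iInter fun i => isClosed_iInter fun ψ => isClosed_iInter fun ψ' =>
      isClosed_iInter fun _ => isClosed_eq ?_ continuous_const
    have c1 : Continuous fun p : WithLp 2 (L2Bulk Ω × PiLp 2 (fun _ : Fin d => L2Bulk Ω)) =>
        p.fst := by fun_prop
    have c2 : Continuous fun p : WithLp 2 (L2Bulk Ω × PiLp 2 (fun _ : Fin d => L2Bulk Ω)) =>
        p.snd i := by fun_prop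
    exact (continuous_const.inner c1).add (continuous_const.inner c2)
  exact hc.completeSpace_coe

/-- The Sobolev space `H²(Ω)`: functions `u ∈ H¹(Ω)` together with their second weak derivatives
`∂ⱼ ∂ᵢ u ∈ L₂(Ω)`; its norm is `(‖u‖² + ∑ᵢ ‖∂ᵢ u‖² + ∑ᵢⱼ ‖∂ⱼ ∂ᵢ u‖²)^{1/2}`. -/
def H2 {d : ℕ} (Ω : Set (EuclideanSpace ℝ (Fin d))) :
    Submodule ℝ (WithLp 2 (H1 Ω × PiLp 2 (fun _ : Fin d × Fin d => L2Bulk Ω))) where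
  carrier := {p | ∀ i j, IsWeakDeriv j (p.fst.1.snd i) (p.snd (i, j))}
  zero_mem' := by
    intro i j
    rw [isWeakDeriv_iff]
    intro ψ ψ' _
    simp
  add_mem' := by
    intro p q hp hq i j
    have hp := (isWeakDeriv_iff j _ _).1 (hp i j)
    have hq := (isWeakDeriv_iff j _ _).1 (hq i j)
    rw [isWeakDeriv_iff]
    intro ψ ψ' h
    have h1 := hp ψ ψ' h
    have h2 := hq ψ ψ' h
    simp only [WithLp.add_fst, WithLp.add_snd, PiLp.add_apply, Submodule.coe_add, inner_add_right]
    linarith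
  smul_mem' := by
    intro c p hp i j
    have hp := (isWeakDeriv_iff j _ _).1 (hp i j)
    rw [isWeakDeriv_iff]
    intro ψ ψ' h
    have h1 := hp ψ ψ' h
    simp only [WithLp.smul_fst, WithLp.smul_snd, PiLp.smul_apply, Submodule.coe_smul,
      inner_smul_right]
    linear_combination c * h1

instance {d : ℕ} (Ω : Set (EuclideanSpace ℝ (Fin d))) : CompleteSpace (H2 Ω) := by
  have hc : IsClosed
      (H2 Ω : Set (WithLp 2 (H1 Ω × PiLp 2 (fun _ : Fin d × Fin d => L2Bulk Ω)))) := by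
    have : (H2 Ω : Set (WithLp 2 (H1 Ω × PiLp 2 (fun _ : Fin d × Fin d => L2Bulk Ω)))) =
        {p | ∀ i j, IsWeakDeriv j (p.fst.1.snd i) (p.snd (i, j))} := rfl
    rw [this]
    simp only [isWeakDeriv_iff, Set.ofPred_forall]
    refine isClosed_iInter fun i => isClosed_iInter fun j => isClosed_iInter fun ψ =>
      isClosed_iInter fun ψ' => isClosed_iInter fun _ => isClosed_eq ?_ continuous_const
    have c1 : Continuous fun p : WithLp 2 (H1 Ω × PiLp 2 (fun _ : Fin d × Fin d => L2Bulk Ω)) =>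
        p.fst.1.snd i := by fun_prop
    have c2 : Continuous fun p : WithLp 2 (H1 Ω × PiLp 2 (fun _ : Fin d × Fin d => L2Bulk Ω)) =>
        p.snd (i, j) := by fun_prop
    exact (continuous_const.inner c1).add (continuous_const.inner c2)
  exact hc.completeSpace_coe

/-- The graph of the restriction map `φ|_Ω ↦ φ|_Γ` on functions that are smooth up to the
boundary. -/
def smoothGraph {d : ℕ} (Ω : Set (EuclideanSpace ℝ (Fin d))) :
    Submodule ℝ (WithLp 2 (H1 Ω × L2Bdry Ω)) where
  carrier := {p | ∃ φ : EuclideanSpace ℝ (Fin d) → ℝ, ContDiff ℝ ∞ φ ∧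
    p.fst.1.fst =ᵐ[volume.restrict Ω] φ ∧
    (∀ i, p.fst.1.snd i =ᵐ[volume.restrict Ω] pderiv i φ) ∧
    p.snd =ᵐ[surfaceMeasure Ω] φ}
  zero_mem' := by
    refine ⟨fun _ => 0, contDiff_const, Lp.coeFn_zero _ _ _, fun i => ?_, Lp.coeFn_zero _ _ _⟩
    have : pderiv i (fun _ : EuclideanSpace ℝ (Fin d) => (0 : ℝ)) = 0 := by
      ext x; simp [pderiv]
    rw [this]
    exact Lp.coeFn_zero _ _ _
  add_mem' := by
    rintro p q ⟨φ, h1, h2, h3, h4⟩ ⟨χ, k1, k2, k3, k4⟩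
    refine ⟨φ + χ, h1.add k1, (Lp.coeFn_add _ _).trans (h2.add k2), fun i => ?_,
      (Lp.coeFn_add _ _).trans (h4.add k4)⟩
    have : pderiv i (φ + χ) = pderiv i φ + pderiv i χ := by
      ext x
      simp [pderiv, fderiv_add (h1.differentiable (by simp) x) (k1.differentiable (by simp) x)]
    rw [this]
    exact (Lp.coeFn_add _ _).trans ((h3 i).add (k3 i))
  smul_mem' := by
    rintro c p ⟨φ, h1, h2, h3, h4⟩
    refine ⟨c • φ, h1.const_smul c, (Lp.coeFn_smul _ _).trans (h2.const_smul c), fun i => ?_,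
      (Lp.coeFn_smul _ _).trans (h4.const_smul c)⟩
    have : pderiv i (c • φ) = c • pderiv i φ := by
      ext x
      simp [pderiv, fderiv_const_smul (h1.differentiable (by simp) x)]
    rw [this]
    exact (Lp.coeFn_smul _ _).trans ((h3 i).const_smul c)

/-- The graph of the trace operator `γ : H¹(Ω) → L₂(Γ)`, the closure in `H¹(Ω) × L₂(Γ)` of the
graph of the restriction map on functions smooth up to the boundary. For a bounded Lipschitz
domain every `v ∈ H¹(Ω)` has exactly one trace `γ v`, and `v ↦ (v, γ v)` is an isomorphism of
`H¹(Ω)` onto this space, which thus is the space `V = H¹(Ω)` with each function carrying its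
trace. -/
abbrev EnergySpace {d : ℕ} (Ω : Set (EuclideanSpace ℝ (Fin d))) : Type :=
  (smoothGraph Ω).topologicalClosure

namespace EnergySpace

variable {d : ℕ} {Ω : Set (EuclideanSpace ℝ (Fin d))}

/-- `v` as an element of `H¹(Ω)`. -/
def toH1 (v : EnergySpace Ω) : H1 Ω := v.1.fst

/-- `v` as an element of `L₂(Ω)`. -/
def toL2 (v : EnergySpace Ω) : L2Bulk Ω := v.toH1.1.fst

/-- The weak derivative `∂ᵢ v`. -/
def grad (v : EnergySpace Ω) (i : Fin d) : L2Bulk Ω := v.toH1.1.snd i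

/-- The trace `γ v`. -/
def trace (v : EnergySpace Ω) : L2Bdry Ω := v.1.snd

/-- `v` as an element `(v, γ v)` of `H = L₂(Ω) ⊕ L₂(Γ)`. -/
def toH (v : EnergySpace Ω) : WithLp 2 (L2Bulk Ω × L2Bdry Ω) := WithLp.toLp 2 (v.toL2, v.trace)

end EnergySpace

/-- `H^{1/2}(Γ)`, the space of traces of functions in `H¹(Ω)`. -/
def HHalf {d : ℕ} (Ω : Set (EuclideanSpace ℝ (Fin d))) : Set (L2Bdry Ω) :=
  range (EnergySpace.trace (Ω := Ω))

/-- The (quotient) norm of `H^{1/2}(Γ)`: the infimum of `‖v‖_{H¹(Ω)}` over all `v` with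
`γ v = g`; meant for `g ∈ HHalf Ω`. -/
def hHalfNorm {d : ℕ} {Ω : Set (EuclideanSpace ℝ (Fin d))} (g : L2Bdry Ω) : ℝ :=
  ⨅ v : {v : EnergySpace Ω // v.trace = g}, ‖v.1.toH1‖

/-- The norm of `H^{-1/2}(Γ)`, the dual of `H^{1/2}(Γ)` with `L₂(Γ)` as pivot space, on elements
of `L₂(Γ)`. -/
def hNegHalfNorm {d : ℕ} {Ω : Set (EuclideanSpace ℝ (Fin d))} (g : L2Bdry Ω) : ℝ≥0∞ :=
  ⨆ ψ : {ψ : L2Bdry Ω // ψ ∈ HHalf Ω ∧ hHalfNorm ψ ≤ 1}, ENNReal.ofReal |⟪g, ψ.1⟫_ℝ|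

/-! ### The parabolic problem and its discretisation -/

section Forms

variable {d : ℕ} {Ω : Set (EuclideanSpace ℝ (Fin d))}

/-- `a(u, v) = ∫_Ω ∇u · ∇v dx + κ ∫_Γ (γ u)(γ v) dσ`. -/
def aForm (κ : ℝ) (u v : EnergySpace Ω) : ℝ :=
  ∑ i, ⟪u.grad i, v.grad i⟫_ℝ + κ * ⟪u.trace, v.trace⟫_ℝ

/-- `(u, v) = ∫_Ω u v dx + μ ∫_Γ (γ u)(γ v) dσ`. -/
def mForm (μ : ℝ) (u v : EnergySpace Ω) : ℝ :=
  ⟪u.toL2, v.toL2⟫_ℝ + μ * ⟪u.trace, v.trace⟫_ℝ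

/-- `φ` is the weak solution of `-Δφ = gΩ` in `Ω`, `∂_ν φ + κ φ = gΓ` on `Γ`. -/
def IsRobinSolution (κ : ℝ) (gΩ : L2Bulk Ω) (gΓ : L2Bdry Ω) (φ : EnergySpace Ω) : Prop :=
  ∀ v : EnergySpace Ω, aForm κ φ v = ⟪gΩ, v.toL2⟫_ℝ + ⟪gΓ, v.trace⟫_ℝ

/-- `u : [0,T] → V` is a weak solution, in `C([0,T], H) ∩ L₂(0,T; V)`, of `∂ₜ u = Δ u` in `Ω`,
`μ ∂ₜ u = -κ u - ∂_ν u` on `Γ`: for every `v ∈ V`, `d/dt (u(t), v) + a(u(t), v) = 0`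
in the integrated sense. -/
structure IsWeakSolution (κ μ T : ℝ) (u : ℝ → EnergySpace Ω) : Prop where
  continuousOn : ContinuousOn (fun t => (u t).toH) (Icc 0 T)
  memLp : MemLp u 2 (volume.restrict (Ioc 0 T))
  eq : ∀ v : EnergySpace Ω, ∀ t ∈ Icc 0 T,
    mForm μ (u t) v + ∫ s in (0 : ℝ)..t, aForm κ (u s) v = mForm μ (u 0) v

/-- `u ∈ H¹(0, T; H²(Ω))`. -/
def IsH1InTimeH2 (T : ℝ) (u : ℝ → EnergySpace Ω) : Prop :=
  ∃ U U' : ℝ → H2 Ω, MemLp U' 2 (volume.restrict (Ioc 0 T)) ∧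
    ∀ t ∈ Icc 0 T, (u t).toH1 = (U t).1.fst ∧ U t = U 0 + ∫ s in (0 : ℝ)..t, U' s

/-- The linear finite element space `V_h` of a triangulation of `Ω`: functions (in `V`) that are
continuous on the closure of `Ω` and affine on each element. -/
def feSpace (Ω : Set (EuclideanSpace ℝ (Fin d)))
    (K : Geometry.SimplicialComplex ℝ (EuclideanSpace ℝ (Fin d))) :
    Submodule ℝ (EnergySpace Ω) where
  carrier := {v | ∃ p : EuclideanSpace ℝ (Fin d) → ℝ, ContinuousOn p (closure Ω) ∧
    (∀ s ∈ K.faces, s.card = d + 1 → ∃ A : EuclideanSpace ℝ (Fin d) →ᵃ[ℝ] ℝ,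
      EqOn p A (convexHull ℝ (s : Set (EuclideanSpace ℝ (Fin d))))) ∧
    v.toL2 =ᵐ[volume.restrict Ω] p}
  zero_mem' := ⟨fun _ => 0, continuousOn_const, fun _ _ _ => ⟨0, fun _ _ => rfl⟩,
    Lp.coeFn_zero _ _ _⟩
  add_mem' := by
    rintro v w ⟨p, h1, h2, h3⟩ ⟨q, k1, k2, k3⟩
    refine ⟨p + q, h1.add k1, fun s hs hc => ?_, (Lp.coeFn_add _ _).trans (h3.add k3)⟩
    obtain ⟨A, hA⟩ := h2 s hs hc
    obtain ⟨B, hB⟩ := k2 s hs hc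
    exact ⟨A + B, fun x hx => by simp [hA hx, hB hx]⟩
  smul_mem' := by
    rintro c v ⟨p, h1, h2, h3⟩
    refine ⟨c • p, h1.const_smul c, fun s hs hc => ?_,
      (Lp.coeFn_smul _ _).trans (h3.const_smul c)⟩
    obtain ⟨A, hA⟩ := h2 s hs hc
    exact ⟨c • A, fun x hx => by simp [hA hx]⟩

/-- `r = R_h w`, the Ritz projection of `w` onto `Vh`:
`a(R_h w, v_h) = a(w, v_h)` for all `v_h ∈ Vh`. -/
def IsRitzProjection (κ : ℝ) (Vh : Submodule ℝ (EnergySpace Ω)) (w r : EnergySpace Ω) : Prop :=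
  r ∈ Vh ∧ ∀ vh ∈ Vh, aForm κ r vh = aForm κ w vh

/-- `u_h : [0,T] → V_h` satisfies `(u̇_h(t), v_h) + a(u_h(t), v_h) = 0` for all `v_h ∈ V_h` and
`0 < t ≤ T`. -/
structure IsSemidiscreteSolution (κ μ T : ℝ) (Vh : Submodule ℝ (EnergySpace Ω))
    (uh : ℝ → EnergySpace Ω) : Prop where
  mem : ∀ t ∈ Icc 0 T, uh t ∈ Vh
  continuousOn : ContinuousOn uh (Icc 0 T)
  eq : ∀ t ∈ Ioc 0 T, ∃ uh' : EnergySpace Ω, HasDerivWithinAt uh uh' (Icc 0 T) t ∧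
    ∀ vh ∈ Vh, mForm μ uh' vh + aForm κ (uh t) vh = 0

end Forms

/-- `H²`-regularity of the Robin problem: for all `gΩ ∈ L₂(Ω)` and `gΓ ∈ H^{1/2}(Γ)` the weak
solution `φ` is in `H²(Ω)`, with
`‖φ‖²_{H²(Ω)} ≤ C₂ (‖gΩ‖²_{L₂(Ω)} + ‖gΓ‖²_{H^{1/2}(Γ)})`. -/
def RobinRegularity {d : ℕ} (Ω : Set (EuclideanSpace ℝ (Fin d))) (κ : ℝ) : Prop :=
  ∃ C₂ : ℝ, ∀ (gΩ : L2Bulk Ω) (gΓ : L2Bdry Ω), gΓ ∈ HHalf Ω →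
    ∀ φ : EnergySpace Ω, IsRobinSolution κ gΩ gΓ φ →
      ∃ Φ : H2 Ω, Φ.1.fst = φ.toH1 ∧ ‖Φ‖ ^ 2 ≤ C₂ * (‖gΩ‖ ^ 2 + hHalfNorm gΓ ^ 2)

end WentzellFEM

end

open WentzellFEM

/-!
Second-order convergence in `L₂(Ω) ⊕ H^{-1/2}(Γ)` of the linear finite element semidiscretisation
of the heat equation with Wentzell boundary conditions.

Write `R` for the Ritz projection and split the error as `(uh - R u) + (R u - u)`. By the
Aubin–Nitsche argument (`abs_le_of_duality`), `R w - w` tested against data `(gΩ, gΓ)` equals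
`a (φ - φh) (R w - w)` up to sign, where `φ` solves the Robin problem with these data and `φh` is
any finite element function. If `w` and `φ` belong to `H²(Ω)`, both factors are of order `h` in
`H¹(Ω)`, and `H²`-regularity bounds `φ` by `‖gΩ‖_{L₂(Ω)} + ‖gΓ‖_{H^{1/2}(Γ)}`. Hence `R w - w` is of
order `h²` in the dual norm, which is the norm of `L₂(Ω) ⊕ H^{-1/2}(Γ)`. The discrete part
`θ = uh - R u` starts from zero and solves the semidiscrete equation with right-hand side
`-(R u - u)'`, paired with test functions in `V` by the mass form; the traces of these lie in
`H^{1/2}(Γ)`, so that the dual norm suffices there as well, and the energy estimate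
(`energy_estimate`) bounds `θ` by `O(h²)` even in `L₂(Ω) ⊕ L₂(Γ)`. This part is carried out for
abstract operators on a Hilbert space in `exists_semidiscrete_error_of_regularity`.

What remains is to place the concrete spaces in this frame. Coercivity of the form `a` is
Friedrichs' inequality (`exists_friedrichs`), obtained by integrating along lines up to the
boundary; no compactness is needed. That `H¹(Ω)` and the graph of the trace operator may be
identified (`exists_antilipschitz_toH1L`, `surjective_toH1L`) rests on the trace inequality
(`exists_trace_le`) and on the density of functions smooth up to the boundary. The latter comes
from a partition of unity and averages over small shifts into the interior cones of the Lipschitz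
domain, which need no extension operator.

The approximation of `H²(Ω)` by finite elements (`exists_fe_approx`) cannot use nodal values of an
`H²` function, which need not be continuous in high dimensions. Instead the function is first
averaged over inward shifts of the size of the mesh width, which costs `O(h)` in `H¹(Ω)` and leaves
second derivatives that are bounded on each element by local `L²` norms
(`exists_smooth_approx_H2`), and then interpolated (`affine_interpolation_le`). The local bounds
add up (`lintegral_le_of_cells`) because elements do not overlap, whatever their shape; the
inscribed balls of a quasi-uniform family enter only in the bound for the slopes of the
interpolants. Continuous piecewise affine functions lie in `H¹(Ω)` by
`exists_energySpace_of_piecewise`.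
-/

namespace WentzellFEM

/-! ### Integration along lines -/

/-- The Cauchy–Schwarz inequality for the Lebesgue integral of a single function. -/
theorem sq_lintegral_le {α : Type*} [MeasurableSpace α] (μ : Measure α) {g : α → ℝ≥0∞}
    (hg : AEMeasurable g μ) : (∫⁻ x, g x ∂μ) ^ 2 ≤ μ univ * ∫⁻ x, g x ^ 2 ∂μ := by
  have h := ENNReal.lintegral_mul_le_Lp_mul_Lq μ (p := 2) (q := 2)
    (Real.holderConjugate_iff.2 (by norm_num)) (f := fun _ => 1) (g := g) aemeasurable_const hg
  simp only [Pi.mul_apply, one_mul, ENNReal.one_rpow, lintegral_const] at h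
  calc (∫⁻ x, g x ∂μ) ^ 2
      ≤ (μ univ ^ (1 / 2 : ℝ) * (∫⁻ a, g a ^ (2 : ℝ) ∂μ) ^ (1 / 2 : ℝ)) ^ 2 := by gcongr
    _ = μ univ * ∫⁻ x, g x ^ 2 ∂μ := by
        rw [mul_pow, ← ENNReal.rpow_natCast, ← ENNReal.rpow_natCast, ← ENNReal.rpow_mul,
          ← ENNReal.rpow_mul]
        norm_num

theorem add_sq_le_two_mul (a b : ℝ≥0∞) : (a + b) ^ 2 ≤ 2 * a ^ 2 + 2 * b ^ 2 := by
  have := ENNReal.rpow_add_le_mul_rpow_add_rpow a b (p := 2) (by norm_num)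
  norm_num at this
  rwa [mul_add] at this

/-- A quantitative form of the fundamental theorem of calculus: the value at one end point of an
interval is controlled by the value at the other one and the `L²` norm of the derivative. -/
theorem enorm_sq_le_of_hasDerivAt {f f' : ℝ → ℝ} {a b : ℝ} (hab : a ≤ b)
    (hf : ∀ t, HasDerivAt f (f' t) t) (hf' : Continuous f') :
    ‖f a‖ₑ ^ 2 ≤ 2 * ‖f b‖ₑ ^ 2
      + 2 * (ENNReal.ofReal (b - a) * ∫⁻ t in Ioc a b, ‖f' t‖ₑ ^ 2) := by
  have h1 : ∫ t in a..b, f' t = f b - f a :=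
    intervalIntegral.integral_eq_sub_of_hasDerivAt (fun t _ => hf t)
      (hf'.intervalIntegrable _ _)
  have h2 : ‖f a‖ₑ ≤ ‖f b‖ₑ + ∫⁻ t in Ioc a b, ‖f' t‖ₑ := by
    have : f a = f b + -∫ t in a..b, f' t := by rw [h1]; ring
    rw [this]
    refine (enorm_add_le _ _).trans ?_
    rw [enorm_neg, intervalIntegral.integral_of_le hab]
    gcongr
    exact enorm_integral_le_lintegral_enorm _
  calc ‖f a‖ₑ ^ 2 ≤ (‖f b‖ₑ + ∫⁻ t in Ioc a b, ‖f' t‖ₑ) ^ 2 := by gcongr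
    _ ≤ _ := add_sq_le_two_mul _ _
    _ ≤ _ := by
      gcongr
      refine (sq_lintegral_le _ (by fun_prop)).trans ?_
      simp

section Lines

variable {d : ℕ}

local notation "E" => EuclideanSpace ℝ (Fin d)

/-- Fubini's theorem for the lines in the direction of a unit vector. -/
theorem lintegral_eq_lintegral_lines {e : E} (he : ‖e‖ = 1) {f : E → ℝ≥0∞} (hf : Measurable f) :
    ∫⁻ x, f x = ∫⁻ y : (ℝ ∙ e)ᗮ, ∫⁻ t : ℝ, f (y + t • e) := by
  have h1 := ((ℝ ∙ e).measurePreserving_measurableEquivProd (0 : E)).symm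
  rw [InnerProductSpace.euclideanHausdorffMeasure_eq_volume] at h1
  have h2 := (LinearIsometryEquiv.toSpanUnitSingleton e he).measurePreserving
  have h3 : MeasurePreserving
      (fun p : (ℝ ∙ e)ᗮ × ℝ => ((p.1 : E) + p.2 • e)) (volume.prod volume) volume := by
    have h4 := h1.comp
      ((h2.prod (MeasurePreserving.id volume)).comp Measure.measurePreserving_swap)
    refine (congrArg (fun g => MeasurePreserving g _ _) ?_).mp h4
    funext p
    simp [add_comm]
  rw [← h3.lintegral_comp hf, lintegral_prod _ (by fun_prop)]

theorem finrank_orthogonal_span {e : E} (he : ‖e‖ = 1) :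
    Module.finrank ℝ (ℝ ∙ e)ᗮ = d - 1 := by
  have h := (ℝ ∙ e).finrank_add_finrank_orthogonal
  rw [finrank_span_singleton (by rintro rfl; simp at he)] at h
  simp at h
  omega

/-- Orthogonal projection onto a hyperplane does not increase the surface measure; on the hyperplane
itself, that is Lebesgue measure. -/
theorem surfaceMeasure_projection_le {e : E} (he : ‖e‖ = 1) (A : Set E) :
    volume ((ℝ ∙ e)ᗮ.orthogonalProjectionOnto '' A) ≤
      Measure.euclideanHausdorffMeasure (d - 1) A := by
  rw [← InnerProductSpace.euclideanHausdorffMeasure_eq_volume, finrank_orthogonal_span he,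
    Measure.euclideanHausdorffMeasure_def, Measure.euclideanHausdorffMeasure_def,
    Measure.smul_apply, Measure.smul_apply]
  gcongr
  exact hausdorffMeasure_orthogonalProjectionOnto_le _ _ _ (Nat.cast_nonneg _)

/-- The part of a bounded open set on a line: from each of its points one reaches the boundary
along the line. -/
theorem exists_exit_point {Ω : Set E} (hΩ : IsOpen Ω) {e : E} (he : ‖e‖ = 1) {R : ℝ}
    (hR : Ω ⊆ Metric.closedBall 0 R) {x : E} (hx : x ∈ Ω) :
    ∃ b : ℝ, 0 < b ∧ x + b • e ∈ frontier Ω ∧ ∀ t ∈ Ico 0 b, x + t • e ∈ Ω := by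
  set C : Set ℝ := Ici 0 ∩ (fun t : ℝ => x + t • e) ⁻¹' Ωᶜ with hC
  have hcont : Continuous (fun t : ℝ => x + t • e) := by fun_prop
  have hCc : IsClosed C := isClosed_Ici.inter (hΩ.isClosed_compl.preimage hcont)
  have hCne : C.Nonempty := by
    have hxR : ‖x‖ ≤ R := by simpa using hR hx
    have hx0 := norm_nonneg x
    refine ⟨2 * R + 1, by simp; linarith, fun h => ?_⟩
    have h1 : ‖x + (2 * R + 1) • e‖ ≤ R := by simpa using hR h
    have h2 : ‖(2 * R + 1) • e‖ ≤ ‖x + (2 * R + 1) • e‖ + ‖x‖ := by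
      simpa using norm_sub_le (x + (2 * R + 1) • e) x
    rw [norm_smul, he, Real.norm_of_nonneg (by linarith)] at h2
    linarith
  have hbdd : BddBelow C := ⟨0, fun t ht => ht.1⟩
  have hb := hCc.csInf_mem hCne hbdd
  have hlt : ∀ t ∈ Ico 0 (sInf C), x + t • e ∈ Ω := by
    intro t ht
    by_contra h
    exact absurd (csInf_le hbdd (show t ∈ C from ⟨ht.1, h⟩)) (not_le.2 ht.2)
  have hpos : 0 < sInf C := by
    refine lt_of_le_of_ne hb.1 fun h => hb.2 ?_
    simpa [← h] using hx
  refine ⟨sInf C, hpos, ?_, hlt⟩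
  rw [hΩ.frontier_eq]
  refine ⟨?_, hb.2⟩
  have : Tendsto (fun t : ℝ => x + t • e) (𝓝[<] (sInf C)) (𝓝 (x + sInf C • e)) :=
    hcont.continuousAt.tendsto.mono_left nhdsWithin_le_nhds
  refine mem_closure_of_tendsto this ?_
  filter_upwards [Ioo_mem_nhdsLT hpos] with t ht using hlt t ⟨ht.1.le, ht.2⟩

/-- For a continuous nonnegative function on a compact set `Γ`, the integral over the projection
of `Γ` to a hyperplane of the maxima over the fibres is at most the integral over `Γ`, since
projections do not increase Hausdorff measure. -/
theorem lintegral_fibre_sup_le {Γ : Set E} (hΓ : IsCompact Γ) {e : E} (he : ‖e‖ = 1) {f : E → ℝ}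
    (hf : Continuous f) (hf0 : ∀ x, 0 ≤ f x) :
    ∃ s : (ℝ ∙ e)ᗮ → ℝ, Measurable s ∧
      (∀ x ∈ Γ, f x ≤ s ((ℝ ∙ e)ᗮ.orthogonalProjectionOnto x)) ∧
      ∫⁻ y, ENNReal.ofReal (s y) ≤
        ∫⁻ x in Γ, ENNReal.ofReal (f x) ∂(Measure.euclideanHausdorffMeasure (d - 1)) := by
  set P := (ℝ ∙ e)ᗮ.orthogonalProjectionOnto with hP
  set s : (ℝ ∙ e)ᗮ → ℝ := fun y => sSup (f '' (Γ ∩ P ⁻¹' {y})) with hs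
  have hcpt : ∀ y, IsCompact (f '' (Γ ∩ P ⁻¹' {y})) := fun y =>
    (hΓ.inter_right (isClosed_singleton.preimage P.continuous)).image hf
  have hle : ∀ x ∈ Γ, f x ≤ s (P x) := fun x hx =>
    le_csSup (hcpt _).bddAbove ⟨x, ⟨hx, rfl⟩, rfl⟩
  have hs0 : ∀ y, 0 ≤ s y := fun y => Real.sSup_nonneg (by rintro _ ⟨x, -, rfl⟩; exact hf0 x)
  -- Superlevel sets of the fibrewise maximum are projections of superlevel sets of `f`; hence `s`
  -- is measurable, and its integral is compared with that of `f` level by level.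
  have hset : ∀ t > 0, {y | t ≤ s y} = P '' (Γ ∩ {x | t ≤ f x}) := by
    intro t ht
    ext y
    constructor
    · intro hy
      have hne : (f '' (Γ ∩ P ⁻¹' {y})).Nonempty := by
        by_contra h
        rw [not_nonempty_iff_eq_empty] at h
        have : t ≤ s y := hy
        simp only [hs, h, Real.sSup_empty] at this
        linarith
      obtain ⟨x, ⟨hx, hxy⟩, hfx⟩ := (hcpt y).sSup_mem hne
      exact ⟨x, ⟨hx, by simpa [hfx] using hy⟩, hxy⟩
    · rintro ⟨x, ⟨hx, hxt⟩, rfl⟩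
      exact le_trans (b := f x) hxt (hle x hx)
  have hmeas : Measurable s := by
    refine measurable_of_Ici fun t => ?_
    by_cases ht : 0 < t
    · have := hset t ht
      change MeasurableSet {y | t ≤ s y}
      rw [this]
      exact ((hΓ.inter_right (isClosed_le continuous_const hf)).image
        P.continuous).isClosed.measurableSet
    · convert MeasurableSet.univ
      ext y
      simp only [mem_preimage, mem_Ici, mem_univ, iff_true]
      linarith [hs0 y]
  refine ⟨s, hmeas, hle, ?_⟩
  rw [lintegral_eq_lintegral_meas_le _ (ae_of_all _ hs0) hmeas.aemeasurable,
    lintegral_eq_lintegral_meas_le _ (ae_of_all _ hf0) hf.measurable.aemeasurable]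
  refine setLIntegral_mono' measurableSet_Ioi fun t ht => ?_
  rw [hset t ht, Measure.restrict_apply (isClosed_le continuous_const hf).measurableSet,
    inter_comm]
  exact surfaceMeasure_projection_le he _

/-- Friedrichs' inequality for smooth functions on a bounded open set. Along each line in the
direction `e`, the value of `φ` at a point is controlled by its value at the exit point on the
boundary and the derivative in between; the exit values are integrated with
`lintegral_fibre_sup_le`. -/
theorem friedrichs_smooth {Ω : Set E} (hΩ : IsOpen Ω) {e : E} (he : ‖e‖ = 1) {R : ℝ}
    (hR : Ω ⊆ Metric.closedBall 0 R) {φ : E → ℝ} (hφ : ContDiff ℝ ∞ φ) :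
    ∫⁻ x in Ω, ‖φ x‖ₑ ^ 2 ≤
      ENNReal.ofReal (2 * R) * (2 * ∫⁻ x, ‖φ x‖ₑ ^ 2 ∂(surfaceMeasure Ω)) +
      ENNReal.ofReal (2 * R) * (2 * (ENNReal.ofReal (2 * R) *
        ∫⁻ x in Ω, ‖fderiv ℝ φ x e‖ₑ ^ 2)) := by
  set P := (ℝ ∙ e)ᗮ.orthogonalProjectionOnto with hP
  have hΓ : IsCompact (frontier Ω) :=
    ((Metric.isBounded_closedBall.subset hR).isCompact_closure).of_isClosed_subset
      isClosed_frontier frontier_subset_closure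
  have hPe : P e = 0 := by
    rw [hP, Submodule.orthogonalProjectionOnto_eq_zero_iff]
    simp
  have hPy : ∀ (y : (ℝ ∙ e)ᗮ) (t : ℝ), P (y + t • e) = y := by
    intro y t
    simp [hPe]
    simp [hP]
  have hye : ∀ (y : (ℝ ∙ e)ᗮ), ⟪(y : E), e⟫_ℝ = 0 := fun y =>
    Submodule.mem_orthogonal_singleton_iff_inner_left.1 y.2
  obtain ⟨s, hsm, hs, hsint⟩ := lintegral_fibre_sup_le hΓ he (f := fun x => φ x ^ 2)
    (hφ.continuous.pow 2) (fun x => sq_nonneg _)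
  have hconv : ∀ a : ℝ, ENNReal.ofReal (a ^ 2) = ‖a‖ₑ ^ 2 := by
    intro a
    rw [← sq_abs, ENNReal.ofReal_pow (abs_nonneg a), ← Real.norm_eq_abs, ofReal_norm]
  simp only [hconv] at hsint
  have hd : Continuous fun x => fderiv ℝ φ x e :=
    (hφ.continuous_fderiv (by simp)).clm_apply continuous_const
  set D := fun y : (ℝ ∙ e)ᗮ => ∫⁻ t : ℝ, Ω.indicator (fun x => ‖fderiv ℝ φ x e‖ₑ ^ 2) (y + t • e)
    with hD
  have hmD : Measurable (Ω.indicator (fun x => ‖fderiv ℝ φ x e‖ₑ ^ 2)) :=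
    (by fun_prop : Measurable fun x => ‖fderiv ℝ φ x e‖ₑ ^ 2).indicator hΩ.measurableSet
  have hmφ : Measurable (Ω.indicator (fun x => ‖φ x‖ₑ ^ 2)) := by
    have := hφ.continuous
    exact (by fun_prop : Measurable fun x => ‖φ x‖ₑ ^ 2).indicator hΩ.measurableSet
  -- Follow the line from the point to its exit point on the boundary.
  have hpt : ∀ (y : (ℝ ∙ e)ᗮ) (t : ℝ), (y : E) + t • e ∈ Ω → ‖φ (y + t • e)‖ₑ ^ 2 ≤
      2 * ENNReal.ofReal (s y) + 2 * (ENNReal.ofReal (2 * R) * D y) := by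
    intro y t ht
    obtain ⟨b, hb0, hbΓ, hbΩ⟩ := exists_exit_point hΩ he hR ht
    have hbt : (y : E) + t • e + b • e = y + (t + b) • e := by rw [add_smul, add_assoc]
    have hder : ∀ τ : ℝ, HasDerivAt (fun τ : ℝ => φ (y + τ • e)) (fderiv ℝ φ (y + τ • e) e) τ := by
      intro τ
      have h1 : HasDerivAt (fun τ : ℝ => (y : E) + τ • e) e τ := by
        simpa using ((hasDerivAt_id τ).smul_const e).const_add (y : E)
      exact (hφ.differentiable (by simp) _).hasFDerivAt.comp_hasDerivAt τ h1
    have := enorm_sq_le_of_hasDerivAt (a := t) (b := t + b) (by linarith) hder (by fun_prop)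
    refine this.trans ?_
    gcongr
    · rw [← hconv, ← hbt]
      have := hs _ hbΓ
      rw [← hP, hbt, hPy] at this
      rw [hbt]
      exact ENNReal.ofReal_le_ofReal this
    · have h1 : ‖(y : E) + t • e‖ ≤ R := by simpa using hR ht
      have h2 : ‖(y : E) + t • e + b • e‖ ≤ R := by
        have : closure Ω ⊆ Metric.closedBall 0 R :=
          closure_minimal hR Metric.isClosed_closedBall
        simpa using this (frontier_subset_closure hbΓ)
      have h3 : ‖b • e‖ ≤ R + R := by
        have := norm_sub_le ((y : E) + t • e + b • e) ((y : E) + t • e)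
        rw [add_sub_cancel_left] at this
        linarith
      rw [norm_smul, he, Real.norm_of_nonneg hb0.le] at h3
      linarith
    · rw [restrict_Ioo_eq_restrict_Ioc.symm, hD, ← lintegral_indicator measurableSet_Ioo]
      refine lintegral_mono fun τ => ?_
      by_cases hτ : τ ∈ Ioo t (t + b)
      · have := hbΩ (τ - t) ⟨by linarith [hτ.1], by linarith [hτ.2]⟩
        rw [add_assoc, ← add_smul, add_sub_cancel] at this
        rw [indicator_of_mem hτ, indicator_of_mem this]
      · rw [indicator_of_notMem hτ]
        exact zero_le
  -- A line meets `Ω` only for parameters in `[-R, R]`, whence the first factor `2 R`.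
  have hline : ∀ y : (ℝ ∙ e)ᗮ, ∫⁻ t : ℝ, Ω.indicator (fun x => ‖φ x‖ₑ ^ 2) (y + t • e) ≤
      ENNReal.ofReal (2 * R) *
        (2 * ENNReal.ofReal (s y) + 2 * (ENNReal.ofReal (2 * R) * D y)) := by
    intro y
    calc ∫⁻ t : ℝ, Ω.indicator (fun x => ‖φ x‖ₑ ^ 2) (y + t • e)
        ≤ ∫⁻ t : ℝ, (Icc (-R) R).indicator (fun _ =>
          (2 * ENNReal.ofReal (s y) + 2 * (ENNReal.ofReal (2 * R) * D y))) t := by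
          refine lintegral_mono fun t => ?_
          by_cases ht : (y : E) + t • e ∈ Ω
          · rw [indicator_of_mem ht, indicator_of_mem]
            · exact hpt y t ht
            · have h1 : ‖(y : E) + t • e‖ ≤ R := by simpa using hR ht
              have h2 : t = ⟪(y : E) + t • e, e⟫_ℝ := by
                rw [inner_add_left, hye, inner_smul_left, real_inner_self_eq_norm_sq, he]
                simp
              have h3 := abs_real_inner_le_norm ((y : E) + t • e) e
              rw [← h2, he, mul_one] at h3
              exact abs_le.1 (h3.trans h1)
          · rw [indicator_of_notMem ht]
            exact zero_le
      _ = _ := by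
          rw [lintegral_indicator measurableSet_Icc, setLIntegral_const, Real.volume_Icc, mul_comm]
          congr 2
          ring
  calc ∫⁻ x in Ω, ‖φ x‖ₑ ^ 2
      = ∫⁻ y : (ℝ ∙ e)ᗮ, ∫⁻ t : ℝ, Ω.indicator (fun x => ‖φ x‖ₑ ^ 2) (y + t • e) := by
        rw [← lintegral_eq_lintegral_lines he hmφ, lintegral_indicator hΩ.measurableSet]
    _ ≤ ∫⁻ y : (ℝ ∙ e)ᗮ, ENNReal.ofReal (2 * R) *
        (2 * ENNReal.ofReal (s y) + 2 * (ENNReal.ofReal (2 * R) * D y)) := lintegral_mono hline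
    _ = ENNReal.ofReal (2 * R) * (2 * ∫⁻ y, ENNReal.ofReal (s y)) +
      ENNReal.ofReal (2 * R) * (2 * (ENNReal.ofReal (2 * R) * ∫⁻ y, D y)) := by
        rw [lintegral_const_mul' _ _ ENNReal.ofReal_ne_top, lintegral_add_left (by fun_prop),
          lintegral_const_mul' _ _ (by simp), lintegral_const_mul' _ _ (by simp),
          lintegral_const_mul' _ _ ENNReal.ofReal_ne_top, mul_add]
    _ ≤ _ := by
        gcongr
        · exact hsint
        · rw [hD, ← lintegral_eq_lintegral_lines he hmD, lintegral_indicator hΩ.measurableSet]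

end Lines

section Trace

variable {d : ℕ}

local notation "E" => EuclideanSpace ℝ (Fin d)

/-! ### The trace inequality -/

/-- In a boundary chart, the closure of `Ω` lies on or above the graph of `ψ`. -/
theorem le_inner_of_mem_closure {Ω : Set E} {x e : E} {r : ℝ} {ψ : E → ℝ}
    (hψ : Continuous ψ)
    (h : ∀ y ∈ Metric.ball x r, (y ∈ Ω ↔ ψ (y - ⟪y, e⟫_ℝ • e) < ⟪y, e⟫_ℝ)) {y : E}
    (hy : y ∈ Metric.ball x r) (hyΩ : y ∈ closure Ω) : ψ (y - ⟪y, e⟫_ℝ • e) ≤ ⟪y, e⟫_ℝ := by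
  by_contra! hlt
  have hopen : IsOpen {z : E | ⟪z, e⟫_ℝ < ψ (z - ⟪z, e⟫_ℝ • e)} :=
    isOpen_lt (by fun_prop) (by fun_prop)
  obtain ⟨z, ⟨hz1, hz2⟩, hz3⟩ := mem_closure_iff.1 hyΩ _ (hopen.inter Metric.isOpen_ball) ⟨hlt, hy⟩
  exact absurd ((h z hz2).1 hz3) (not_lt.2 (le_of_lt hz1))

/-- In a boundary chart, the boundary lies on the graph of `ψ`. -/
theorem eq_inner_of_mem_frontier {Ω : Set E} (hΩ : IsOpen Ω) {x e : E} {r : ℝ} {ψ : E → ℝ}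
    (hψ : Continuous ψ)
    (h : ∀ y ∈ Metric.ball x r, (y ∈ Ω ↔ ψ (y - ⟪y, e⟫_ℝ • e) < ⟪y, e⟫_ℝ)) {y : E}
    (hy : y ∈ Metric.ball x r) (hyΩ : y ∈ frontier Ω) : ψ (y - ⟪y, e⟫_ℝ • e) = ⟪y, e⟫_ℝ := by
  refine le_antisymm (le_inner_of_mem_closure hψ h hy (frontier_subset_closure hyΩ)) ?_
  rw [hΩ.frontier_eq] at hyΩ
  exact not_lt.1 fun hlt => hyΩ.2 ((h y hy).2 hlt)

/-- A Lipschitz domain has a uniform interior cone at each point of its closure: the shifts by the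
vectors `s v`, where `v` is close to the axis `e`, lead into the domain. -/
theorem exists_interior_cone {Ω : Set E} (hΩ : IsOpen Ω) (hL : HasLipschitzBoundary Ω) {x : E}
    (hx : x ∈ closure Ω) : ∃ (r s₀ : ℝ) (e : E), 0 < r ∧ 0 < s₀ ∧
      ∀ y ∈ closure Ω ∩ Metric.ball x r, ∀ v ∈ Metric.closedBall e 1, ∀ s ∈ Ioc 0 s₀,
        y + s • v ∈ Ω := by
  by_cases hxΩ : x ∈ Ω
  · obtain ⟨r, hr, hball⟩ := Metric.isOpen_iff.1 hΩ x hxΩ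
    refine ⟨r / 2, r / 2, 0, by positivity, by positivity, fun y hy v hv s hs => hball ?_⟩
    have h1 : ‖y - x‖ < r / 2 := by simpa [dist_eq_norm] using hy.2
    have h2 : ‖v‖ ≤ 1 := by simpa using hv
    have h3 : ‖s • v‖ ≤ r / 2 := by
      rw [norm_smul, Real.norm_of_nonneg hs.1.le]
      nlinarith [hs.1, hs.2]
    rw [Metric.mem_ball, dist_eq_norm, add_sub_right_comm]
    linarith [norm_add_le (y - x) (s • v)]
  · obtain ⟨r, e, ψ, L, hr, he, hψ, h⟩ := hL x (by rw [hΩ.frontier_eq]; exact ⟨hx, hxΩ⟩)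
    have hL0 : (0 : ℝ) ≤ L := L.2
    -- A vector within distance `1` of `(L + 2) e` rises by at least `L + 1`, while the graph rises
    -- by at most `L` along its horizontal part.
    refine ⟨r / 2, r / (2 * (L + 4)), ((L : ℝ) + 2) • e, by positivity, by positivity,
      fun y hy v hv s hs => ?_⟩
    set w := v - ((L : ℝ) + 2) • e with hw
    have hv' : v = ((L : ℝ) + 2) • e + w := by rw [hw]; abel
    have hw1 : ‖w‖ ≤ 1 := by simpa [dist_eq_norm] using hv
    have h1 : ‖y - x‖ < r / 2 := by simpa [dist_eq_norm] using hy.2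
    have hvn : ‖v‖ ≤ L + 3 := by
      rw [hv']
      refine (norm_add_le _ _).trans ?_
      rw [norm_smul, he, Real.norm_of_nonneg (by positivity)]
      linarith
    have hsv : ‖s • v‖ < r / 2 := by
      rw [norm_smul, Real.norm_of_nonneg hs.1.le]
      have h2 := hs.2
      rw [le_div_iff₀ (by positivity)] at h2
      nlinarith [hs.1]
    have hyr : y ∈ Metric.ball x r := by
      rw [Metric.mem_ball, dist_eq_norm]; linarith
    have hyv : y + s • v ∈ Metric.ball x r := by
      rw [Metric.mem_ball, dist_eq_norm, add_sub_right_comm]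
      linarith [norm_add_le (y - x) (s • v)]
    rw [h _ hyv]
    have hye := le_inner_of_mem_closure hψ.continuous h hyr hy.1
    have hee : ⟪e, e⟫_ℝ = 1 := by rw [real_inner_self_eq_norm_sq, he]; norm_num
    have hwe : -1 ≤ ⟪w, e⟫_ℝ := by
      have := (abs_le.1 (abs_real_inner_le_norm w e)).1
      rw [he, mul_one] at this
      linarith
    have hinner : ⟪y + s • v, e⟫_ℝ = ⟪y, e⟫_ℝ + s * (L + 2 + ⟪w, e⟫_ℝ) := by
      rw [hv', inner_add_left, inner_smul_left, inner_add_left, inner_smul_left, hee]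
      simp
    have hproj : ‖w - ⟪w, e⟫_ℝ • e‖ ≤ 1 := by
      have h2 : ‖w - ⟪w, e⟫_ℝ • e‖ ^ 2 = ‖w‖ ^ 2 - ⟪w, e⟫_ℝ ^ 2 := by
        rw [norm_sub_sq_real, inner_smul_right, norm_smul, he, Real.norm_eq_abs, mul_one, sq_abs]
        ring
      have h3 : ‖w - ⟪w, e⟫_ℝ • e‖ ^ 2 ≤ 1 := by rw [h2]; nlinarith [norm_nonneg w]
      nlinarith [norm_nonneg (w - ⟪w, e⟫_ℝ • e)]
    have hdiff : ψ (y + s • v - ⟪y + s • v, e⟫_ℝ • e) ≤ ψ (y - ⟪y, e⟫_ℝ • e) + L * s := by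
      have h2 := hψ.dist_le_mul (y + s • v - ⟪y + s • v, e⟫_ℝ • e) (y - ⟪y, e⟫_ℝ • e)
      have h3 : (y + s • v - ⟪y + s • v, e⟫_ℝ • e) - (y - ⟪y, e⟫_ℝ • e) =
          s • (w - ⟪w, e⟫_ℝ • e) := by
        rw [hinner, hv']
        module
      rw [dist_eq_norm, dist_eq_norm, h3, norm_smul, Real.norm_of_nonneg hs.1.le,
        Real.norm_eq_abs] at h2
      have h4 := le_of_abs_le h2
      have h5 : (L : ℝ) * (s * ‖w - ⟪w, e⟫_ℝ • e‖) ≤ L * s := by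
        have := hs.1
        gcongr
        nlinarith
      linarith
    have h6 := hs.1
    nlinarith

/-- A piece of the boundary that is the graph of a Lipschitz function has surface measure at most
a constant times the Lebesgue measure of its projection. -/
theorem exists_surface_le_projection {Ω : Set E} (hΩ : IsOpen Ω) {x e : E} {r : ℝ} {ψ : E → ℝ}
    {L : ℝ≥0} (he : ‖e‖ = 1) (hψ : LipschitzWith L ψ)
    (h : ∀ y ∈ Metric.ball x r, (y ∈ Ω ↔ ψ (y - ⟪y, e⟫_ℝ • e) < ⟪y, e⟫_ℝ)) :
    ((surfaceMeasure Ω).restrict (Metric.ball x r)).map (ℝ ∙ e)ᗮ.orthogonalProjectionOnto ≤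
      ((1 + L : ℝ≥0∞) ^ (d - 1)) • volume := by
  set P := (ℝ ∙ e)ᗮ.orthogonalProjectionOnto with hP
  have hPz : ∀ z : E, (P z : E) = z - ⟪z, e⟫_ℝ • e := by
    intro z
    rw [hP, Submodule.orthogonalProjectionOnto_orthogonal, real_inner_comm,
      ← Submodule.starProjection_unit_singleton ℝ he]
  -- The inverse of the projection on the graph is Lipschitz with constant `1 + L`.
  set G : (ℝ ∙ e)ᗮ → E := fun y => (y : E) + ψ y • e with hG
  have hGL : LipschitzWith (1 + L) G := by
    have h1 : LipschitzWith 1 (fun y : (ℝ ∙ e)ᗮ => (y : E)) := LipschitzWith.subtype_val _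
    have h2 : LipschitzWith L (fun y : (ℝ ∙ e)ᗮ => ψ y • e) := by
      refine LipschitzWith.of_dist_le_mul fun y z => ?_
      rw [dist_eq_norm, ← sub_smul, norm_smul, he, mul_one, ← dist_eq_norm]
      exact hψ.dist_le_mul y z
    exact h1.add h2
  rw [Measure.le_iff]
  intro A hA
  rw [Measure.map_apply P.continuous.measurable hA, surfaceMeasure,
    Measure.restrict_restrict Metric.isOpen_ball.measurableSet,
    Measure.restrict_apply (P.continuous.measurable hA)]
  calc Measure.euclideanHausdorffMeasure (d - 1) (P ⁻¹' A ∩ (Metric.ball x r ∩ frontier Ω))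
      ≤ Measure.euclideanHausdorffMeasure (d - 1) (G '' A) := by
        refine measure_mono ?_
        rintro z ⟨hzA, hzx, hzΩ⟩
        refine ⟨P z, hzA, ?_⟩
        rw [hG]
        simp only
        rw [hPz, eq_inner_of_mem_frontier hΩ hψ.continuous h hzx hzΩ]
        abel
    _ ≤ _ := by
        rw [Measure.smul_apply, ← InnerProductSpace.euclideanHausdorffMeasure_eq_volume,
          finrank_orthogonal_span he, Measure.euclideanHausdorffMeasure_def,
          Measure.euclideanHausdorffMeasure_def, Measure.smul_apply, Measure.smul_apply,
          smul_comm]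
        gcongr
        have := hGL.hausdorffMeasure_image_le (d := ((d - 1 : ℕ) : ℝ)) (Nat.cast_nonneg _) A
        simpa using this

/-- The trace inequality near a boundary point. The value at a boundary point `z` is bounded by
averages over the segment from `z` to `z + δ e`, and the boundary is a Lipschitz graph in the
direction `e`. -/
theorem trace_inequality_local {Ω : Set E} (hΩ : IsOpen Ω) (hL : HasLipschitzBoundary Ω) {x : E}
    (hx : x ∈ frontier Ω) : ∃ r > 0, ∃ C : ℝ≥0∞, C ≠ ⊤ ∧ ∀ φ : E → ℝ, ContDiff ℝ ∞ φ →
      ∫⁻ z in Metric.ball x r, ‖φ z‖ₑ ^ 2 ∂(surfaceMeasure Ω) ≤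
        C * ((∫⁻ z in Ω, ‖φ z‖ₑ ^ 2) + ∫⁻ z in Ω, ‖fderiv ℝ φ z‖ₑ ^ 2) := by
  obtain ⟨r, e, ψ, L, hr, he, hψ, h⟩ := hL x hx
  set δ := r / 2 with hδ
  have hδ0 : 0 < δ := by positivity
  refine ⟨r / 2, by positivity, (ENNReal.ofReal δ)⁻¹ * ((1 + L : ℝ≥0∞) ^ (d - 1) *
    (2 + 2 * (ENNReal.ofReal δ * ENNReal.ofReal δ))), ?_, fun φ hφ => ?_⟩
  · refine ENNReal.mul_ne_top (by simpa using hδ0) (ENNReal.mul_ne_top ?_ ?_)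
    · exact ENNReal.pow_ne_top (by simp)
    · simp [ENNReal.mul_eq_top]
  set P := (ℝ ∙ e)ᗮ.orthogonalProjectionOnto with hP
  have hPz : ∀ z : E, (P z : E) = z - ⟪z, e⟫_ℝ • e := by
    intro z
    rw [hP, Submodule.orthogonalProjectionOnto_orthogonal, real_inner_comm,
      ← Submodule.starProjection_unit_singleton ℝ he]
  have hee : ⟪e, e⟫_ℝ = 1 := by rw [real_inner_self_eq_norm_sq, he]; norm_num
  have hcd : Continuous fun z => fderiv ℝ φ z e :=
    (hφ.continuous_fderiv (by simp)).clm_apply continuous_const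
  have hcφ := hφ.continuous
  -- `F` majorises the integrand on the segments, and `H` integrates it over entire lines, so that
  -- only the projection of the boundary point matters.
  set F : E → ℝ≥0∞ := Ω.indicator fun z => 2 * ‖φ z‖ₑ ^ 2 +
    2 * (ENNReal.ofReal δ * ENNReal.ofReal δ) * ‖fderiv ℝ φ z e‖ₑ ^ 2 with hF
  have hFm : Measurable F := Measurable.indicator (by fun_prop) hΩ.measurableSet
  set H : (ℝ ∙ e)ᗮ → ℝ≥0∞ := fun y => ∫⁻ t : ℝ, F (y + t • e) with hH
  have hHm : Measurable H := by
    have : Measurable fun p : (ℝ ∙ e)ᗮ × ℝ => F (p.1 + p.2 • e) := hFm.comp (by fun_prop)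
    exact this.lintegral_prod_right'
  have hseg : ∀ z ∈ Metric.ball x (r / 2) ∩ frontier Ω, ∀ t ∈ Ioo 0 δ, z + t • e ∈ Ω := by
    intro z hz t ht
    have h1 : ‖z - x‖ < r / 2 := by simpa [dist_eq_norm] using hz.1
    have h2 : ‖t • e‖ < r / 2 := by
      rw [norm_smul, he, Real.norm_of_nonneg ht.1.le]; linarith [ht.2]
    have hzr : z ∈ Metric.ball x r := by
      rw [Metric.mem_ball, dist_eq_norm]; linarith
    have hzt : z + t • e ∈ Metric.ball x r := by
      rw [Metric.mem_ball, dist_eq_norm, add_sub_right_comm]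
      linarith [norm_add_le (z - x) (t • e)]
    rw [h _ hzt]
    have h3 : ⟪z + t • e, e⟫_ℝ = ⟪z, e⟫_ℝ + t := by
      rw [inner_add_left, inner_smul_left, hee]; simp
    have h4 : z + t • e - (⟪z, e⟫_ℝ + t) • e = z - ⟪z, e⟫_ℝ • e := by module
    rw [h3, h4, eq_inner_of_mem_frontier hΩ hψ.continuous h hzr hz.2]
    linarith [ht.1]
  have hpt : ∀ z ∈ Metric.ball x (r / 2) ∩ frontier Ω,
      ENNReal.ofReal δ * ‖φ z‖ₑ ^ 2 ≤ H (P z) := by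
    intro z hz
    have hder : ∀ τ : ℝ, HasDerivAt (fun τ : ℝ => φ (z + τ • e)) (fderiv ℝ φ (z + τ • e) e) τ := by
      intro τ
      have h1 : HasDerivAt (fun τ : ℝ => z + τ • e) e τ := by
        simpa using ((hasDerivAt_id τ).smul_const e).const_add z
      exact (hφ.differentiable (by simp) _).hasFDerivAt.comp_hasDerivAt τ h1
    have h1 : ∀ t ∈ Ioo 0 δ, ‖φ z‖ₑ ^ 2 ≤ 2 * ‖φ (z + t • e)‖ₑ ^ 2 +
        2 * (ENNReal.ofReal δ * ∫⁻ τ in Ioo 0 δ, ‖fderiv ℝ φ (z + τ • e) e‖ₑ ^ 2) := by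
      intro t ht
      have := enorm_sq_le_of_hasDerivAt ht.1.le hder (by fun_prop)
      simp only [zero_smul, add_zero, sub_zero] at this
      refine this.trans ?_
      rw [← restrict_Ioo_eq_restrict_Ioc]
      gcongr
      · exact ht.2.le
      · exact ht.2.le
    calc ENNReal.ofReal δ * ‖φ z‖ₑ ^ 2 = ∫⁻ t in Ioo 0 δ, ‖φ z‖ₑ ^ 2 := by
          rw [setLIntegral_const, Real.volume_Ioo, sub_zero, mul_comm]
      _ ≤ ∫⁻ t in Ioo 0 δ, (2 * ‖φ (z + t • e)‖ₑ ^ 2 +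
          2 * (ENNReal.ofReal δ * ∫⁻ τ in Ioo 0 δ, ‖fderiv ℝ φ (z + τ • e) e‖ₑ ^ 2)) :=
          setLIntegral_mono' measurableSet_Ioo h1
      _ = ∫⁻ t in Ioo 0 δ, (2 * ‖φ (z + t • e)‖ₑ ^ 2 +
          2 * (ENNReal.ofReal δ * ENNReal.ofReal δ) * ‖fderiv ℝ φ (z + t • e) e‖ₑ ^ 2) := by
          have hm : Measurable fun t : ℝ => ‖φ (z + t • e)‖ₑ ^ 2 :=
            (hcφ.comp (by fun_prop : Continuous fun t : ℝ => z + t • e)).measurable.enorm.pow_const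
              2
          have hm' : Measurable fun t : ℝ => ‖fderiv ℝ φ (z + t • e) e‖ₑ ^ 2 :=
            (hcd.comp (by fun_prop : Continuous fun t : ℝ => z + t • e)).measurable.enorm.pow_const
              2
          rw [lintegral_add_left (hm.const_mul 2), lintegral_add_left (hm.const_mul 2),
            setLIntegral_const, Real.volume_Ioo, sub_zero, lintegral_const_mul _ hm,
            lintegral_const_mul _ hm']
          ring
      _ ≤ ∫⁻ t : ℝ, F (z + t • e) := by
          rw [← lintegral_indicator measurableSet_Ioo]
          refine lintegral_mono fun t => ?_
          by_cases ht : t ∈ Ioo 0 δ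
          · rw [indicator_of_mem ht, hF, indicator_of_mem (hseg z hz t ht)]
          · rw [indicator_of_notMem ht]
            exact zero_le
      _ = ∫⁻ t : ℝ, F (P z + (t + ⟪z, e⟫_ℝ) • e) := by
          refine lintegral_congr fun t => ?_
          rw [hPz]
          congr 1
          module
      _ = H (P z) := lintegral_add_right_eq_self (fun t : ℝ => F (P z + t • e)) ⟪z, e⟫_ℝ
  have hle := exists_surface_le_projection hΩ he hψ h
  have hmain : ENNReal.ofReal δ * ∫⁻ z in Metric.ball x (r / 2), ‖φ z‖ₑ ^ 2 ∂(surfaceMeasure Ω) ≤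
      (1 + L : ℝ≥0∞) ^ (d - 1) * ∫⁻ z, F z := by
    rw [← lintegral_const_mul' _ _ ENNReal.ofReal_ne_top]
    calc ∫⁻ z in Metric.ball x (r / 2), ENNReal.ofReal δ * ‖φ z‖ₑ ^ 2 ∂(surfaceMeasure Ω)
        ≤ ∫⁻ z in Metric.ball x (r / 2), H (P z) ∂(surfaceMeasure Ω) := by
          rw [surfaceMeasure, Measure.restrict_restrict Metric.isOpen_ball.measurableSet]
          exact setLIntegral_mono' (Metric.isOpen_ball.measurableSet.inter
            isClosed_frontier.measurableSet) hpt
      _ ≤ ∫⁻ z in Metric.ball x r, H (P z) ∂(surfaceMeasure Ω) :=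
          lintegral_mono_set (Metric.ball_subset_ball (by linarith))
      _ = ∫⁻ y, H y ∂((surfaceMeasure Ω).restrict (Metric.ball x r)).map P :=
          (lintegral_map hHm P.continuous.measurable).symm
      _ ≤ ∫⁻ y, H y ∂(((1 + L : ℝ≥0∞) ^ (d - 1)) • volume) := lintegral_mono' hle le_rfl
      _ = _ := by
          rw [lintegral_smul_measure, smul_eq_mul, hH, ← lintegral_eq_lintegral_lines he hFm]
  have hFle : ∫⁻ z, F z ≤ (2 + 2 * (ENNReal.ofReal δ * ENNReal.ofReal δ)) *
      ((∫⁻ z in Ω, ‖φ z‖ₑ ^ 2) + ∫⁻ z in Ω, ‖fderiv ℝ φ z‖ₑ ^ 2) := by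
    have hen : ∀ z, ‖fderiv ℝ φ z e‖ₑ ≤ ‖fderiv ℝ φ z‖ₑ := by
      intro z
      have := (fderiv ℝ φ z).le_opENorm e
      rwa [← ofReal_norm e, he, ENNReal.ofReal_one, mul_one] at this
    rw [hF, lintegral_indicator hΩ.measurableSet, lintegral_add_left (by fun_prop),
      lintegral_const_mul _ (by fun_prop), lintegral_const_mul _ (by fun_prop), mul_add]
    gcongr
    · exact le_self_add
    · exact le_add_self
    · exact hen _
  have hδ1 : ENNReal.ofReal δ ≠ 0 := by simpa using hδ0
  rw [mul_assoc, mul_assoc, ← ENNReal.div_eq_inv_mul, ENNReal.le_div_iff_mul_le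
    (Or.inl hδ1) (Or.inl ENNReal.ofReal_ne_top), mul_comm]
  refine hmain.trans ?_
  gcongr

/-- The trace inequality for smooth functions on a bounded Lipschitz domain. -/
theorem trace_inequality_smooth {Ω : Set E} (hΩ : IsOpen Ω) (hb : Bornology.IsBounded Ω)
    (hL : HasLipschitzBoundary Ω) : ∃ C : ℝ≥0∞, C ≠ ⊤ ∧ ∀ φ : E → ℝ, ContDiff ℝ ∞ φ →
      ∫⁻ z, ‖φ z‖ₑ ^ 2 ∂(surfaceMeasure Ω) ≤
        C * ((∫⁻ z in Ω, ‖φ z‖ₑ ^ 2) + ∫⁻ z in Ω, ‖fderiv ℝ φ z‖ₑ ^ 2) := by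
  have hΓ : IsCompact (frontier Ω) :=
    hb.isCompact_closure.of_isClosed_subset isClosed_frontier frontier_subset_closure
  have key : ∃ C : ℝ≥0∞, C ≠ ⊤ ∧ ∀ φ : E → ℝ, ContDiff ℝ ∞ φ →
      ∫⁻ z in frontier Ω, ‖φ z‖ₑ ^ 2 ∂(surfaceMeasure Ω) ≤
        C * ((∫⁻ z in Ω, ‖φ z‖ₑ ^ 2) + ∫⁻ z in Ω, ‖fderiv ℝ φ z‖ₑ ^ 2) := by
    refine hΓ.induction_on (p := fun s => ∃ C : ℝ≥0∞, C ≠ ⊤ ∧ ∀ φ : E → ℝ, ContDiff ℝ ∞ φ →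
      ∫⁻ z in s, ‖φ z‖ₑ ^ 2 ∂(surfaceMeasure Ω) ≤
        C * ((∫⁻ z in Ω, ‖φ z‖ₑ ^ 2) + ∫⁻ z in Ω, ‖fderiv ℝ φ z‖ₑ ^ 2)) ?_ ?_ ?_ ?_
    · exact ⟨0, by simp, by simp⟩
    · rintro s t hst ⟨C, hC, h⟩
      exact ⟨C, hC, fun φ hφ => (lintegral_mono_set hst).trans (h φ hφ)⟩
    · rintro s t ⟨C, hC, h⟩ ⟨C', hC', h'⟩
      refine ⟨C + C', by simp [hC, hC'], fun φ hφ => ?_⟩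
      refine (lintegral_union_le _ _ _).trans ?_
      rw [add_mul]
      exact add_le_add (h φ hφ) (h' φ hφ)
    · intro x hx
      obtain ⟨r, hr, C, hC, h⟩ := trace_inequality_local hΩ hL hx
      exact ⟨_, mem_nhdsWithin_of_mem_nhds (Metric.ball_mem_nhds x hr), C, hC, h⟩
  rwa [surfaceMeasure, Measure.restrict_restrict isClosed_frontier.measurableSet,
    inter_self] at key

/-- The boundary has finite surface measure, by the trace inequality for the constant function `1`.
-/
theorem isFiniteMeasure_surfaceMeasure {Ω : Set E} (hΩ : IsOpen Ω) (hb : Bornology.IsBounded Ω)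
    (hL : HasLipschitzBoundary Ω) : IsFiniteMeasure (surfaceMeasure Ω) := by
  obtain ⟨C, hC, h⟩ := trace_inequality_smooth hΩ hb hL
  have := h (fun _ => 1) contDiff_const
  have hv : volume Ω < ⊤ := hb.measure_lt_top
  simp only [enorm_one, one_pow, lintegral_const, one_mul, Measure.restrict_apply_univ,
    fderiv_fun_const, Pi.zero_apply] at this
  refine ⟨this.trans_lt (ENNReal.mul_lt_top hC.lt_top (ENNReal.add_lt_top.2 ⟨hv, ?_⟩))⟩
  exact ENNReal.mul_lt_top (ENNReal.pow_lt_top enorm_lt_top) hv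

end Trace

section Energy

variable {d : ℕ} {Ω : Set (EuclideanSpace ℝ (Fin d))}

local notation "E" => EuclideanSpace ℝ (Fin d)

/-! ### The energy space -/

theorem enorm_sq_eq_lintegral {α : Type*} [MeasurableSpace α] {μ : Measure α} (f : Lp ℝ 2 μ) :
    ‖f‖ₑ ^ 2 = ∫⁻ x, ‖f x‖ₑ ^ 2 ∂μ := by
  have := eLpNorm_nnreal_pow_eq_lintegral (μ := μ) (f := f) (p := 2) (by norm_num)
  simpa [Lp.enorm_def] using this

theorem enorm_sq_eq_lintegral_of_ae {α : Type*} [MeasurableSpace α] {μ : Measure α} (f : Lp ℝ 2 μ)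
    {g : α → ℝ} (h : f =ᵐ[μ] g) : ‖f‖ₑ ^ 2 = ∫⁻ x, ‖g x‖ₑ ^ 2 ∂μ := by
  rw [enorm_sq_eq_lintegral]
  exact lintegral_congr_ae (h.mono fun x hx => by simp only [hx])

theorem ofReal_norm_sq {F : Type*} [SeminormedAddGroup F] (f : F) :
    ENNReal.ofReal (‖f‖ ^ 2) = ‖f‖ₑ ^ 2 := by
  rw [ENNReal.ofReal_pow (norm_nonneg f), ofReal_norm]

theorem contDiff_pderiv {φ : E → ℝ} (hφ : ContDiff ℝ ∞ φ) (i : Fin d) :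
    ContDiff ℝ ∞ (pderiv i φ) :=
  (hφ.fderiv_right (m := ∞) (by simp)).clm_apply contDiff_const

theorem tsupport_pderiv_subset (φ : E → ℝ) (i : Fin d) : tsupport (pderiv i φ) ⊆ tsupport φ :=
  tsupport_fderiv_apply_subset ℝ _

theorem hasCompactSupport_pderiv {φ : E → ℝ} (hφ : HasCompactSupport φ) (i : Fin d) :
    HasCompactSupport (pderiv i φ) :=
  hφ.of_isClosed_subset (isClosed_tsupport _) (tsupport_pderiv_subset φ i)

theorem H1.norm_sq (p : H1 Ω) : ‖p‖ ^ 2 = ‖p.1.fst‖ ^ 2 + ∑ i, ‖p.1.snd i‖ ^ 2 := by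
  change ‖p.1‖ ^ 2 = _
  rw [WithLp.prod_norm_sq_eq_of_L2, PiLp.norm_sq_eq_of_L2]

theorem H2.norm_sq (p : H2 Ω) :
    ‖p‖ ^ 2 = ‖p.1.fst‖ ^ 2 + ∑ k, ‖p.1.snd k‖ ^ 2 := by
  change ‖p.1‖ ^ 2 = _
  rw [WithLp.prod_norm_sq_eq_of_L2, PiLp.norm_sq_eq_of_L2]

theorem EnergySpace.norm_sq (v : EnergySpace Ω) : ‖v‖ ^ 2 = ‖v.toH1‖ ^ 2 + ‖v.trace‖ ^ 2 := by
  change ‖v.1‖ ^ 2 = _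
  rw [WithLp.prod_norm_sq_eq_of_L2]
  rfl

theorem norm_toH1_sq (v : EnergySpace Ω) :
    ‖v.toH1‖ ^ 2 = ‖v.toL2‖ ^ 2 + ∑ i, ‖v.grad i‖ ^ 2 := H1.norm_sq _

/-- The operator norm of a linear form on Euclidean space is controlled by its coordinates. -/
theorem enorm_fderiv_sq_le (φ : E → ℝ) (x : E) :
    ‖fderiv ℝ φ x‖ₑ ^ 2 ≤ ∑ i, ‖pderiv i φ x‖ₑ ^ 2 := by
  set A := fderiv ℝ φ x with hA
  have hAv : ∀ v : E, A v = ∑ i, v i * pderiv i φ x := by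
    intro v
    conv_lhs => rw [← (EuclideanSpace.basisFun (Fin d) ℝ).sum_repr v]
    simp [map_sum, pderiv, hA]
  have h0 : 0 ≤ ∑ i, pderiv i φ x ^ 2 := Finset.sum_nonneg fun i _ => sq_nonneg _
  have h1 : ‖A‖ ≤ √(∑ i, pderiv i φ x ^ 2) := by
    refine A.opNorm_le_bound (Real.sqrt_nonneg _) fun v => ?_
    rw [Real.norm_eq_abs, ← Real.sqrt_sq (norm_nonneg v), ← Real.sqrt_mul h0, hAv]
    refine Real.abs_le_sqrt ?_
    rw [EuclideanSpace.norm_sq_eq, mul_comm]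
    simpa using Finset.sum_mul_sq_le_sq_mul_sq Finset.univ (fun i => v i) (fun i => pderiv i φ x)
  have h2 : ‖A‖ ^ 2 ≤ ∑ i, pderiv i φ x ^ 2 := by
    calc ‖A‖ ^ 2 ≤ √(∑ i, pderiv i φ x ^ 2) ^ 2 := by gcongr
      _ = _ := Real.sq_sqrt h0
  rw [← ofReal_norm_sq]
  refine (ENNReal.ofReal_le_ofReal h2).trans ?_
  rw [ENNReal.ofReal_sum_of_nonneg fun i _ => sq_nonneg _]
  refine Finset.sum_le_sum fun i _ => ?_
  rw [← ofReal_norm_sq, Real.norm_eq_abs, sq_abs]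

/-- The trace inequality on the energy space, from `trace_inequality_smooth` by density. -/
theorem exists_trace_le (hΩ : IsOpen Ω) (hb : Bornology.IsBounded Ω)
    (hL : HasLipschitzBoundary Ω) :
    ∃ C > 0, ∀ v : EnergySpace Ω, ‖v.trace‖ ^ 2 ≤ C * ‖v.toH1‖ ^ 2 := by
  obtain ⟨C, hC, h⟩ := trace_inequality_smooth hΩ hb hL
  refine ⟨C.toReal + 1, by positivity, fun v => ?_⟩
  have hsm : ∀ p ∈ smoothGraph Ω, ‖p.snd‖ ^ 2 ≤ (C.toReal + 1) * ‖p.fst‖ ^ 2 := by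
    rintro p ⟨φ, h1, h2, h3, h4⟩
    have key : ‖p.snd‖ ^ 2 ≤ C.toReal * ‖p.fst‖ ^ 2 := by
      rw [← ENNReal.ofReal_le_ofReal_iff (by positivity), ENNReal.ofReal_mul ENNReal.toReal_nonneg,
        ENNReal.ofReal_toReal hC, ofReal_norm_sq, enorm_sq_eq_lintegral_of_ae _ h4]
      refine (h φ h1).trans ?_
      gcongr
      rw [H1.norm_sq, ENNReal.ofReal_add (by positivity) (by positivity), ofReal_norm_sq,
        enorm_sq_eq_lintegral_of_ae _ h2, ENNReal.ofReal_sum_of_nonneg fun _ _ => sq_nonneg _]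
      gcongr
      refine (lintegral_mono fun x => enorm_fderiv_sq_le φ x).trans ?_
      have hc : ∀ i, Continuous (pderiv i φ) := fun i => (contDiff_pderiv h1 i).continuous
      rw [lintegral_finsetSum _ fun i _ => ((hc i).measurable.enorm.pow_const 2)]
      refine Finset.sum_le_sum fun i _ => ?_
      rw [ofReal_norm_sq, enorm_sq_eq_lintegral_of_ae _ (h3 i)]
    nlinarith [sq_nonneg ‖p.fst‖]
  have hcl : IsClosed {p : WithLp 2 (H1 Ω × L2Bdry Ω) |
      ‖p.snd‖ ^ 2 ≤ (C.toReal + 1) * ‖p.fst‖ ^ 2} := isClosed_le (by fun_prop) (by fun_prop)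
  exact closure_minimal hsm hcl v.2

/-- Friedrichs' inequality on the energy space, from `friedrichs_smooth` by density. -/
theorem exists_friedrichs (hd : 1 ≤ d) (hΩ : IsOpen Ω) (hb : Bornology.IsBounded Ω) :
    ∃ C > 0, ∀ v : EnergySpace Ω,
      ‖v.toL2‖ ^ 2 ≤ C * (∑ i, ‖v.grad i‖ ^ 2 + ‖v.trace‖ ^ 2) := by
  obtain ⟨R, hR⟩ := hb.subset_closedBall 0
  set e : E := EuclideanSpace.single ⟨0, hd⟩ 1 with he
  have he1 : ‖e‖ = 1 := by simp [he]
  set D := max (2 * R) 0 with hD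
  set C := 2 * D + 2 * D * D + 1 with hC
  have hD0 : 0 ≤ D := le_max_right _ _
  refine ⟨C, by positivity, fun v => ?_⟩
  have hsm : ∀ p ∈ smoothGraph Ω,
      ‖p.fst.1.fst‖ ^ 2 ≤ C * (∑ i, ‖p.fst.1.snd i‖ ^ 2 + ‖p.snd‖ ^ 2) := by
    rintro p ⟨φ, h1, h2, h3, h4⟩
    have key := friedrichs_smooth hΩ he1 hR h1
    have h5 : ENNReal.ofReal (2 * R) = ENNReal.ofReal D := by
      rw [hD, ENNReal.ofReal_max]; simp
    have h6 := enorm_sq_eq_lintegral_of_ae _ (h3 ⟨0, hd⟩)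
    have h7 : ∀ x, pderiv ⟨0, hd⟩ φ x = fderiv ℝ φ x e := fun x => rfl
    simp only [h7] at h6
    have h2' : (2 : ℝ≥0∞) = ENNReal.ofReal 2 := by simp
    rw [← enorm_sq_eq_lintegral_of_ae _ h2, ← enorm_sq_eq_lintegral_of_ae _ h4, ← h6, h5,
      ← ofReal_norm_sq, ← ofReal_norm_sq, ← ofReal_norm_sq,
      ← ENNReal.ofReal_mul hD0] at key
    simp only [h2', ← ENNReal.ofReal_mul hD0,
      ← ENNReal.ofReal_mul (show (0 : ℝ) ≤ 2 by norm_num)] at key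
    rw [← ENNReal.ofReal_add (by positivity) (by positivity),
      ENNReal.ofReal_le_ofReal_iff (by positivity)] at key
    have h8 : ‖p.fst.1.snd ⟨0, hd⟩‖ ^ 2 ≤ ∑ i, ‖p.fst.1.snd i‖ ^ 2 :=
      Finset.single_le_sum (f := fun i => ‖p.fst.1.snd i‖ ^ 2) (fun i _ => sq_nonneg _)
        (Finset.mem_univ _)
    have h9 := mul_le_mul_of_nonneg_left h8 (by positivity : 0 ≤ D * (2 * D))
    have h10 : 0 ≤ ∑ i, ‖p.fst.1.snd i‖ ^ 2 := by positivity
    have h11 := sq_nonneg ‖p.snd‖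
    have h12 := mul_nonneg (by positivity : 0 ≤ 2 * D + 1) h10
    have h13 := mul_nonneg (by positivity : 0 ≤ 2 * D * D + 1) h11
    rw [hC]
    nlinarith
  have hcl : IsClosed {p : WithLp 2 (H1 Ω × L2Bdry Ω) |
      ‖p.fst.1.fst‖ ^ 2 ≤ C * (∑ i, ‖p.fst.1.snd i‖ ^ 2 + ‖p.snd‖ ^ 2)} :=
    isClosed_le (by fun_prop) (by fun_prop)
  exact closure_minimal hsm hcl v.2

/-- A smooth function on a bounded Lipschitz domain, as an element of the energy space. Its boundary
values are square integrable because the surface measure is finite. -/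
theorem exists_energySpace_of_smooth (hΩ : IsOpen Ω) (hb : Bornology.IsBounded Ω)
    (hL : HasLipschitzBoundary Ω) {φ : E → ℝ} (hφ : ContDiff ℝ ∞ φ) :
    ∃ v : EnergySpace Ω, v.toL2 =ᵐ[volume.restrict Ω] φ ∧
      ∀ i, v.grad i =ᵐ[volume.restrict Ω] pderiv i φ := by
  have := isFiniteMeasure_surfaceMeasure hΩ hb hL
  have : IsFiniteMeasure (volume.restrict Ω) := ⟨by simpa using hb.measure_lt_top⟩
  have hc : ∀ i, Continuous (pderiv i φ) := fun i => (contDiff_pderiv hφ i).continuous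
  have hmem : ∀ (μ : Measure E) [IsFiniteMeasure μ] (K : Set E), IsCompact K → (∀ᵐ x ∂μ, x ∈ K) →
      ∀ g : E → ℝ, Continuous g → MemLp g 2 μ := by
    intro μ _ K hK hμ g hg
    obtain ⟨B, hB⟩ := hK.exists_bound_of_continuousOn hg.continuousOn
    exact MemLp.of_bound hg.aestronglyMeasurable B (hμ.mono hB)
  have hcl : IsCompact (closure Ω) := hb.isCompact_closure
  have hΩae : ∀ᵐ x ∂(volume.restrict Ω), x ∈ closure Ω :=
    (ae_restrict_mem hΩ.measurableSet).mono fun x hx => subset_closure hx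
  have hΓae : ∀ᵐ x ∂(surfaceMeasure Ω), x ∈ closure Ω :=
    (ae_restrict_mem isClosed_frontier.measurableSet).mono fun x hx => frontier_subset_closure hx
  have m0 := hmem _ _ hcl hΩae φ hφ.continuous
  have m1 := fun i => hmem _ _ hcl hΩae (pderiv i φ) (hc i)
  have m2 := hmem _ _ hcl hΓae φ hφ.continuous
  have hH1 : (WithLp.toLp 2 ((m0.toLp φ), WithLp.toLp 2 fun i => ((m1 i).toLp (pderiv i φ))) :
      WithLp 2 (L2Bulk Ω × PiLp 2 (fun _ : Fin d => L2Bulk Ω))) ∈ H1 Ω := by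
    intro i χ hχ hχc hχΩ
    have hχ' : Differentiable ℝ χ := hχ.differentiable (by simp)
    have hφ' : Differentiable ℝ φ := hφ.differentiable (by simp)
    have hcχ : Continuous (pderiv i χ) := (contDiff_pderiv hχ i).continuous
    have hsup : HasCompactSupport (pderiv i χ) := hasCompactSupport_pderiv hχc i
    have e1 : ∫ x in Ω, (m0.toLp φ) x * pderiv i χ x = ∫ x, φ x * pderiv i χ x := by
      refine Eq.trans ?_ (setIntegral_eq_integral_of_forall_compl_eq_zero (s := Ω) ?_)
      · exact integral_congr_ae (m0.coeFn_toLp.mono fun x hx => by simp only [hx])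
      · intro x hx
        rw [image_eq_zero_of_notMem_tsupport fun h => hx (hχΩ (tsupport_pderiv_subset _ _ h)),
          mul_zero]
    have e2 : ∫ x in Ω, ((m1 i).toLp (pderiv i φ)) x * χ x = ∫ x, pderiv i φ x * χ x := by
      refine Eq.trans ?_ (setIntegral_eq_integral_of_forall_compl_eq_zero (s := Ω) ?_)
      · exact integral_congr_ae ((m1 i).coeFn_toLp.mono fun x hx => by simp only [hx])
      · intro x hx
        rw [image_eq_zero_of_notMem_tsupport fun h => hx (hχΩ h), mul_zero]
    change ∫ x in Ω, (m0.toLp φ) x * pderiv i χ x = -∫ x in Ω, ((m1 i).toLp (pderiv i φ)) x * χ x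
    rw [e1, e2]
    exact integral_mul_fderiv_eq_neg_fderiv_mul_of_integrable
      (((hc i).mul hχ.continuous).integrable_of_hasCompactSupport hχc.mul_left)
      ((hφ.continuous.mul hcχ).integrable_of_hasCompactSupport hsup.mul_left)
      ((hφ.continuous.mul hχ.continuous).integrable_of_hasCompactSupport hχc.mul_left)
      (fun x _ => hφ' x) (fun x _ => hχ' x)
  refine ⟨⟨WithLp.toLp 2 (⟨_, hH1⟩, m2.toLp φ), subset_closure
    ⟨φ, hφ, m0.coeFn_toLp, fun i => (m1 i).coeFn_toLp, m2.coeFn_toLp⟩⟩, m0.coeFn_toLp,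
    fun i => (m1 i).coeFn_toLp⟩

end Energy

section Mollify

variable {d : ℕ} {Ω : Set (EuclideanSpace ℝ (Fin d))}

local notation "E" => EuclideanSpace ℝ (Fin d)

/-! ### Localised weak derivatives and mollification -/

/-- `G` is the weak derivative `∂ᵢ F` in a neighbourhood of the part of `K` inside `Ω`: it may be
tested with all functions whose support meets `K` only inside `Ω`. This holds for functions on `Ω`
cut off outside `K` and extended by zero. -/
def IsLocalWeakDeriv (Ω K : Set E) (i : Fin d) (F G : E → ℝ) : Prop :=
  ∀ φ : E → ℝ, ContDiff ℝ ∞ φ → HasCompactSupport φ → tsupport φ ∩ K ⊆ Ω →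
    ∫ x, F x * pderiv i φ x = -∫ x, G x * φ x

/-- The shifts by `s v` with `‖v - e‖ ≤ 1` and `0 < s ≤ ε` of points in the closure of `Ω` stay in
`Ω`, as long as they stay in `K`. -/
def HasInwardShifts (Ω K : Set E) (e : E) (ε : ℝ) : Prop :=
  ∀ y ∈ closure Ω, ∀ v ∈ Metric.closedBall e 1, ∀ s ∈ Ioc 0 ε, y + s • v ∈ K → y + s • v ∈ Ω

theorem HasInwardShifts.mono {K : Set E} {e : E} {ε δ : ℝ} (h : HasInwardShifts Ω K e ε)
    (hδ : δ ≤ ε) : HasInwardShifts Ω K e δ :=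
  fun y hy v hv s hs => h y hy v hv s ⟨hs.1, hs.2.trans hδ⟩

/-- Localised form of the interior cone property: near each point of the closure of a Lipschitz
domain there is a direction `e` of inward shifts. The radius is shrunk so that a shifted point in
the ball has its original point in the larger ball of the cone property. -/
theorem exists_hasInwardShifts (hΩ : IsOpen Ω) (hL : HasLipschitzBoundary Ω) {x : E}
    (hx : x ∈ closure Ω) : ∃ r > 0, ∃ e, ∃ ε > 0,
      HasInwardShifts Ω (Metric.closedBall x r) e ε := by
  obtain ⟨r, s₀, e, hr, hs₀, h⟩ := exists_interior_cone hΩ hL hx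
  have he := norm_nonneg e
  refine ⟨r / 2, by positivity, e, min s₀ (r / (2 * (‖e‖ + 2))), by positivity,
    fun y hy v hv s hs hyK => h y ⟨hy, ?_⟩ v hv s ⟨hs.1, hs.2.trans (min_le_left _ _)⟩⟩
  have h1 : ‖v‖ ≤ ‖e‖ + 1 := by
    have : ‖v - e‖ ≤ 1 := by simpa [dist_eq_norm] using hv
    have h2 := norm_add_le (v - e) e
    rw [sub_add_cancel] at h2
    linarith
  have h2 : ‖s • v‖ < r / 2 := by
    have h3 := hs.2.trans (min_le_right _ _)
    rw [le_div_iff₀ (by positivity)] at h3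
    rw [norm_smul, Real.norm_of_nonneg hs.1.le]
    nlinarith [hs.1]
  have h3 : ‖y + s • v - x‖ ≤ r / 2 := by simpa [dist_eq_norm] using hyK
  rw [Metric.mem_ball, dist_eq_norm]
  have h4 := norm_sub_le (y + s • v - x) (s • v)
  have h5 : y + s • v - x - s • v = y - x := by abel
  rw [h5] at h4
  linarith

/-- The average of the values `F (x + w)` with weight `κ w`. -/
noncomputable def mollify (κ F : E → ℝ) (x : E) : ℝ := ∫ z, F z * κ (z - x)

theorem mollify_eq_convolution (κ F : E → ℝ) :
    mollify κ F = convolution F (fun y => κ (-y)) (ContinuousLinearMap.mul ℝ ℝ) volume := by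
  funext x
  simp [mollify, convolution]

theorem mollify_eq (κ F : E → ℝ) (x : E) : mollify κ F x = ∫ w, F (x + w) * κ w := by
  rw [mollify, ← integral_add_left_eq_self (fun z => F z * κ (z - x)) x]
  simp

theorem hasCompactSupport_comp_neg {κ : E → ℝ} (hκ : HasCompactSupport κ) :
    HasCompactSupport fun y => κ (-y) :=
  hκ.comp_homeomorph (Homeomorph.neg E)

theorem contDiff_mollify {κ F : E → ℝ} (hκ : ContDiff ℝ ∞ κ) (hκc : HasCompactSupport κ)
    (hF : LocallyIntegrable F) : ContDiff ℝ ∞ (mollify κ F) := by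
  rw [mollify_eq_convolution]
  exact (hasCompactSupport_comp_neg hκc).contDiff_convolution_right _ hF (hκ.comp contDiff_neg)

/-- Derivatives of an average fall on the weight; the sign is due to averaging over `x + w` instead
of `x - w`. -/
theorem pderiv_mollify {κ F : E → ℝ} (hκ : ContDiff ℝ ∞ κ) (hκc : HasCompactSupport κ)
    (hF : LocallyIntegrable F) (i : Fin d) (x : E) :
    pderiv i (mollify κ F) x = -mollify (pderiv i κ) F x := by
  have hneg := hasCompactSupport_comp_neg hκc
  have hs : ContDiff ℝ ∞ fun y => κ (-y) := hκ.comp contDiff_neg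
  have h1 := hneg.hasFDerivAt_convolution_right (ContinuousLinearMap.mul ℝ ℝ) hF
    (hs.of_le (by simp)) x
  rw [← mollify_eq_convolution] at h1
  have h2 : ∀ y, fderiv ℝ (fun y => κ (-y)) y (EuclideanSpace.single i 1) =
      -pderiv i κ (-y) := by
    intro y
    have h3 := ((hκ.differentiable (by simp) (-y)).hasFDerivAt.comp y (hasFDerivAt_id y).neg).fderiv
    change fderiv ℝ (κ ∘ fun y => -y) y _ = _
    rw [h3]
    simp [pderiv]
  rw [pderiv, h1.fderiv, convolution_precompR_apply _ hF (hneg.fderiv ℝ)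
    (hs.continuous_fderiv (by simp)), mollify, ← integral_neg]
  simp [convolution, h2]

theorem tsupport_comp_sub (κ : E → ℝ) (x : E) :
    tsupport (fun z => κ (z - x)) = (fun z => z - x) ⁻¹' tsupport κ :=
  tsupport_comp_eq_preimage κ (Homeomorph.subRight x)

theorem pderiv_comp_sub (κ : E → ℝ) (i : Fin d) (x z : E) :
    pderiv i (fun z => κ (z - x)) z = pderiv i κ (z - x) := by
  rw [pderiv, fderiv_comp_sub]
  rfl

/-- Derivatives of an average are averages of weak derivatives, as long as the averages reach the
part of `K` inside `Ω` only. -/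
theorem IsLocalWeakDeriv.mollify_pderiv {K : Set E} {i : Fin d} {F G : E → ℝ}
    (h : IsLocalWeakDeriv Ω K i F G) {κ : E → ℝ} (hκ : ContDiff ℝ ∞ κ) (hκc : HasCompactSupport κ)
    {x : E} (hx : ∀ w ∈ tsupport κ, x + w ∈ K → x + w ∈ Ω) :
    mollify (pderiv i κ) F x = -mollify κ G x := by
  have := h (fun z => κ (z - x)) (hκ.comp (contDiff_id.sub contDiff_const))
    (hκc.comp_homeomorph (Homeomorph.subRight x)) (by
      rintro z ⟨hz, hzK⟩
      rw [tsupport_comp_sub] at hz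
      have := hx (z - x) hz
      rw [add_sub_cancel] at this
      exact this hzK)
  simpa only [pderiv_comp_sub, mollify] using this

/-- A family of averaging kernels supported in the balls of radius `ε` about `ε e`. -/
theorem exists_kernel (e : E) {ε : ℝ} (hε : 0 < ε) : ∃ κ : E → ℝ, ContDiff ℝ ∞ κ ∧
    HasCompactSupport κ ∧ (∀ w, 0 ≤ κ w) ∧ ∫ w, κ w = 1 ∧
    tsupport κ ⊆ Metric.closedBall (ε • e) ε ∧
    ∀ w, κ w ≤ 1 / volume.real (Metric.closedBall (0 : E) (ε / 2)) := by
  let f : ContDiffBump (ε • e) := ⟨ε / 2, ε, by positivity, by linarith⟩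
  refine ⟨f.normed volume, f.contDiff_normed, f.hasCompactSupport_normed, f.nonneg_normed,
    f.integral_normed, f.tsupport_normed_eq.le, fun w => ?_⟩
  refine (f.normed_le_div_measure_closedBall_rIn volume w).trans_eq ?_
  rw [Measure.real, Measure.real, Measure.addHaar_closedBall_center]

theorem exists_smul_of_mem_closedBall {e w : E} {ε : ℝ} (hε : 0 < ε)
    (hw : w ∈ Metric.closedBall (ε • e) ε) : ∃ v ∈ Metric.closedBall e 1, w = ε • v := by
  refine ⟨ε⁻¹ • w, ?_, by rw [smul_smul, mul_inv_cancel₀ hε.ne', one_smul]⟩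
  rw [Metric.mem_closedBall, dist_eq_norm] at hw ⊢
  have : ε⁻¹ • w - e = ε⁻¹ • (w - ε • e) := by
    rw [smul_sub, smul_smul, inv_mul_cancel₀ hε.ne', one_smul]
  rw [this, norm_smul, norm_inv, Real.norm_of_nonneg hε.le, inv_mul_le_iff₀ hε, mul_one]
  exact hw

theorem HasInwardShifts.add_mem {K : Set E} {e : E} {ε : ℝ} (h : HasInwardShifts Ω K e ε)
    (hε : 0 < ε) {x w : E} (hx : x ∈ closure Ω) (hw : w ∈ Metric.closedBall (ε • e) ε)
    (hK : x + w ∈ K) : x + w ∈ Ω := by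
  obtain ⟨v, hv, rfl⟩ := exists_smul_of_mem_closedBall hε hw
  exact h x hx v hv ε ⟨hε, le_rfl⟩ hK

theorem integrable_mul_kernel {κ F : E → ℝ} (hκ : Continuous κ) (hκc : HasCompactSupport κ)
    (hF : LocallyIntegrable F) (x : E) : Integrable fun w => F (x + w) * κ w := by
  have h1 : Integrable fun z => F z * κ (z - x) := by
    have h2 : HasCompactSupport fun z => κ (z - x) :=
      hκc.comp_homeomorph (Homeomorph.subRight x)
    have := hF.integrable_smul_left_of_hasCompactSupport
      (hκ.comp (continuous_id.sub continuous_const)) h2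
    simpa [mul_comm] using this
  have := h1.comp_add_left x
  simpa using this

/-- Jensen's inequality for averages. -/
theorem enorm_integral_mul_sq_le {κ : E → ℝ} (hκ : Continuous κ)
    (hκ0 : ∀ w, 0 ≤ κ w) (hκ1 : ∫ w, κ w = 1) {f : E → ℝ} (hf : Measurable f) :
    ‖∫ w, f w * κ w‖ₑ ^ 2 ≤ ∫⁻ w, ‖f w‖ₑ ^ 2 * ENNReal.ofReal (κ w) := by
  have hint : Integrable κ := by
    by_contra h
    rw [integral_undef h] at hκ1
    norm_num at hκ1
  have hm : Measurable fun w => ENNReal.ofReal (κ w) := hκ.measurable.ennreal_ofReal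
  set ν := volume.withDensity fun w => ENNReal.ofReal (κ w) with hν
  have hν1 : ν univ = 1 := by
    rw [hν, withDensity_apply _ MeasurableSet.univ, Measure.restrict_univ,
      ← ofReal_integral_eq_lintegral_ofReal hint (ae_of_all _ hκ0), hκ1, ENNReal.ofReal_one]
  calc ‖∫ w, f w * κ w‖ₑ ^ 2 ≤ (∫⁻ w, ‖f w * κ w‖ₑ) ^ 2 := by
        gcongr
        exact enorm_integral_le_lintegral_enorm _
    _ = (∫⁻ w, ‖f w‖ₑ ∂ν) ^ 2 := by
        rw [hν, lintegral_withDensity_eq_lintegral_mul _ hm hf.enorm]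
        congr 1
        refine lintegral_congr fun w => ?_
        rw [enorm_mul, Real.enorm_of_nonneg (hκ0 w), mul_comm]
        rfl
    _ ≤ ∫⁻ w, ‖f w‖ₑ ^ 2 ∂ν := by
        refine (sq_lintegral_le ν hf.enorm.aemeasurable).trans ?_
        rw [hν1, one_mul]
    _ = _ := by
        rw [hν, lintegral_withDensity_eq_lintegral_mul _ hm (hf.enorm.pow_const 2)]
        refine lintegral_congr fun w => ?_
        rw [mul_comm]
        rfl

/-- Pointwise values of an average are controlled by a local `L²` norm. -/
theorem enorm_mollify_sq_le {κ G : E → ℝ} (hκ : Continuous κ)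
    (hκ0 : ∀ w, 0 ≤ κ w) (hκ1 : ∫ w, κ w = 1) {B : ℝ} (hB : ∀ w, κ w ≤ B) {S : Set E}
    (hG : Measurable G) {x : E} (hS : ∀ w ∈ tsupport κ, x + w ∈ S) (hSm : MeasurableSet S) :
    ‖mollify κ G x‖ₑ ^ 2 ≤ ENNReal.ofReal B * ∫⁻ z in S, ‖G z‖ₑ ^ 2 := by
  rw [mollify_eq]
  refine (enorm_integral_mul_sq_le hκ hκ0 hκ1 (f := fun w => G (x + w))
    (hG.comp (measurable_const_add x))).trans ?_
  rw [← lintegral_const_mul' _ _ ENNReal.ofReal_ne_top, ← lintegral_indicator hSm,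
    ← lintegral_add_left_eq_self (S.indicator _) x]
  refine lintegral_mono fun w => ?_
  by_cases hw : w ∈ tsupport κ
  · rw [indicator_of_mem (hS w hw), mul_comm]
    gcongr
    exact hB w
  · rw [image_eq_zero_of_notMem_tsupport hw]
    simp

/-- Averaging moves a function in `L²` at most as much as the shifts that are averaged. -/
theorem eLpNorm_mollify_sub_le {κ F : E → ℝ} (hκ : Continuous κ) (hκc : HasCompactSupport κ)
    (hκ0 : ∀ w, 0 ≤ κ w) (hκ1 : ∫ w, κ w = 1) (hF : Measurable F) (hFi : LocallyIntegrable F)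
    {M : ℝ≥0∞} {A : Set E}
    (hM : ∀ w ∈ tsupport κ, eLpNorm (fun x => F (x + w) - F x) 2 (volume.restrict A) ≤ M) :
    eLpNorm (fun x => mollify κ F x - F x) 2 (volume.restrict A) ≤ M := by
  have hsq : ∀ f : E → ℝ, ∫⁻ x in A, ‖f x‖ₑ ^ 2 = eLpNorm f 2 (volume.restrict A) ^ 2 := by
    intro f
    have := eLpNorm_nnreal_pow_eq_lintegral (μ := volume.restrict A) (f := f) (p := 2) (by norm_num)
    simpa using this.symm
  have hint : Integrable κ := hκ.integrable_of_hasCompactSupport hκc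
  refine (ENNReal.pow_right_strictMono two_ne_zero).le_iff_le.1 ?_
  rw [← hsq]
  calc ∫⁻ x in A, ‖mollify κ F x - F x‖ₑ ^ 2
      ≤ ∫⁻ x in A, ∫⁻ w, ‖F (x + w) - F x‖ₑ ^ 2 * ENNReal.ofReal (κ w) := by
        refine lintegral_mono fun x => ?_
        have h1 : mollify κ F x - F x = ∫ w, (F (x + w) - F x) * κ w := by
          rw [mollify_eq]
          simp_rw [sub_mul]
          rw [integral_sub (integrable_mul_kernel hκ hκc hFi x) (hint.const_mul _),
            integral_const_mul, hκ1, mul_one]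
        rw [h1]
        exact enorm_integral_mul_sq_le hκ hκ0 hκ1 (by fun_prop)
    _ = ∫⁻ w, ∫⁻ x in A, ‖F (x + w) - F x‖ₑ ^ 2 * ENNReal.ofReal (κ w) := by
        refine lintegral_lintegral_swap ?_
        have := hκ.measurable
        exact Measurable.aemeasurable (by fun_prop)
    _ ≤ ∫⁻ w, M ^ 2 * ENNReal.ofReal (κ w) := by
        refine lintegral_mono fun w => ?_
        simp only
        rw [lintegral_mul_const' _ _ ENNReal.ofReal_ne_top, hsq]
        by_cases hw : w ∈ tsupport κ
        · gcongr
          exact hM w hw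
        · rw [image_eq_zero_of_notMem_tsupport hw]
          simp
    _ = M ^ 2 := by
        rw [lintegral_const_mul _ hκ.measurable.ennreal_ofReal,
          ← ofReal_integral_eq_lintegral_ofReal hint (ae_of_all _ hκ0), hκ1, ENNReal.ofReal_one,
          mul_one]

/-- Translations are continuous in `L²`. -/
theorem tendsto_eLpNorm_shift_sub {F : E → ℝ} (hF : MemLp F 2 volume) :
    Tendsto (fun w : E => eLpNorm (fun x => F (x + w) - F x) 2 volume) (𝓝 0) (𝓝 0) := by
  have : Fact ((2 : ℝ≥0∞) ≠ ⊤) := ⟨by simp⟩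
  have h1 : Tendsto (fun w : E => DomAddAct.mk w +ᵥ (hF.toLp F)) (𝓝 0) (𝓝 (hF.toLp F)) := by
    have hc : Continuous fun w : E => DomAddAct.mk w +ᵥ (hF.toLp F) := by
      have : Continuous (DomAddAct.mk : E → Eᵈᵃᵃ) := DomAddAct.continuous_mk
      exact this.vadd continuous_const
    have := hc.tendsto 0
    simpa using this
  rw [Lp.tendsto_Lp_iff_tendsto_eLpNorm'] at h1
  refine h1.congr fun w => ?_
  refine eLpNorm_congr_ae ?_
  rw [DomAddAct.mk_vadd_toLp]
  filter_upwards [MemLp.coeFn_toLp hF, MemLp.coeFn_toLp (hF.comp_measurePreserving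
    (measurePreserving_vadd w volume))] with x hx hx'
  rw [Pi.sub_apply, hx]
  refine congrArg (· - F x) (hx'.trans ?_)
  simp [add_comm]

/-- A square integrable function on an open set whose pairings with test functions are bounded by
`M` times their norm has norm at most `M`: test functions are dense. -/
theorem eLpNorm_le_of_forall_test (hΩ : IsOpen Ω) {h : E → ℝ} (hh : MemLp h 2 (volume.restrict Ω))
    {M : ℝ} (hM0 : 0 ≤ M)
    (hM : ∀ ψ : E → ℝ, ContDiff ℝ ∞ ψ → HasCompactSupport ψ → tsupport ψ ⊆ Ω →
      |∫ x in Ω, h x * ψ x| ≤ M * (eLpNorm ψ 2 (volume.restrict Ω)).toReal) :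
    eLpNorm h 2 (volume.restrict Ω) ≤ ENNReal.ofReal M := by
  have hmem : ∀ ψ : E → ℝ, ContDiff ℝ ∞ ψ → HasCompactSupport ψ →
      MemLp ψ 2 (volume.restrict Ω) := fun ψ h1 h2 =>
    (h1.continuous.memLp_of_hasCompactSupport h2).restrict Ω
  -- The test functions form a dense subspace: what is orthogonal to all of them vanishes.
  let D : Submodule ℝ (L2Bulk Ω) :=
    { carrier := {f | ∃ ψ : E → ℝ, ContDiff ℝ ∞ ψ ∧ HasCompactSupport ψ ∧ tsupport ψ ⊆ Ω ∧
        f =ᵐ[volume.restrict Ω] ψ}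
      zero_mem' := ⟨0, contDiff_const, HasCompactSupport.zero, by simp, Lp.coeFn_zero _ _ _⟩
      add_mem' := by
        rintro f g ⟨ψ, h1, h2, h3, h4⟩ ⟨χ, k1, k2, k3, k4⟩
        exact ⟨ψ + χ, h1.add k1, h2.add k2, (tsupport_add _ _).trans (union_subset h3 k3),
          (Lp.coeFn_add _ _).trans (h4.add k4)⟩
      smul_mem' := by
        rintro c f ⟨ψ, h1, h2, h3, h4⟩
        exact ⟨c • ψ, h1.const_smul c, h2.smul_left (f := fun _ => c),
          (tsupport_smul_subset_right (fun _ => c) ψ).trans h3,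
          (Lp.coeFn_smul _ _).trans (h4.const_smul c)⟩ }
  have hdense : D.topologicalClosure = ⊤ := by
    rw [Submodule.topologicalClosure_eq_top_iff, Submodule.eq_bot_iff]
    intro f hf
    have hloc : LocallyIntegrableOn f Ω := by
      refine locallyIntegrableOn_of_locallyIntegrable_restrict ?_
      exact (Lp.memLp f).locallyIntegrable (by norm_num)
    have h0 := hΩ.ae_eq_zero_of_integral_contDiff_smul_eq_zero hloc fun ψ h1 h2 h3 => by
      have := (Submodule.mem_orthogonal _ _).1 hf ((hmem ψ h1 h2).toLp ψ)
        ⟨ψ, h1, h2, h3, MemLp.coeFn_toLp _⟩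
      rw [L2.inner_def] at this
      have h5 : ∫ x in Ω, ψ x • f x = 0 := by
        rw [← this]
        refine integral_congr_ae ((MemLp.coeFn_toLp (hmem ψ h1 h2)).mono fun x hx => ?_)
        simp [hx, mul_comm]
      rw [← h5]
      refine (setIntegral_eq_integral_of_forall_compl_eq_zero fun x hx => ?_).symm
      rw [image_eq_zero_of_notMem_tsupport fun hx' => hx (h3 hx'), zero_smul]
    rw [Lp.eq_zero_iff_ae_eq_zero]
    rw [Filter.EventuallyEq, ae_restrict_iff' hΩ.measurableSet]
    exact h0
  have hcl : IsClosed {f : L2Bulk Ω | |⟪f, hh.toLp h⟫_ℝ| ≤ M * ‖f‖} :=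
    isClosed_le (by fun_prop) (by fun_prop)
  have hsub : (D : Set (L2Bulk Ω)) ⊆ {f : L2Bulk Ω | |⟪f, hh.toLp h⟫_ℝ| ≤ M * ‖f‖} := by
    rintro f ⟨ψ, h1, h2, h3, h4⟩
    have := hM ψ h1 h2 h3
    rw [← eLpNorm_congr_ae h4] at this
    change |_| ≤ M * (eLpNorm f 2 (volume.restrict Ω)).toReal
    convert this using 2
    rw [L2.inner_def]
    refine integral_congr_ae ?_
    filter_upwards [h4, hh.coeFn_toLp] with x hx hx'
    simp [hx, hx']
  have hall := closure_minimal hsub hcl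
  have hf : hh.toLp h ∈ closure (D : Set (L2Bulk Ω)) := by
    have : hh.toLp h ∈ D.topologicalClosure := by rw [hdense]; trivial
    exact this
  have h5 : |⟪hh.toLp h, hh.toLp h⟫_ℝ| ≤ M * ‖hh.toLp h‖ := hall hf
  rw [real_inner_self_eq_norm_sq, abs_of_nonneg (sq_nonneg _)] at h5
  have h6 : ‖hh.toLp h‖ ≤ M := by
    by_contra! hlt
    nlinarith [norm_nonneg (hh.toLp h)]
  rw [← Lp.enorm_toLp hh, ← ofReal_norm]
  exact ENNReal.ofReal_le_ofReal h6

end Mollify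

section Approx

variable {d : ℕ} {Ω : Set (EuclideanSpace ℝ (Fin d))}

local notation "E" => EuclideanSpace ℝ (Fin d)

theorem abs_integral_mul_le {α : Type*} [MeasurableSpace α] {μ : Measure α} {f g : α → ℝ}
    (hf : MemLp f 2 μ) (hg : MemLp g 2 μ) :
    |∫ x, f x * g x ∂μ| ≤ (eLpNorm f 2 μ).toReal * (eLpNorm g 2 μ).toReal := by
  have h := abs_real_inner_le_norm (hf.toLp f) (hg.toLp g)
  rw [Lp.norm_toLp, Lp.norm_toLp, L2.inner_def] at h
  convert h using 2
  refine integral_congr_ae ?_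
  filter_upwards [hf.coeFn_toLp, hg.coeFn_toLp] with x h1 h2
  simp [h1, h2, mul_comm]

theorem fderiv_apply_eq_sum (φ : E → ℝ) (x v : E) :
    fderiv ℝ φ x v = ∑ i, v i * pderiv i φ x := by
  conv_lhs => rw [← (EuclideanSpace.basisFun (Fin d) ℝ).sum_repr v]
  simp [map_sum, pderiv]

/-- The change of a function under an inward shift is bounded by its weak derivatives. By duality
it suffices to pair with a test function `ψ`, and then the derivative of the pairing along the
shift is a pairing of `ψ` with the weak derivatives. -/
theorem eLpNorm_shift_sub_le (hΩ : IsOpen Ω) {K : Set E} {e : E} {ε : ℝ}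
    (hK : HasInwardShifts Ω K e ε) {F : E → ℝ} {G : Fin d → E → ℝ} (hF : MemLp F 2 volume)
    (hG : ∀ i, MemLp (G i) 2 volume) (hFG : ∀ i, IsLocalWeakDeriv Ω K i F (G i)) {v : E}
    (hv : v ∈ Metric.closedBall e 1) {s : ℝ} (hs : s ∈ Ioc 0 ε) :
    eLpNorm (fun x => F (x + s • v) - F x) 2 (volume.restrict Ω) ≤
      ENNReal.ofReal (s * ((‖e‖ + 1) * ∑ i, (eLpNorm (G i) 2 volume).toReal)) := by
  have hFl : LocallyIntegrable F := hF.locallyIntegrable (by norm_num)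
  have hmem : MemLp (fun x => F (x + s • v) - F x) 2 volume := by
    refine MemLp.sub ?_ hF
    exact hF.comp_measurePreserving (measurePreserving_add_right volume (s • v))
  have hs0 := hs.1.le
  have hvi : ∀ i, |v i| ≤ ‖e‖ + 1 := by
    intro i
    have h1 : ‖v - e‖ ≤ 1 := by simpa [dist_eq_norm] using hv
    have h2 := norm_add_le (v - e) e
    rw [sub_add_cancel] at h2
    have h3 : |v i| ≤ ‖v‖ := by simpa using PiLp.norm_apply_le v i
    linarith
  refine eLpNorm_le_of_forall_test hΩ (hmem.restrict Ω) (by positivity) fun ψ h1 h2 h3 => ?_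
  have hψ : MemLp ψ 2 volume := h1.continuous.memLp_of_hasCompactSupport h2
  set N := (eLpNorm ψ 2 (volume.restrict Ω)).toReal with hN
  have hN' : (eLpNorm ψ 2 volume).toReal = N := by
    rw [hN, eLpNorm_restrict_eq_of_support_subset ((subset_tsupport ψ).trans h3)]
  have hGm : ContDiff ℝ ∞ (mollify ψ F) := contDiff_mollify h1 h2 hFl
  have hder : ∀ t : ℝ, HasDerivAt (fun t : ℝ => mollify ψ F (t • v))
      (fderiv ℝ (mollify ψ F) (t • v) v) t := by
    intro t
    have h4 : HasDerivAt (fun t : ℝ => t • v) v t := by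
      simpa using (hasDerivAt_id t).smul_const v
    exact (hGm.differentiable (by simp) _).hasFDerivAt.comp_hasDerivAt t h4
  -- The pairing of `ψ` with the shift of `F` by `t v` is `mollify ψ F (t v)`; its derivative in `t`
  -- pairs `ψ` with weak derivatives of `F`, since the shifted support of `ψ` stays admissible.
  have hbound : ∀ t ∈ Ico 0 s, ‖fderiv ℝ (mollify ψ F) (t • v) v‖ ≤
      (‖e‖ + 1) * (∑ i, (eLpNorm (G i) 2 volume).toReal) * N := by
    intro t ht
    -- For `t = 0` there is no shift, and the support of `ψ` lies in `Ω` anyway.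
    have hx : ∀ w ∈ tsupport ψ, t • v + w ∈ K → t • v + w ∈ Ω := by
      intro w hw hwK
      rcases ht.1.eq_or_lt with h0 | h0
      · rw [← h0, zero_smul, zero_add]
        exact h3 hw
      · rw [add_comm] at hwK ⊢
        exact hK w (subset_closure (h3 hw)) v hv t ⟨h0, ht.2.le.trans hs.2⟩ hwK
    rw [fderiv_apply_eq_sum, Finset.mul_sum, Finset.sum_mul]
    refine (norm_sum_le _ _).trans (Finset.sum_le_sum fun i _ => ?_)
    rw [pderiv_mollify h1 h2 hFl, (hFG i).mollify_pderiv h1 h2 hx, neg_neg, norm_mul, mul_assoc]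
    gcongr
    · exact hvi i
    · have h5 : MemLp (fun z => ψ (z - t • v)) 2 volume :=
        hψ.comp_measurePreserving (measurePreserving_sub_right volume (t • v))
      have h6 : eLpNorm (fun z => ψ (z - t • v)) 2 volume = eLpNorm ψ 2 volume :=
        eLpNorm_comp_measurePreserving hψ.1 (measurePreserving_sub_right volume (t • v))
      rw [← hN', ← h6, Real.norm_eq_abs]
      exact abs_integral_mul_le (hG i) h5
  have hmvt := norm_image_sub_le_of_norm_deriv_le_segment'
    (fun t _ => (hder t).hasDerivWithinAt) hbound s ⟨hs0, le_rfl⟩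
  have hval : ∫ x in Ω, (F (x + s • v) - F x) * ψ x =
      mollify ψ F (s • v) - mollify ψ F ((0 : ℝ) • v) := by
    rw [setIntegral_eq_integral_of_forall_compl_eq_zero, mollify_eq, mollify_eq,
      ← integral_sub (integrable_mul_kernel h1.continuous h2 hFl _)
        (integrable_mul_kernel h1.continuous h2 hFl _)]
    · refine integral_congr_ae (ae_of_all _ fun x => ?_)
      simp only [zero_smul, zero_add]
      rw [sub_mul, add_comm x]
    · intro x hx
      rw [image_eq_zero_of_notMem_tsupport fun h => hx (h3 h), mul_zero]
  rw [hval, ← Real.norm_eq_abs]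
  refine hmvt.trans_eq ?_
  ring

/-! ### Cut-offs of Sobolev functions -/

/-- The product of `f` with a cut-off function `χ` on `Ω`, extended by zero. -/
noncomputable def cut (Ω : Set (EuclideanSpace ℝ (Fin d))) (χ f : E → ℝ) : E → ℝ :=
  Ω.indicator fun x => χ x * f x

theorem measurable_cut (hΩ : IsOpen Ω) {χ f : E → ℝ} (hχ : Continuous χ) (hf : Measurable f) :
    Measurable (cut Ω χ f) :=
  (hχ.measurable.mul hf).indicator hΩ.measurableSet

theorem eLpNorm_cut_le (hΩ : IsOpen Ω) {χ : E → ℝ} {B : ℝ} (hB : ∀ x, |χ x| ≤ B)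
    (f : L2Bulk Ω) : eLpNorm (cut Ω χ f) 2 volume ≤ ENNReal.ofReal (B * ‖f‖) := by
  have hB0 : 0 ≤ B := (abs_nonneg _).trans (hB 0)
  rw [cut, eLpNorm_indicator_eq_eLpNorm_restrict hΩ.measurableSet, ENNReal.ofReal_mul hB0,
    ofReal_norm, Lp.enorm_def]
  refine eLpNorm_le_mul_eLpNorm_of_ae_le_mul (ae_of_all _ fun x => ?_) 2
  rw [norm_mul]
  gcongr
  exact hB x

theorem memLp_cut (hΩ : IsOpen Ω) {χ : E → ℝ} (hχ : Continuous χ) (hχc : HasCompactSupport χ)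
    (f : L2Bulk Ω) : MemLp (cut Ω χ f) 2 volume := by
  obtain ⟨B, hB⟩ := hχ.bounded_above_of_compact_support hχc
  exact ⟨(measurable_cut hΩ hχ (Lp.stronglyMeasurable f).measurable).aestronglyMeasurable,
    (eLpNorm_cut_le hΩ hB f).trans_lt ENNReal.ofReal_lt_top⟩

theorem integrable_mul_test {F φ : E → ℝ} (hF : MemLp F 2 volume) (hφ : ContDiff ℝ ∞ φ)
    (hφc : HasCompactSupport φ) : Integrable fun x => F x * φ x :=
  MemLp.integrable_mul (p := 2) (q := 2) hF (hφ.continuous.memLp_of_hasCompactSupport hφc)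

theorem IsLocalWeakDeriv.add {K : Set E} {i : Fin d} {F G F' G' : E → ℝ}
    (h : IsLocalWeakDeriv Ω K i F G) (h' : IsLocalWeakDeriv Ω K i F' G')
    (hF : MemLp F 2 volume) (hG : MemLp G 2 volume) (hF' : MemLp F' 2 volume)
    (hG' : MemLp G' 2 volume) : IsLocalWeakDeriv Ω K i (F + F') (G + G') := by
  intro φ h1 h2 h3
  have k1 := contDiff_pderiv h1 i
  have k2 := hasCompactSupport_pderiv h2 i
  simp only [Pi.add_apply, add_mul]
  rw [integral_add (integrable_mul_test hF k1 k2) (integrable_mul_test hF' k1 k2),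
    integral_add (integrable_mul_test hG h1 h2) (integrable_mul_test hG' h1 h2), h φ h1 h2 h3,
    h' φ h1 h2 h3]
  ring

theorem pderiv_mul {χ φ : E → ℝ} (hχ : ContDiff ℝ ∞ χ) (hφ : ContDiff ℝ ∞ φ) (i : Fin d) (x : E) :
    pderiv i (fun y => χ y * φ y) x = χ x * pderiv i φ x + pderiv i χ x * φ x := by
  have h := ((hχ.differentiable (by simp) x).hasFDerivAt.mul
    (hφ.differentiable (by simp) x).hasFDerivAt).fderiv
  change fderiv ℝ (χ * φ) x _ = _
  rw [h]
  simp [pderiv, mul_comm]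

/-- The product rule for a cut-off function and a weakly differentiable function. -/
theorem isLocalWeakDeriv_cut (hΩ : IsOpen Ω) {K : Set E} {i : Fin d} {f g : L2Bulk Ω}
    (h : IsWeakDeriv i f g) {χ : E → ℝ} (hχ : ContDiff ℝ ∞ χ) (hχc : HasCompactSupport χ)
    (hχK : tsupport χ ⊆ K) :
    IsLocalWeakDeriv Ω K i (cut Ω χ f) (cut Ω χ g + cut Ω (pderiv i χ) f) := by
  intro φ h1 h2 h3
  have hχ' := contDiff_pderiv hχ i
  have hχc' := hasCompactSupport_pderiv hχc i
  have h4 := h (fun y => χ y * φ y) (hχ.mul h1) h2.mul_left fun x hx =>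
    h3 ⟨tsupport_mul_subset_right hx, hχK (tsupport_mul_subset_left hx)⟩
  have hcut : ∀ (χ φ : E → ℝ) (f : L2Bulk Ω),
      ∫ x, cut Ω χ f x * φ x = ∫ x in Ω, f x * (χ x * φ x) := by
    intro χ φ f
    rw [← integral_indicator hΩ.measurableSet]
    refine integral_congr_ae (ae_of_all _ fun x => ?_)
    by_cases hx : x ∈ Ω
    · simp only [cut, indicator_of_mem hx]; ring
    · simp [cut, indicator_of_notMem hx]
  have hint : ∀ (χ φ : E → ℝ) (f : L2Bulk Ω), ContDiff ℝ ∞ χ → HasCompactSupport χ →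
      ContDiff ℝ ∞ φ → HasCompactSupport φ →
      Integrable (fun x => f x * (χ x * φ x)) (volume.restrict Ω) := by
    intro χ φ f k1 k2 k3 k4
    exact MemLp.integrable_mul (p := 2) (q := 2) (Lp.memLp f)
      (((k1.continuous.mul k3.continuous).memLp_of_hasCompactSupport k2.mul_right).restrict Ω)
  simp only [pderiv_mul hχ h1, mul_add] at h4
  rw [integral_add (hint _ _ _ hχ hχc (contDiff_pderiv h1 i) (hasCompactSupport_pderiv h2 i))
    (hint _ _ _ hχ' hχc' h1 h2)] at h4
  simp only [Pi.add_apply, add_mul]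
  rw [integral_add (integrable_mul_test (memLp_cut hΩ hχ.continuous hχc g) h1 h2)
    (integrable_mul_test (memLp_cut hΩ hχ'.continuous hχc' f) h1 h2), hcut, hcut, hcut]
  linarith

/-- Multiplication by a smooth cut-off function acts on `H¹(Ω)`. -/
theorem exists_mul_H1 (hΩ : IsOpen Ω) {χ : E → ℝ} (hχ : ContDiff ℝ ∞ χ)
    (hχc : HasCompactSupport χ) (p : H1 Ω) :
    ∃ q : H1 Ω, q.1.fst =ᵐ[volume.restrict Ω] cut Ω χ p.1.fst ∧
      ∀ i, q.1.snd i =ᵐ[volume.restrict Ω] cut Ω χ (p.1.snd i) + cut Ω (pderiv i χ) p.1.fst := by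
  have m0 := (memLp_cut hΩ hχ.continuous hχc p.1.fst).restrict Ω
  have m1 := fun i => ((memLp_cut hΩ hχ.continuous hχc (p.1.snd i)).add
    (memLp_cut hΩ (contDiff_pderiv hχ i).continuous (hasCompactSupport_pderiv hχc i)
      p.1.fst)).restrict Ω
  refine ⟨⟨WithLp.toLp 2 (m0.toLp _, WithLp.toLp 2 fun i => (m1 i).toLp _), ?_⟩, m0.coeFn_toLp,
    fun i => (m1 i).coeFn_toLp⟩
  intro i φ h1 h2 h3
  have h := isLocalWeakDeriv_cut hΩ (p.2 i) hχ hχc (subset_univ _) φ h1 h2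
    (inter_subset_left.trans h3)
  change ∫ x in Ω, (m0.toLp _ : E → ℝ) x * pderiv i φ x =
    -∫ x in Ω, ((m1 i).toLp _ : E → ℝ) x * φ x
  have e1 : ∫ x in Ω, (m0.toLp _ : E → ℝ) x * pderiv i φ x =
      ∫ x, cut Ω χ p.1.fst x * pderiv i φ x := by
    refine Eq.trans ?_ (setIntegral_eq_integral_of_forall_compl_eq_zero (s := Ω) ?_)
    · exact integral_congr_ae (m0.coeFn_toLp.mono fun x hx => by simp only [hx])
    · intro x hx
      rw [image_eq_zero_of_notMem_tsupport fun h => hx (h3 (tsupport_pderiv_subset _ _ h)),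
        mul_zero]
  have e2 : ∫ x in Ω, ((m1 i).toLp _ : E → ℝ) x * φ x =
      ∫ x, (cut Ω χ (p.1.snd i) + cut Ω (pderiv i χ) p.1.fst) x * φ x := by
    refine Eq.trans ?_ (setIntegral_eq_integral_of_forall_compl_eq_zero (s := Ω) ?_)
    · exact integral_congr_ae ((m1 i).coeFn_toLp.mono fun x hx => by simp only [hx])
    · intro x hx
      rw [image_eq_zero_of_notMem_tsupport fun h => hx (h3 h), mul_zero]
  rw [e1, e2, h]

end Approx

section Density

variable {d : ℕ} {Ω : Set (EuclideanSpace ℝ (Fin d))}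

local notation "E" => EuclideanSpace ℝ (Fin d)

/-! ### Smooth approximation -/

/-- A finite smooth partition of unity on the closure of a bounded Lipschitz domain, each member
of which lives in a region with inward shifts. -/
theorem exists_partition (hΩ : IsOpen Ω) (hb : Bornology.IsBounded Ω)
    (hL : HasLipschitzBoundary Ω) :
    ∃ (ι : Type) (_ : Fintype ι) (χ : ι → E → ℝ) (K : ι → Set E) (e : ι → E) (ε : ι → ℝ),
      (∀ k, ContDiff ℝ ∞ (χ k)) ∧ (∀ k, HasCompactSupport (χ k)) ∧ (∀ k, tsupport (χ k) ⊆ K k) ∧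
      (∀ k, 0 < ε k) ∧ (∀ k, HasInwardShifts Ω (K k) (e k) (ε k)) ∧
      ∀ x ∈ closure Ω, ∑ k, χ k x = 1 := by
  choose! r hr e ε hε h using fun (x : E) (hx : x ∈ closure Ω) => exists_hasInwardShifts hΩ hL hx
  obtain ⟨t, ht, hcov⟩ := hb.isCompact_closure.elim_nhds_subcover (fun x => Metric.ball x (r x))
    (fun x hx => Metric.ball_mem_nhds x (hr x hx))
  obtain ⟨f, hf⟩ := SmoothPartitionOfUnity.exists_isSubordinate (modelWithCornersSelf ℝ E)
    (isClosed_closure (s := Ω)) (fun k : t => Metric.ball (k : E) (r k))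
    (fun _ => Metric.isOpen_ball) (by
      intro x hx
      have := hcov hx
      simp only [mem_iUnion] at this ⊢
      obtain ⟨k, hk, hxk⟩ := this
      exact ⟨⟨k, hk⟩, hxk⟩)
  refine ⟨t, inferInstance, fun k => f k, fun k => Metric.closedBall k (r k), fun k => e k,
    fun k => ε k, fun k => (f k).contMDiff.contDiff, fun k => ?_, fun k => ?_,
    fun k => hε k (ht k k.2), fun k => h k (ht k k.2), fun x hx => ?_⟩
  · exact (isCompact_closedBall (k : E) (r k)).of_isClosed_subset (isClosed_tsupport _)
      ((hf k).trans Metric.ball_subset_closedBall)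
  · exact (hf k).trans Metric.ball_subset_closedBall
  · rw [← finsum_eq_sum_of_fintype]
    exact f.sum_eq_one hx

/-- `v ↦ v` from the energy space to `H¹(Ω)`. -/
noncomputable def toH1L (Ω : Set (EuclideanSpace ℝ (Fin d))) : EnergySpace Ω →L[ℝ] H1 Ω :=
  (WithLp.fstL 2 ℝ (H1 Ω) (L2Bdry Ω)).comp (smoothGraph Ω).topologicalClosure.subtypeL

theorem toH1L_apply (v : EnergySpace Ω) : toH1L Ω v = v.toH1 := rfl

theorem norm_sub_le_of_ae {α : Type*} [MeasurableSpace α] {μ : Measure α} {a b : Lp ℝ 2 μ}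
    {f g : α → ℝ} (ha : a =ᵐ[μ] f) (hb : b =ᵐ[μ] g) {η : ℝ} (hη : 0 ≤ η)
    (h : eLpNorm (fun x => f x - g x) 2 μ ≤ ENNReal.ofReal η) : ‖a - b‖ ≤ η := by
  rw [Lp.norm_def]
  refine ENNReal.toReal_le_of_le_ofReal hη (le_trans (le_of_eq ?_) h)
  refine eLpNorm_congr_ae ((Lp.coeFn_sub a b).trans ?_)
  filter_upwards [ha, hb] with x h1 h2
  simp [h1, h2]

theorem norm_H1_le_of_forall {p : H1 Ω} {η : ℝ} (hη : 0 ≤ η) (h0 : ‖p.1.fst‖ ≤ η)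
    (h1 : ∀ i, ‖p.1.snd i‖ ≤ η) : ‖p‖ ≤ (d + 1) * η := by
  have h2 : ‖p‖ ^ 2 ≤ ((d + 1) * η) ^ 2 := by
    rw [H1.norm_sq]
    have h3 : ∑ i, ‖p.1.snd i‖ ^ 2 ≤ ∑ _i : Fin d, η ^ 2 :=
      Finset.sum_le_sum fun i _ => by gcongr; exact h1 i
    simp only [Finset.sum_const, Finset.card_univ, Fintype.card_fin, nsmul_eq_mul] at h3
    have h4 : ‖p.1.fst‖ ^ 2 ≤ η ^ 2 := by gcongr
    have h5 : (0 : ℝ) ≤ d := Nat.cast_nonneg d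
    nlinarith [mul_nonneg h5 (sq_nonneg η), mul_nonneg (mul_nonneg h5 h5) (sq_nonneg η)]
  exact le_of_sq_le_sq h2 (by positivity)

/-- Averages over inward shifts of a cut-off Sobolev function converge to it in `H¹(Ω)`. -/
theorem exists_smooth_approx_H1 {K : Set E} {e : E} {ε₀ : ℝ} (hε₀ : 0 < ε₀)
    (hK : HasInwardShifts Ω K e ε₀) {F : E → ℝ} {G : Fin d → E → ℝ} (hF : MemLp F 2 volume)
    (hG : ∀ i, MemLp (G i) 2 volume) (hFm : Measurable F) (hGm : ∀ i, Measurable (G i))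
    (hΩ : IsOpen Ω)
    (hFG : ∀ i, IsLocalWeakDeriv Ω K i F (G i)) {η : ℝ} (hη : 0 < η) :
    ∃ g : E → ℝ, ContDiff ℝ ∞ g ∧
      eLpNorm (fun x => g x - F x) 2 (volume.restrict Ω) ≤ ENNReal.ofReal η ∧
      ∀ i, eLpNorm (fun x => pderiv i g x - G i x) 2 (volume.restrict Ω) ≤ ENNReal.ofReal η := by
  have hη' : 0 < ENNReal.ofReal η := by simpa using hη
  have hev : ∀ᶠ w : E in 𝓝 0, eLpNorm (fun x => F (x + w) - F x) 2 volume < ENNReal.ofReal η ∧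
      ∀ i, eLpNorm (fun x => G i (x + w) - G i x) 2 volume < ENNReal.ofReal η :=
    ((tendsto_eLpNorm_shift_sub hF).eventually_lt_const hη').and
      (eventually_all.2 fun i => (tendsto_eLpNorm_shift_sub (hG i)).eventually_lt_const hη')
  obtain ⟨δ, hδ, hball⟩ := Metric.eventually_nhds_iff_ball.1 hev
  have he := norm_nonneg e
  set ε := min ε₀ (δ / (2 * (‖e‖ + 1))) with hεdef
  have hε : 0 < ε := by positivity
  obtain ⟨κ, hκ, hκc, hκ0, hκ1, hκs, -⟩ := exists_kernel e hε
  have hsmall : ∀ w ∈ tsupport κ, w ∈ Metric.ball (0 : E) δ := by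
    intro w hw
    have h1 : ‖w - ε • e‖ ≤ ε := by simpa [dist_eq_norm] using hκs hw
    have h2 : ‖ε • e‖ = ε * ‖e‖ := by rw [norm_smul, Real.norm_of_nonneg hε.le]
    have h3 := norm_add_le (w - ε • e) (ε • e)
    rw [sub_add_cancel] at h3
    have h4 : ε ≤ δ / (2 * (‖e‖ + 1)) := min_le_right _ _
    rw [le_div_iff₀ (by positivity)] at h4
    rw [mem_ball_zero_iff]
    nlinarith
  have hFl : LocallyIntegrable F := hF.locallyIntegrable (by norm_num)
  refine ⟨mollify κ F, contDiff_mollify hκ hκc hFl, ?_, fun i => ?_⟩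
  · refine eLpNorm_mollify_sub_le hκ.continuous hκc hκ0 hκ1 hFm hFl fun w hw => ?_
    exact (eLpNorm_mono_measure _ Measure.restrict_le_self).trans (hball w (hsmall w hw)).1.le
  · have h1 : (fun x => pderiv i (mollify κ F) x - G i x) =ᵐ[volume.restrict Ω]
        fun x => mollify κ (G i) x - G i x := by
      filter_upwards [ae_restrict_mem hΩ.measurableSet] with x hx
      rw [pderiv_mollify hκ hκc hFl, (hFG i).mollify_pderiv hκ hκc, neg_neg]
      intro w hw hwK
      exact (hK.mono (min_le_left _ _)).add_mem hε (subset_closure hx) (hκs hw) hwK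
    rw [eLpNorm_congr_ae h1]
    refine eLpNorm_mollify_sub_le hκ.continuous hκc hκ0 hκ1 (hGm i)
      ((hG i).locallyIntegrable (by norm_num)) fun w hw => ?_
    exact (eLpNorm_mono_measure _ Measure.restrict_le_self).trans
      ((hball w (hsmall w hw)).2 i).le

theorem measurable_lp {μ : Measure E} (f : Lp ℝ 2 μ) : Measurable f :=
  (Lp.stronglyMeasurable f).measurable

/-- A function in the energy space is controlled by its `H¹(Ω)` norm, by the trace inequality; in
particular it has only one trace. -/
theorem exists_antilipschitz_toH1L (hΩ : IsOpen Ω) (hb : Bornology.IsBounded Ω)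
    (hL : HasLipschitzBoundary Ω) : ∃ C > 0, ∀ v : EnergySpace Ω, ‖v‖ ≤ C * ‖v.toH1‖ := by
  obtain ⟨C, hC, h⟩ := exists_trace_le hΩ hb hL
  refine ⟨C + 1, by positivity, fun v => ?_⟩
  refine le_of_sq_le_sq ?_ (by positivity)
  rw [v.norm_sq, mul_pow]
  nlinarith [h v, mul_nonneg hC.le (sq_nonneg ‖v.toH1‖), mul_nonneg (sq_nonneg C)
    (sq_nonneg ‖v.toH1‖)]

theorem coeFn_finset_sum {α ι : Type*} [MeasurableSpace α] {μ : Measure α} (s : Finset ι)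
    (f : ι → Lp ℝ 2 μ) : ⇑(∑ k ∈ s, f k) =ᵐ[μ] fun x => ∑ k ∈ s, f k x := by
  classical
  induction s using Finset.induction_on with
  | empty =>
    simp only [Finset.sum_empty]
    exact Lp.coeFn_zero ℝ 2 μ
  | insert a s ha ih =>
    rw [Finset.sum_insert ha]
    filter_upwards [Lp.coeFn_add (f a) (∑ k ∈ s, f k), ih] with x h1 h2
    rw [h1, Pi.add_apply, h2, Finset.sum_insert ha]

/-- A Sobolev function is the sum of its pieces under a partition of unity. -/
theorem eq_sum_of_partition (hΩ : IsOpen Ω) {ι : Type*} [Fintype ι] {χ : ι → E → ℝ}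
    (hχ : ∀ k, ContDiff ℝ ∞ (χ k)) (hsum : ∀ x ∈ closure Ω, ∑ k, χ k x = 1) (p : H1 Ω)
    (q : ι → H1 Ω) (hq0 : ∀ k, (q k).1.fst =ᵐ[volume.restrict Ω] cut Ω (χ k) p.1.fst)
    (hq1 : ∀ k i, (q k).1.snd i =ᵐ[volume.restrict Ω]
      cut Ω (χ k) (p.1.snd i) + cut Ω (pderiv i (χ k)) p.1.fst) : p = ∑ k, q k := by
  have hΩae : ∀ᵐ x ∂(volume.restrict Ω), x ∈ Ω := ae_restrict_mem hΩ.measurableSet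
  have hder : ∀ i, ∀ x ∈ Ω, ∑ k, pderiv i (χ k) x = 0 := by
    intro i x hx
    have h1 : (fun y => ∑ k, χ k y) =ᶠ[𝓝 x] fun _ => (1 : ℝ) := by
      filter_upwards [hΩ.mem_nhds hx] with y hy using hsum y (subset_closure hy)
    have h2 := h1.fderiv_eq (𝕜 := ℝ)
    rw [fderiv_fun_sum fun k _ => (hχ k).differentiable (by simp) x] at h2
    simpa [pderiv] using congrArg (fun A => A (EuclideanSpace.single i (1 : ℝ))) h2
  have hfst : (∑ k, q k).1.fst = ∑ k, (q k).1.fst := by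
    rw [Submodule.coe_sum]
    exact map_sum (WithLp.fstL 2 ℝ (L2Bulk Ω) (PiLp 2 fun _ : Fin d => L2Bulk Ω)) _ _
  have hsnd : ∀ i, (∑ k, q k).1.snd i = ∑ k, (q k).1.snd i := by
    intro i
    rw [Submodule.coe_sum]
    exact map_sum ((PiLp.proj 2 (fun _ : Fin d => L2Bulk Ω) i : _ →L[ℝ] _).comp
      (WithLp.sndL 2 ℝ (L2Bulk Ω) (PiLp 2 fun _ : Fin d => L2Bulk Ω))) _ _
  refine Subtype.ext (WithLp.ofLp_injective 2 (Prod.ext ?_ (PiLp.ext fun i => ?_)))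
  · change p.1.fst = (∑ k, q k).1.fst
    rw [hfst]
    refine Lp.ext ?_
    filter_upwards [coeFn_finset_sum Finset.univ fun k => (q k).1.fst, ae_all_iff.2 hq0, hΩae]
      with x h1 h2 hx
    simp only [h1, h2, cut, indicator_of_mem hx]
    rw [← Finset.sum_mul, hsum x (subset_closure hx), one_mul]
  · change p.1.snd i = (∑ k, q k).1.snd i
    rw [hsnd]
    refine Lp.ext ?_
    filter_upwards [coeFn_finset_sum Finset.univ fun k => (q k).1.snd i,
      ae_all_iff.2 fun k => hq1 k i, hΩae] with x h1 h2 hx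
    simp only [h1, h2, cut, indicator_of_mem hx, Pi.add_apply]
    rw [Finset.sum_add_distrib, ← Finset.sum_mul, ← Finset.sum_mul,
      hsum x (subset_closure hx), hder i x hx]
    ring

/-- Every function in `H¹(Ω)` has a trace. The range of the energy space in `H¹(Ω)` is closed by the
lower bound of `exists_antilipschitz_toH1L`, and dense since functions smooth up to the boundary
are. -/
theorem surjective_toH1L (hΩ : IsOpen Ω) (hb : Bornology.IsBounded Ω)
    (hL : HasLipschitzBoundary Ω) : Function.Surjective (toH1L Ω) := by
  obtain ⟨C, hC, hanti⟩ := exists_antilipschitz_toH1L hΩ hb hL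
  have hcl : IsClosed (range (toH1L Ω)) := by
    have : AntilipschitzWith C.toNNReal (toH1L Ω) :=
      AddMonoidHomClass.antilipschitz_of_bound _ fun v => by
        rw [Real.coe_toNNReal C hC.le]
        exact hanti v
    exact this.isClosed_range (toH1L Ω).uniformContinuous
  obtain ⟨ι, _, χ, K, e, ε, h1, h2, h3, h4, h5, h6⟩ := exists_partition hΩ hb hL
  intro p
  choose q hq0 hq1 using fun k => exists_mul_H1 hΩ (h1 k) (h2 k) p
  -- Each localised piece is a limit of smooth functions, obtained by averaging over inward shifts.
  have hqmem : ∀ k, q k ∈ range (toH1L Ω) := by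
    intro k
    refine hcl.closure_subset (Metric.mem_closure_iff.2 fun δ hδ => ?_)
    set η := δ / (2 * (d + 1)) with hη
    have hη0 : 0 < η := by positivity
    obtain ⟨g, hg, hg0, hg1⟩ := exists_smooth_approx_H1 (h4 k) (h5 k)
      (F := cut Ω (χ k) p.1.fst)
      (G := fun i => cut Ω (χ k) (p.1.snd i) + cut Ω (pderiv i (χ k)) p.1.fst)
      (memLp_cut hΩ (h1 k).continuous (h2 k) _)
      (fun i => (memLp_cut hΩ (h1 k).continuous (h2 k) _).add (memLp_cut hΩ
        (contDiff_pderiv (h1 k) i).continuous (hasCompactSupport_pderiv (h2 k) i) _))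
      (measurable_cut hΩ (h1 k).continuous (measurable_lp _))
      (fun i => (measurable_cut hΩ (h1 k).continuous (measurable_lp _)).add
        (measurable_cut hΩ (contDiff_pderiv (h1 k) i).continuous (measurable_lp _)))
      hΩ (fun i => isLocalWeakDeriv_cut hΩ (p.2 i) (h1 k) (h2 k) (h3 k)) hη0
    obtain ⟨v, hv0, hv1⟩ := exists_energySpace_of_smooth hΩ hb hL hg
    refine ⟨_, ⟨v, rfl⟩, ?_⟩
    rw [dist_comm, dist_eq_norm]
    have := norm_H1_le_of_forall (p := toH1L Ω v - q k) hη0.le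
      (norm_sub_le_of_ae hv0 (hq0 k) hη0.le hg0)
      (fun i => norm_sub_le_of_ae (hv1 i) (hq1 k i) hη0.le (hg1 i))
    refine this.trans_lt ?_
    rw [hη]
    field_simp
    linarith
  have hsum := eq_sum_of_partition hΩ h1 h6 p q hq0 hq1
  rw [hsum]
  choose v hv using hqmem
  exact ⟨∑ k, v k, by simp [map_sum, hv]⟩

theorem H2.norm_fst_le (Φ : H2 Ω) : ‖Φ.1.fst‖ ≤ ‖Φ‖ := by
  refine le_of_sq_le_sq ?_ (norm_nonneg _)
  rw [H2.norm_sq]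
  have : 0 ≤ ∑ k, ‖Φ.1.snd k‖ ^ 2 := by positivity
  linarith

theorem H2.norm_snd_le (Φ : H2 Ω) (k : Fin d × Fin d) : ‖Φ.1.snd k‖ ≤ ‖Φ‖ := by
  refine le_of_sq_le_sq ?_ (norm_nonneg _)
  rw [H2.norm_sq]
  have := Finset.single_le_sum (f := fun k => ‖Φ.1.snd k‖ ^ 2) (fun i _ => sq_nonneg _)
    (Finset.mem_univ k)
  have h2 := sq_nonneg ‖Φ.1.fst‖
  simp only at this
  linarith

theorem H1.norm_fst_le (p : H1 Ω) : ‖p.1.fst‖ ≤ ‖p‖ := by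
  refine le_of_sq_le_sq ?_ (norm_nonneg _)
  rw [H1.norm_sq]
  have : 0 ≤ ∑ k, ‖p.1.snd k‖ ^ 2 := by positivity
  linarith

theorem H1.norm_snd_le (p : H1 Ω) (i : Fin d) : ‖p.1.snd i‖ ≤ ‖p‖ := by
  refine le_of_sq_le_sq ?_ (norm_nonneg _)
  rw [H1.norm_sq]
  have := Finset.single_le_sum (f := fun k => ‖p.1.snd k‖ ^ 2) (fun i _ => sq_nonneg _)
    (Finset.mem_univ i)
  have h2 := sq_nonneg ‖p.1.fst‖
  simp only at this
  linarith

theorem exists_bound_of_hasCompactSupport {χ : E → ℝ} (hχ : ContDiff ℝ ∞ χ)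
    (hχc : HasCompactSupport χ) : ∃ B, ∀ x, |χ x| ≤ B ∧ (∀ i, |pderiv i χ x| ≤ B) ∧
      ∀ i j, |pderiv j (pderiv i χ) x| ≤ B := by
  obtain ⟨B0, h0⟩ := hχ.continuous.bounded_above_of_compact_support hχc
  choose B1 h1 using fun i => (contDiff_pderiv hχ i).continuous.bounded_above_of_compact_support
    (hasCompactSupport_pderiv hχc i)
  choose B2 h2 using fun i j =>
    (contDiff_pderiv (contDiff_pderiv hχ i) j).continuous.bounded_above_of_compact_support
    (hasCompactSupport_pderiv (hasCompactSupport_pderiv hχc i) j)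
  obtain ⟨M1, hM1⟩ := Finite.exists_le B1
  obtain ⟨M2, hM2⟩ := Finite.exists_le fun p : Fin d × Fin d => B2 p.1 p.2
  refine ⟨max B0 (max M1 M2), fun x => ⟨(h0 x).trans (le_max_left _ _), fun i => ?_,
    fun i j => ?_⟩⟩
  · exact (h1 i x).trans ((hM1 i).trans ((le_max_left _ _).trans (le_max_right _ _)))
  · exact (h2 i j x).trans ((hM2 (i, j)).trans ((le_max_right _ _).trans (le_max_right _ _)))

set_option maxHeartbeats 1000000 in
/-- Averages over inward shifts of size `ε` of a cut-off function in `H²(Ω)` approximate it in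
`H¹(Ω)` with error `O(ε)`, and their second derivatives are controlled pointwise by local `L²`
norms of the second weak derivatives. -/
theorem exists_smooth_approx_H2 (hΩ : IsOpen Ω) {K : Set E} {e : E} {ε₀ : ℝ}
    (hK : HasInwardShifts Ω K e ε₀) {χ : E → ℝ} (hχ : ContDiff ℝ ∞ χ)
    (hχc : HasCompactSupport χ) (hχK : tsupport χ ⊆ K) :
    ∃ C > 0, ∀ Φ : H2 Ω, ∀ ε ∈ Ioc 0 ε₀, ∃ (g : E → ℝ) (G : Fin d → Fin d → E → ℝ),
      ContDiff ℝ ∞ g ∧ (∀ i j, Measurable (G i j)) ∧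
      (∀ i j, eLpNorm (G i j) 2 volume ≤ ENNReal.ofReal (C * ‖Φ‖)) ∧
      eLpNorm (fun x => g x - cut Ω χ Φ.1.fst.1.fst x) 2 (volume.restrict Ω) ≤
        ENNReal.ofReal (C * ε * ‖Φ‖) ∧
      (∀ i, eLpNorm (fun x => pderiv i g x - (cut Ω χ (Φ.1.fst.1.snd i) +
        cut Ω (pderiv i χ) Φ.1.fst.1.fst) x) 2 (volume.restrict Ω) ≤
        ENNReal.ofReal (C * ε * ‖Φ‖)) ∧
      ∀ x ∈ closure Ω, ∀ i j, ∀ S, MeasurableSet S → Metric.closedBall (x + ε • e) ε ⊆ S →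
        ‖pderiv j (pderiv i g) x‖ₑ ^ 2 ≤
          ENNReal.ofReal (1 / volume.real (Metric.closedBall (0 : E) (ε / 2))) *
            ∫⁻ z in S, ‖G i j z‖ₑ ^ 2 := by
  obtain ⟨B, hB⟩ := exists_bound_of_hasCompactSupport hχ hχc
  have hB0 : 0 ≤ B := (abs_nonneg _).trans (hB 0).1
  have he := norm_nonneg e
  have hχ1 := fun i => contDiff_pderiv hχ i
  have hχc1 := fun i => hasCompactSupport_pderiv hχc i
  have hχ2 := fun i j => contDiff_pderiv (hχ1 i) j
  have hχc2 := fun i j => hasCompactSupport_pderiv (hχc1 i) j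
  -- At most four terms, each bounded by `B ‖Φ‖`, make up a derivative of `χ Φ`; the factor `‖e‖ +
  -- 1` bounds the length of the shifts, relative to `ε`.
  set C := (‖e‖ + 1) * (d * (4 * B)) + 4 * B + 1 with hC
  have hCp : 0 ≤ (‖e‖ + 1) * (d * (4 * B)) := by positivity
  refine ⟨C, by positivity, fun Φ ε hε => ?_⟩
  set u := Φ.1.fst.1.fst with hu
  set D := fun i => Φ.1.fst.1.snd i with hD
  set D2 := fun i j => Φ.1.snd (i, j) with hD2
  have nu : ‖u‖ ≤ ‖Φ‖ := (H1.norm_fst_le _).trans (H2.norm_fst_le Φ)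
  have nD : ∀ i, ‖D i‖ ≤ ‖Φ‖ := fun i => (H1.norm_snd_le _ i).trans (H2.norm_fst_le Φ)
  have nD2 : ∀ i j, ‖D2 i j‖ ≤ ‖Φ‖ := fun i j => H2.norm_snd_le Φ (i, j)
  have hΦ := norm_nonneg Φ
  set F := cut Ω χ u with hF
  -- `G1` and `G2` are the first and second derivatives of `χ Φ` by the product rule, extended by
  -- zero.
  set G1 := fun i => cut Ω χ (D i) + cut Ω (pderiv i χ) u with hG1
  set G2 := fun i j => (cut Ω χ (D2 i j) + cut Ω (pderiv j χ) (D i)) +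
    (cut Ω (pderiv i χ) (D j) + cut Ω (pderiv j (pderiv i χ)) u) with hG2
  have m0 : ∀ f : L2Bulk Ω, MemLp (cut Ω χ f) 2 volume := memLp_cut hΩ hχ.continuous hχc
  have m1 : ∀ i, ∀ f : L2Bulk Ω, MemLp (cut Ω (pderiv i χ) f) 2 volume :=
    fun i => memLp_cut hΩ (hχ1 i).continuous (hχc1 i)
  have m2 : ∀ i j, ∀ f : L2Bulk Ω, MemLp (cut Ω (pderiv j (pderiv i χ)) f) 2 volume :=
    fun i j => memLp_cut hΩ (hχ2 i j).continuous (hχc2 i j)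
  have b0 : ∀ f : L2Bulk Ω, ‖f‖ ≤ ‖Φ‖ → eLpNorm (cut Ω χ f) 2 volume ≤
      ENNReal.ofReal (B * ‖Φ‖) := fun f hf =>
    (eLpNorm_cut_le hΩ (fun x => (hB x).1) f).trans (ENNReal.ofReal_le_ofReal (by gcongr))
  have b1 : ∀ i, ∀ f : L2Bulk Ω, ‖f‖ ≤ ‖Φ‖ → eLpNorm (cut Ω (pderiv i χ) f) 2 volume ≤
      ENNReal.ofReal (B * ‖Φ‖) := fun i f hf =>
    (eLpNorm_cut_le hΩ (fun x => (hB x).2.1 i) f).trans (ENNReal.ofReal_le_ofReal (by gcongr))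
  have b2 : ∀ i j, ∀ f : L2Bulk Ω, ‖f‖ ≤ ‖Φ‖ →
      eLpNorm (cut Ω (pderiv j (pderiv i χ)) f) 2 volume ≤ ENNReal.ofReal (B * ‖Φ‖) :=
    fun i j f hf => (eLpNorm_cut_le hΩ (fun x => (hB x).2.2 i j) f).trans
      (ENNReal.ofReal_le_ofReal (by gcongr))
  have mG1 : ∀ i, MemLp (G1 i) 2 volume := fun i => (m0 _).add (m1 _ _)
  have mG2 : ∀ i j, MemLp (G2 i j) 2 volume := fun i j =>
    ((m0 _).add (m1 _ _)).add ((m1 _ _).add (m2 _ _ _))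
  have nG1 : ∀ i, (eLpNorm (G1 i) 2 volume).toReal ≤ 4 * B * ‖Φ‖ := by
    intro i
    refine ENNReal.toReal_le_of_le_ofReal (by positivity) ?_
    refine (eLpNorm_add_le (m0 _).1 (m1 _ _).1 (by norm_num)).trans
      ((add_le_add (b0 _ (nD i)) (b1 i _ nu)).trans ?_)
    rw [← ENNReal.ofReal_add (by positivity) (by positivity)]
    refine ENNReal.ofReal_le_ofReal ?_
    nlinarith [mul_nonneg hB0 hΦ]
  have nG2' : ∀ i j, eLpNorm (G2 i j) 2 volume ≤ ENNReal.ofReal (4 * B * ‖Φ‖) := by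
    intro i j
    refine (eLpNorm_add_le ((m0 _).add (m1 _ _)).1 ((m1 _ _).add (m2 _ _ _)).1
      (by norm_num)).trans ?_
    refine (add_le_add (eLpNorm_add_le (m0 _).1 (m1 _ _).1 (by norm_num))
      (eLpNorm_add_le (m1 _ _).1 (m2 _ _ _).1 (by norm_num))).trans ?_
    refine (add_le_add (add_le_add (b0 _ (nD2 i j)) (b1 j _ (nD i)))
      (add_le_add (b1 i _ (nD j)) (b2 i j _ nu))).trans ?_
    rw [← ENNReal.ofReal_add (by positivity) (by positivity),
      ← ENNReal.ofReal_add (by positivity) (by positivity)]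
    refine ENNReal.ofReal_le_ofReal (le_of_eq ?_)
    ring
  have nG2 : ∀ i j, (eLpNorm (G2 i j) 2 volume).toReal ≤ 4 * B * ‖Φ‖ := fun i j =>
    ENNReal.toReal_le_of_le_ofReal (by positivity) (nG2' i j)
  have w1 : ∀ i, IsLocalWeakDeriv Ω K i F (G1 i) := fun i =>
    isLocalWeakDeriv_cut hΩ (Φ.1.fst.2 i) hχ hχc hχK
  have w2 : ∀ i j, IsLocalWeakDeriv Ω K j (G1 i) (G2 i j) := fun i j =>
    (isLocalWeakDeriv_cut hΩ (Φ.2 i j) hχ hχc hχK).add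
      (isLocalWeakDeriv_cut hΩ (Φ.1.fst.2 j) (hχ1 i) (hχc1 i)
        ((tsupport_pderiv_subset _ _).trans hχK))
      (m0 _) ((m0 _).add (m1 _ _)) (m1 _ _) ((m1 _ _).add (m2 _ _ _))
  have mF := m0 u
  have hFl : LocallyIntegrable F := mF.locallyIntegrable (by norm_num)
  have hG1l : ∀ i, LocallyIntegrable (G1 i) := fun i => (mG1 i).locallyIntegrable (by norm_num)
  have hFm : Measurable F := measurable_cut hΩ hχ.continuous (measurable_lp _)
  have hG1m : ∀ i, Measurable (G1 i) := fun i =>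
    (measurable_cut hΩ hχ.continuous (measurable_lp _)).add
      (measurable_cut hΩ (hχ1 i).continuous (measurable_lp _))
  have hG2m : ∀ i j, Measurable (G2 i j) := fun i j =>
    ((measurable_cut hΩ hχ.continuous (measurable_lp _)).add
      (measurable_cut hΩ (hχ1 j).continuous (measurable_lp _))).add
    ((measurable_cut hΩ (hχ1 i).continuous (measurable_lp _)).add
      (measurable_cut hΩ (hχ2 i j).continuous (measurable_lp _)))
  obtain ⟨κ, hκ, hκc, hκ0, hκ1, hκs, hκB⟩ := exists_kernel e hε.1
  have hin : ∀ x ∈ closure Ω, ∀ w ∈ tsupport κ, x + w ∈ K → x + w ∈ Ω :=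
    fun x hx w hw hwK => (hK.mono hε.2).add_mem hε.1 hx (hκs hw) hwK
  -- Averaging over shifts of size `ε` costs `ε` times the `L²` norm of the derivatives; this is
  -- used for `F` with derivatives `G1` and for `G1` with derivatives `G2`.
  have hshift : ∀ (H : E → ℝ) (H' : Fin d → E → ℝ), MemLp H 2 volume → Measurable H →
      (∀ i, MemLp (H' i) 2 volume) → (∀ i, IsLocalWeakDeriv Ω K i H (H' i)) →
      (∀ i, (eLpNorm (H' i) 2 volume).toReal ≤ 4 * B * ‖Φ‖) →
      eLpNorm (fun x => mollify κ H x - H x) 2 (volume.restrict Ω) ≤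
        ENNReal.ofReal (C * ε * ‖Φ‖) := by
    intro H H' k1 k2 k3 k4 k5
    refine eLpNorm_mollify_sub_le hκ.continuous hκc hκ0 hκ1 k2
      (k1.locallyIntegrable (by norm_num)) fun w hw => ?_
    obtain ⟨v, hv, rfl⟩ := exists_smul_of_mem_closedBall hε.1 (hκs hw)
    refine (eLpNorm_shift_sub_le hΩ hK k1 k3 k4 hv hε).trans (ENNReal.ofReal_le_ofReal ?_)
    have h1 : ∑ i, (eLpNorm (H' i) 2 volume).toReal ≤ ∑ _i : Fin d, 4 * B * ‖Φ‖ :=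
      Finset.sum_le_sum fun i _ => k5 i
    simp only [Finset.sum_const, Finset.card_univ, Fintype.card_fin, nsmul_eq_mul] at h1
    have hε0 := hε.1
    calc ε * ((‖e‖ + 1) * ∑ i, (eLpNorm (H' i) 2 volume).toReal)
        ≤ ε * ((‖e‖ + 1) * (d * (4 * B * ‖Φ‖))) := by gcongr
      _ = ((‖e‖ + 1) * (d * (4 * B))) * (ε * ‖Φ‖) := by ring
      _ ≤ C * (ε * ‖Φ‖) := by
        gcongr
        rw [hC]
        linarith
      _ = _ := by ring
  refine ⟨mollify κ F, fun i j => G2 j i, contDiff_mollify hκ hκc hFl, fun i j => hG2m j i,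
    fun i j => (nG2' j i).trans (ENNReal.ofReal_le_ofReal ?_), ?_, fun i => ?_, ?_⟩
  · gcongr
    rw [hC]
    linarith
  · exact hshift F G1 mF hFm mG1 w1 nG1
  · refine le_trans (le_of_eq (eLpNorm_congr_ae ?_))
      (hshift (G1 i) (G2 i) (mG1 i) (hG1m i) (mG2 i) (w2 i) (nG2 i))
    filter_upwards [ae_restrict_mem hΩ.measurableSet] with x hx
    rw [pderiv_mollify hκ hκc hFl, (w1 i).mollify_pderiv hκ hκc (hin x (subset_closure hx)),
      neg_neg]
  · intro x hx i j S hS hball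
    have h1 : pderiv j (pderiv i (mollify κ F)) x = mollify κ (G2 j i) x := by
      have h2 : pderiv i (mollify κ F) = fun x => -mollify (pderiv i κ) F x :=
        funext fun x => pderiv_mollify hκ hκc hFl i x
      have hκ' := contDiff_pderiv hκ i
      have hκc' := hasCompactSupport_pderiv hκc i
      have h3 : ∀ f : E → ℝ, pderiv j (fun x => -f x) x = -pderiv j f x := by
        intro f
        simp [pderiv, fderiv_fun_neg]
      rw [h2, h3, pderiv_mollify hκ' hκc' hFl, neg_neg, (w1 j).mollify_pderiv hκ' hκc'
        (fun w hw => hin x hx w (tsupport_pderiv_subset _ _ hw)),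
        (w2 j i).mollify_pderiv hκ hκc (hin x hx), neg_neg]
    rw [h1]
    refine enorm_mollify_sq_le hκ.continuous hκ0 hκ1 hκB (hG2m j i) (fun w hw => hball ?_) hS
    have h4 : ‖w - ε • e‖ ≤ ε := by simpa [dist_eq_norm] using hκs hw
    rw [Metric.mem_closedBall, dist_eq_norm, add_sub_add_left_eq_sub]
    exact h4

end Density

/-! ### Affine interpolation on a simplex -/

section Simplex

variable {d : ℕ} {Ω : Set (EuclideanSpace ℝ (Fin d))}

local notation "E" => EuclideanSpace ℝ (Fin d)

theorem norm_fderiv_le {φ : E → ℝ} {x : E} {M : ℝ} (hM : ∀ i, |pderiv i φ x| ≤ M) (hM0 : 0 ≤ M) :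
    ‖fderiv ℝ φ x‖ ≤ d * M := by
  refine ContinuousLinearMap.opNorm_le_bound _ (by positivity) fun v => ?_
  rw [fderiv_apply_eq_sum]
  calc ‖∑ i, v i * pderiv i φ x‖ ≤ ∑ i : Fin d, ‖v i * pderiv i φ x‖ := norm_sum_le _ _
    _ ≤ ∑ i : Fin d, ‖v‖ * M := by
        refine Finset.sum_le_sum fun i _ => ?_
        rw [norm_mul]
        exact mul_le_mul (PiLp.norm_apply_le v i) (hM i) (norm_nonneg _) (norm_nonneg _)
    _ = d * M * ‖v‖ := by simp; ring

theorem abs_sub_le_of_pderiv_le {φ : E → ℝ} (hφ : ContDiff ℝ ∞ φ) {S : Set E} (hS : Convex ℝ S)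
    {M : ℝ} (hM0 : 0 ≤ M) (hM : ∀ x ∈ S, ∀ i, |pderiv i φ x| ≤ M) {x z : E} (hx : x ∈ S)
    (hz : z ∈ S) : |φ z - φ x| ≤ d * M * ‖z - x‖ :=
  hS.norm_image_sub_le_of_norm_fderiv_le (𝕜 := ℝ)
    (fun y _ => hφ.differentiable (by simp) y) (fun y hy => norm_fderiv_le (hM y hy) hM0) hx hz

/-- The remainder of the first-order Taylor polynomial on a convex set. -/
theorem abs_taylor_le {g : E → ℝ} (hg : ContDiff ℝ ∞ g) {S : Set E} (hS : Convex ℝ S) {M : ℝ}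
    (hM0 : 0 ≤ M) (hM : ∀ x ∈ S, ∀ i j, |pderiv j (pderiv i g) x| ≤ M) {x z : E} (hx : x ∈ S)
    (hz : z ∈ S) : |g z - g x - fderiv ℝ g x (z - x)| ≤ d * (d * M) * ‖z - x‖ ^ 2 := by
  set ψ : E → ℝ := fun y => g y - fderiv ℝ g x y with hψ
  have hψs : ContDiff ℝ ∞ ψ := hg.sub (fderiv ℝ g x).contDiff
  have hp : ∀ i y, pderiv i ψ y = pderiv i g y - pderiv i g x := by
    intro i y
    have h := (hg.differentiable (by simp) y).hasFDerivAt.sub ((fderiv ℝ g x).hasFDerivAt (x := y))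
    have h2 : fderiv ℝ ψ y = fderiv ℝ g y - fderiv ℝ g x := h.fderiv
    simp [pderiv, h2]
  have hb : ∀ y ∈ segment ℝ x z, ∀ i, |pderiv i ψ y| ≤ d * M * ‖z - x‖ := by
    intro y hy i
    rw [hp]
    refine (abs_sub_le_of_pderiv_le (contDiff_pderiv hg i) hS hM0 (fun y hy j => hM y hy i j) hx
      (hS.segment_subset hx hz hy)).trans ?_
    gcongr
    have := norm_sub_le_of_mem_segment hy
    simpa [norm_sub_rev] using this
  have := abs_sub_le_of_pderiv_le hψs (convex_segment x z) (by positivity) hb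
    (left_mem_segment ℝ x z) (right_mem_segment ℝ x z)
  calc |g z - g x - fderiv ℝ g x (z - x)| = |ψ z - ψ x| := by
        congr 1; simp only [hψ, map_sub]; ring
    _ ≤ _ := this
    _ = _ := by ring

/-- The error of affine interpolation on a simplex `S` of diameter at most `h` that contains a
ball of radius `r`. The first-order Taylor polynomial of `g` at `x` differs from `A` by an affine
function that is small at the vertices, hence on all of `S`; its slope is then controlled by its
oscillation across the inscribed ball. -/
theorem affine_interpolation_le {g : E → ℝ} (hg : ContDiff ℝ ∞ g) {s : Set E} {M h r : ℝ}
    (hM0 : 0 ≤ M) (hr : 0 < r)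
    (hM : ∀ x ∈ convexHull ℝ s, ∀ i j, |pderiv j (pderiv i g) x| ≤ M)
    (hh : ∀ x ∈ convexHull ℝ s, ∀ y ∈ convexHull ℝ s, ‖x - y‖ ≤ h)
    {c : E} (hc : Metric.closedBall c r ⊆ convexHull ℝ s) {A : E →ᵃ[ℝ] ℝ}
    (hA : ∀ z ∈ s, A z = g z) {x : E} (hx : x ∈ convexHull ℝ s) :
    |g x - A x| ≤ d * (d * M) * h ^ 2 ∧
      ∀ i, |pderiv i g x - A.linear (EuclideanSpace.single i 1)| ≤ d * (d * M) * h ^ 2 / r := by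
  -- `L` is the Taylor polynomial minus `A`. At a vertex, where `A = g`, it is the Taylor remainder.
  set L : E →ᵃ[ℝ] ℝ := (AffineMap.const ℝ E (g x - fderiv ℝ g x x) +
    (fderiv ℝ g x).toLinearMap.toAffineMap) - A with hL
  have hLv : ∀ y, L y = g x + fderiv ℝ g x (y - x) - A y := by
    intro y
    simp [hL, map_sub]
    ring
  set δ := d * (d * M) * h ^ 2 with hδ
  have hb : convexHull ℝ s ⊆ L ⁻¹' Icc (-δ) δ := by
    refine convexHull_min (fun z hz => ?_) ((convex_Icc _ _).affine_preimage L)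
    have hz' := subset_convexHull ℝ s hz
    have h1 := abs_taylor_le hg (convex_convexHull ℝ s) hM0 hM hx hz'
    have h2 : |L z| ≤ δ := by
      rw [hLv, hA z hz, abs_sub_comm]
      calc _ = |g z - g x - fderiv ℝ g x (z - x)| := by congr 1; ring
        _ ≤ _ := h1
        _ ≤ _ := by
          rw [hδ]; gcongr
          exact hh z hz' x hx
    exact abs_le.1 h2
  refine ⟨?_, fun i => ?_⟩
  · have := abs_le.2 (hb hx)
    simpa [hLv] using this
  · have hn : ‖r • (EuclideanSpace.single i 1 : E)‖ = r := by
      rw [norm_smul]; simp [abs_of_pos hr]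
    -- The slope of `L` in direction `i` is its difference over the diameter of the ball in that
    -- direction, divided by `2 r`.
    have h1 := hb (hc (show c + r • (EuclideanSpace.single i 1 : E) ∈ Metric.closedBall c r by
      rw [Metric.mem_closedBall, dist_eq_norm]; simp [-PiLp.norm_single, hn]))
    have h2 := hb (hc (show c - r • (EuclideanSpace.single i 1 : E) ∈ Metric.closedBall c r by
      rw [Metric.mem_closedBall, dist_eq_norm, sub_sub_cancel_left, norm_neg, hn]))
    have h3 : L (c + r • (EuclideanSpace.single i 1 : E)) -
        L (c - r • (EuclideanSpace.single i 1 : E)) =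
        2 * r * (pderiv i g x - A.linear (EuclideanSpace.single i 1)) := by
      have e1 := AffineMap.linearMap_vsub A (c + r • (EuclideanSpace.single i 1 : E))
        (c - r • (EuclideanSpace.single i 1 : E))
      have e2 : (c + r • (EuclideanSpace.single i 1 : E)) -
        (c - r • (EuclideanSpace.single i 1 : E)) = (2 * r) • EuclideanSpace.single i 1 := by
        module
      rw [vsub_eq_sub, vsub_eq_sub, e2, map_smul, smul_eq_mul] at e1
      have e3 : fderiv ℝ g x (c + r • (EuclideanSpace.single i 1 : E) - x) -
        fderiv ℝ g x (c - r • (EuclideanSpace.single i 1 : E) - x) = 2 * r * pderiv i g x := by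
        rw [← map_sub, sub_sub_sub_cancel_right, e2, map_smul, smul_eq_mul, pderiv]
      rw [hLv, hLv]
      linear_combination e3 + e1
    rw [le_div_iff₀ hr]
    have h4 : |pderiv i g x - A.linear (EuclideanSpace.single i 1)| * r =
        |(pderiv i g x - A.linear (EuclideanSpace.single i 1)) * r| := by
      rw [abs_mul, abs_of_pos hr]
    rw [h4, abs_le]
    simp only [mem_preimage, mem_Icc] at h1 h2
    constructor <;> linarith [h1.1, h1.2, h2.1, h2.2]

/-- Values prescribed at the vertices of a `d`-simplex extend to an affine function. -/
theorem exists_affine_interpolant {s : Finset E} (hs : AffineIndependent ℝ ((↑) : s → E))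
    (hcard : s.card = d + 1) (g : E → ℝ) : ∃ A : E →ᵃ[ℝ] ℝ, ∀ z ∈ s, A z = g z := by
  have htop : affineSpan ℝ (range ((↑) : s → E)) = ⊤ := by
    rw [hs.affineSpan_eq_top_iff_card_eq_finrank_add_one]
    simp [hcard]
  let b : AffineBasis s ℝ E := ⟨_, hs, htop⟩
  refine ⟨∑ w : s, g w • b.coord w, fun z hz => ?_⟩
  have hz' : z = b ⟨z, hz⟩ := rfl
  have : ∀ (t : Finset s) (y : E), (∑ w ∈ t, g w • b.coord w) y = ∑ w ∈ t, g w * b.coord w y := by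
    intro t y
    classical
    induction t using Finset.induction_on with
    | empty => simp
    | insert a t ha ih => rw [Finset.sum_insert ha, Finset.sum_insert ha, ← ih]; simp
  rw [this, hz']
  simp only [AffineBasis.coord_apply, mul_ite, mul_one, mul_zero, Finset.sum_ite_eq',
    Finset.mem_univ, if_true]
  rfl

end Simplex

/-! ### Continuous piecewise affine functions -/

/-- A continuous function on an interval that is `M`-Lipschitz on each of finitely many closed
sets covering the interval varies by at most `M` times the length of the interval. -/
theorem abs_sub_le_of_finite_cover {ι : Type*} (I : Finset ι) {C : ι → Set ℝ} {f : ℝ → ℝ}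
    {a b M : ℝ} (hab : a ≤ b) (hf : ContinuousOn f (Icc a b)) (hC : ∀ k ∈ I, IsClosed (C k))
    (hcov : ∀ t ∈ Icc a b, ∃ k ∈ I, t ∈ C k)
    (hL : ∀ k ∈ I, ∀ x ∈ C k, ∀ y ∈ C k, |f y - f x| ≤ M * |y - x|) :
    |f b - f a| ≤ M * (b - a) := by
  set S := {t | |f t - f a| ≤ M * (t - a)} with hS
  have hcl : IsClosed (S ∩ Icc a b) := by
    have : S ∩ Icc a b = {t ∈ Icc a b | |f t - f a| ≤ M * (t - a)} := by
      ext t; simp [hS, and_comm]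
    rw [this]
    exact isClosed_Icc.isClosed_le (hf.sub continuousOn_const).abs (by fun_prop)
  have := hcl.Icc_subset_of_forall_exists_gt (show a ∈ S by simp [hS]) ?_
  · exact this (right_mem_Icc.2 hab)
  -- One of the finitely many closed sets contains points arbitrarily close to `t` on its right,
  -- hence also `t`.
  rintro t ⟨htS, hta, htb⟩ y hy
  have hfr : ∃ᶠ z in 𝓝[>] t, ∃ k ∈ I, z ∈ C k := by
    refine Eventually.frequently ?_
    filter_upwards [Ioo_mem_nhdsGT htb] with z hz
    exact hcov z ⟨hta.trans hz.1.le, hz.2.le⟩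
  obtain ⟨k, hk, hfk⟩ : ∃ k ∈ I, ∃ᶠ z in 𝓝[>] t, z ∈ C k := by
    by_contra! hcon
    refine hfr ?_
    have h2 : ∀ k ∈ I, ∀ᶠ z in 𝓝[>] t, z ∉ C k := hcon
    filter_upwards [(eventually_all_finset I).2 h2] with z hz
    rintro ⟨k, hk, hzk⟩
    exact hz k hk hzk
  have htC : t ∈ C k := by
    rw [← (hC k hk).closure_eq, mem_closure_iff_frequently]
    exact hfk.filter_mono nhdsWithin_le_nhds
  obtain ⟨z, hzC, hz⟩ := (hfk.and_eventually (Ioc_mem_nhdsGT hy)).exists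
  refine ⟨z, ?_, hz⟩
  have h1 := hL k hk t htC z hzC
  rw [abs_of_pos (sub_pos.2 hz.1)] at h1
  have h2 : |f t - f a| ≤ M * (t - a) := htS
  change |f z - f a| ≤ M * (z - a)
  calc |f z - f a| ≤ |f z - f t| + |f t - f a| := abs_sub_le _ _ _
    _ ≤ M * (z - t) + M * (t - a) := add_le_add h1 h2
    _ = _ := by ring

section Piecewise

variable {d : ℕ} {Ω : Set (EuclideanSpace ℝ (Fin d))}

local notation "E" => EuclideanSpace ℝ (Fin d)

theorem isClosed_convexHull_finset (s : Finset E) : IsClosed (convexHull ℝ (s : Set E)) :=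
  (s.finite_toSet.isCompact_convexHull ℝ).isClosed

/-- The elements of a triangulation. -/
noncomputable def IsTriangulation.cells {K : Geometry.SimplicialComplex ℝ E}
    (hK : IsTriangulation Ω K) : Finset (Finset E) :=
  letI := Classical.propDecidable
  hK.finite.toFinset.filter fun s => s.card = d + 1

theorem IsTriangulation.mem_cells {K : Geometry.SimplicialComplex ℝ E} (hK : IsTriangulation Ω K)
    {s : Finset E} : s ∈ hK.cells ↔ s ∈ K.faces ∧ s.card = d + 1 := by
  simp [IsTriangulation.cells]

theorem IsTriangulation.closure_eq {K : Geometry.SimplicialComplex ℝ E}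
    (hK : IsTriangulation Ω K) : closure Ω = ⋃ s ∈ hK.cells, convexHull ℝ (s : Set E) := by
  rw [← hK.space_eq]
  refine Subset.antisymm (fun x hx => ?_) ?_
  · obtain ⟨s, hs, hxs⟩ := Geometry.SimplicialComplex.mem_space_iff.1 hx
    obtain ⟨t, ht, hst, hc⟩ := hK.pure s hs
    exact mem_biUnion (hK.mem_cells.2 ⟨ht, hc⟩)
      (convexHull_mono (Finset.coe_subset.2 hst) hxs)
  · exact iUnion₂_subset fun s hs =>
      Geometry.SimplicialComplex.convexHull_subset_space (hK.mem_cells.1 hs).1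

/-- The piecewise affine nodal interpolant `p` of a function `g`, equal to `A s` on the element `s`.
It is well defined since two elements meet in the convex hull of their common vertices. -/
theorem exists_interpolant {K : Geometry.SimplicialComplex ℝ E} (hK : IsTriangulation Ω K)
    (g : E → ℝ) : ∃ (p : E → ℝ) (A : Finset E → (E →ᵃ[ℝ] ℝ)), ContinuousOn p (closure Ω) ∧
      ∀ s ∈ hK.cells, EqOn p (A s) (convexHull ℝ (s : Set E)) ∧ ∀ z ∈ s, A s z = g z := by
  classical
  have h1 : ∀ s : Finset E, ∃ A : E →ᵃ[ℝ] ℝ, s ∈ hK.cells → ∀ z ∈ s, A z = g z := by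
    intro s
    by_cases hs : s ∈ hK.cells
    · have := hK.mem_cells.1 hs
      obtain ⟨A, hA⟩ := exists_affine_interpolant (K.indep this.1) this.2 g
      exact ⟨A, fun _ => hA⟩
    · exact ⟨0, fun h => absurd h hs⟩
  choose A hA using h1
  have key : ∀ s ∈ hK.cells, ∀ t ∈ hK.cells, ∀ x ∈ convexHull ℝ (s : Set E),
      x ∈ convexHull ℝ (t : Set E) → A s x = A t x := by
    intro s hs t ht x hxs hxt
    have hx := K.inter_subset_convexHull (hK.mem_cells.1 hs).1 (hK.mem_cells.1 ht).1 ⟨hxs, hxt⟩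
    have : convexHull ℝ (s ∩ t : Set E) ⊆ (A s - A t) ⁻¹' {0} := by
      refine convexHull_min (fun z hz => ?_) ((convex_singleton _).affine_preimage _)
      simp [hA s hs z hz.1, hA t ht z hz.2]
    have := this hx
    simpa [sub_eq_zero] using this
  let p : E → ℝ := fun x =>
    if h : ∃ s ∈ hK.cells, x ∈ convexHull ℝ (s : Set E) then A h.choose x else 0
  have hp : ∀ s ∈ hK.cells, EqOn p (A s) (convexHull ℝ (s : Set E)) := by
    intro s hs x hx
    have h : ∃ s ∈ hK.cells, x ∈ convexHull ℝ (s : Set E) := ⟨s, hs, hx⟩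
    simp only [p, dif_pos h]
    exact key _ h.choose_spec.1 _ hs x h.choose_spec.2 hx
  refine ⟨p, A, ?_, fun s hs => ⟨hp s hs, hA s hs⟩⟩
  have hU : closure Ω = ⋃ s : hK.cells, convexHull ℝ ((s : Finset E) : Set E) := by
    rw [hK.closure_eq]; ext; simp
  rw [hU]
  refine LocallyFinite.continuousOn_iUnion (locallyFinite_of_finite _)
    (fun s => isClosed_convexHull_finset _) fun s => ?_
  exact ((A s.1).continuous_of_finiteDimensional.continuousOn).congr (hp s.1 s.2)

theorem abs_affine_sub_le (A : E →ᵃ[ℝ] ℝ) (x y : E) :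
    |A y - A x| ≤ ‖A.linear.toContinuousLinearMap‖ * ‖y - x‖ := by
  have h := A.linear.toContinuousLinearMap.le_opNorm (y - x)
  have e := AffineMap.linearMap_vsub A y x
  simp only [vsub_eq_sub] at e
  rwa [LinearMap.coe_toContinuousLinearMap', e, Real.norm_eq_abs] at h

theorem hasDerivAt_affine (A : E →ᵃ[ℝ] ℝ) (x v : E) :
    HasDerivAt (fun t : ℝ => A (x + t • v)) (A.linear v) 0 := by
  have h : (fun t : ℝ => A (x + t • v)) = fun t => t * A.linear v + A x := by
    funext t
    have := A.map_vadd x (t • v)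
    simp only [vadd_eq_add, map_smul, smul_eq_mul] at this
    rw [add_comm, this]
  rw [h]
  simpa using ((hasDerivAt_id (0 : ℝ)).mul_const (A.linear v)).add_const (A x)

theorem pderiv_eq_of_eventuallyEq {q : E → ℝ} {A : E →ᵃ[ℝ] ℝ} {x : E} (h : q =ᶠ[𝓝 x] A)
    (i : Fin d) : pderiv i q x = A.linear (EuclideanSpace.single i 1) := by
  have h2 : HasFDerivAt A A.linear.toContinuousLinearMap x := by
    have : (A : E → ℝ) = fun y => A.linear.toContinuousLinearMap y + A 0 := by
      funext y
      have := A.map_vadd 0 y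
      simpa using this
    rw [this]
    exact A.linear.toContinuousLinearMap.hasFDerivAt.add_const _
  rw [pderiv, h.fderiv_eq, h2.fderiv]
  rfl

/-- A continuous piecewise affine function is Lipschitz along segments in the domain, since the
elements cut a segment into finitely many closed sets. -/
theorem abs_sub_le_of_piecewise {K : Geometry.SimplicialComplex ℝ E} (hK : IsTriangulation Ω K)
    {p : E → ℝ} {A : Finset E → (E →ᵃ[ℝ] ℝ)} (hp : ContinuousOn p (closure Ω))
    (hpA : ∀ s ∈ hK.cells, EqOn p (A s) (convexHull ℝ (s : Set E))) {x y : E}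
    (hxy : segment ℝ x y ⊆ Ω) :
    |p y - p x| ≤ (∑ s ∈ hK.cells, ‖(A s).linear.toContinuousLinearMap‖) * ‖y - x‖ := by
  set ℓ : ℝ → E := fun t => x + t • (y - x) with hℓ
  have hℓc : Continuous ℓ := by fun_prop
  have hℓm : ∀ t ∈ Icc (0 : ℝ) 1, ℓ t ∈ closure Ω := by
    intro t ht
    apply subset_closure
    apply hxy
    rw [segment_eq_image']
    exact ⟨t, ht, rfl⟩
  have := abs_sub_le_of_finite_cover hK.cells
    (C := fun s => ℓ ⁻¹' convexHull ℝ (s : Set E)) (f := fun t => p (ℓ t)) (a := 0) (b := 1)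
    (M := (∑ s ∈ hK.cells, ‖(A s).linear.toContinuousLinearMap‖) * ‖y - x‖) zero_le_one
    (hp.comp hℓc.continuousOn hℓm)
    (fun s _ => (isClosed_convexHull_finset s).preimage hℓc)
    (fun t ht => by
      have := hℓm t ht
      rw [hK.closure_eq] at this
      simpa using this)
    (fun s hs t ht t' ht' => by
      rw [hpA s hs ht, hpA s hs ht']
      refine (abs_affine_sub_le (A s) _ _).trans ?_
      have h1 : ℓ t' - ℓ t = (t' - t) • (y - x) := by simp only [hℓ]; module
      rw [h1, norm_smul, Real.norm_eq_abs]
      calc _ = ‖(A s).linear.toContinuousLinearMap‖ * ‖y - x‖ * |t' - t| := by ring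
        _ ≤ _ := by
          gcongr
          exact Finset.single_le_sum
            (f := fun s => ‖(A s).linear.toContinuousLinearMap‖) (fun _ _ => norm_nonneg _) hs)
  simpa [hℓ] using this

/-- Almost every point of the domain is an interior point of an element. -/
theorem ae_mem_interior_cell (hΩ : IsOpen Ω) {K : Geometry.SimplicialComplex ℝ E}
    (hK : IsTriangulation Ω K) :
    ∀ᵐ x ∂(volume.restrict Ω), x ∈ Ω ∧ ∃ s ∈ hK.cells, x ∈ interior (convexHull ℝ (s : Set E)) := by
  have h1 : ∀ᵐ x ∂(volume.restrict Ω), ∀ s ∈ hK.cells,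
      x ∉ frontier (convexHull ℝ (s : Set E)) := by
    rw [Finset.eventually_all]
    intro s _
    exact ae_restrict_of_ae
      (measure_eq_zero_iff_ae_notMem.1 ((convex_convexHull ℝ _).addHaar_frontier volume))
  filter_upwards [h1, ae_restrict_mem hΩ.measurableSet] with x hx hxΩ
  refine ⟨hxΩ, ?_⟩
  have h2 := subset_closure hxΩ
  rw [hK.closure_eq] at h2
  simp only [mem_iUnion] at h2
  obtain ⟨s, hs, hxs⟩ := h2
  refine ⟨s, hs, ?_⟩
  by_contra hcon
  exact hx s hs ⟨subset_closure hxs, hcon⟩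

theorem measurable_indicator_of_continuousOn (hΩ : IsOpen Ω) {p : E → ℝ}
    (hp : ContinuousOn p (closure Ω)) : Measurable (Ω.indicator p) := by
  classical
  rw [← piecewise_eq_indicator]
  exact (hp.mono subset_closure).measurable_piecewise continuousOn_const hΩ.measurableSet

/-- Integration by parts for continuous piecewise affine functions: the weak derivatives are the
piecewise constant classical ones. -/
theorem integral_mul_pderiv_of_piecewise (hΩ : IsOpen Ω) (hb : Bornology.IsBounded Ω)
    {K : Geometry.SimplicialComplex ℝ E} (hK : IsTriangulation Ω K)
    {p : E → ℝ} {A : Finset E → (E →ᵃ[ℝ] ℝ)} (hp : ContinuousOn p (closure Ω))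
    (hpA : ∀ s ∈ hK.cells, EqOn p (A s) (convexHull ℝ (s : Set E))) (i : Fin d) {φ : E → ℝ}
    (hφ : ContDiff ℝ ∞ φ) (hφc : HasCompactSupport φ) (hφΩ : tsupport φ ⊆ Ω) :
    ∫ x, Ω.indicator p x * pderiv i φ x = -∫ x, pderiv i (Ω.indicator p) x * φ x := by
  set q := Ω.indicator p with hq
  set M := ∑ s ∈ hK.cells, ‖(A s).linear.toContinuousLinearMap‖ with hM
  have hM0 : 0 ≤ M := Finset.sum_nonneg fun _ _ => norm_nonneg _
  have hqm : Measurable q := measurable_indicator_of_continuousOn hΩ hp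
  obtain ⟨B, hB⟩ : ∃ B, ∀ x, ‖q x‖ ≤ B := by
    obtain ⟨B, hB⟩ := hb.isCompact_closure.exists_bound_of_continuousOn hp
    refine ⟨max B 0, fun x => ?_⟩
    by_cases hx : x ∈ Ω
    · rw [hq, indicator_of_mem hx]
      exact (hB x (subset_closure hx)).trans (le_max_left _ _)
    · rw [hq, indicator_of_notMem hx]; simp
  have hqloc : LocallyIntegrable q :=
    (locallyIntegrable_const B).mono hqm.aestronglyMeasurable
      (ae_of_all _ fun x => (hB x).trans (le_abs_self B))
  -- Differentiate `∫ q (x + t e) φ x` at `t = 0` in two ways: under the integral on `q`, which is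
  -- Lipschitz along short segments starting in the support of `φ`, and as the average
  -- `mollify φ q (t e)`, whose derivative falls on `φ`.
  obtain ⟨δ, hδ, hδΩ⟩ := hφc.isCompact.exists_cthickening_subset_open hΩ hφΩ
  set e : E := EuclideanSpace.single i 1 with he
  have hne : ‖e‖ = 1 := by simp [he]
  have hin : ∀ x ∈ tsupport φ, ∀ t ∈ Metric.ball (0 : ℝ) δ, x + t • e ∈ Metric.ball x δ := by
    intro x hx t ht
    rw [mem_ball_zero_iff, Real.norm_eq_abs] at ht
    rw [Metric.mem_ball, dist_eq_norm, add_sub_cancel_left, norm_smul, hne, mul_one]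
    exact ht
  have hbΩ : ∀ x ∈ tsupport φ, Metric.ball x δ ⊆ Ω := fun x hx => by
    refine Subset.trans (fun y hy => ?_) hδΩ
    exact Metric.mem_cthickening_of_dist_le y x δ _ hx (Metric.mem_ball.1 hy).le
  have hφi : Integrable φ := hφ.continuous.integrable_of_hasCompactSupport hφc
  have hlip : ∀ x ∈ tsupport φ, ∀ t ∈ Metric.ball (0 : ℝ) δ, ∀ t' ∈ Metric.ball (0 : ℝ) δ,
      |q (x + t • e) - q (x + t' • e)| ≤ M * |t - t'| := by
    intro x hx t ht t' ht'
    have h1 : segment ℝ (x + t' • e) (x + t • e) ⊆ Ω :=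
      ((convex_ball x δ).segment_subset (hin x hx t' ht') (hin x hx t ht)).trans (hbΩ x hx)
    have h2 := abs_sub_le_of_piecewise hK hp hpA h1
    rw [hq, indicator_of_mem (h1 (right_mem_segment ..)),
      indicator_of_mem (h1 (left_mem_segment ..))]
    refine h2.trans_eq ?_
    have : x + t • e - (x + t' • e) = (t - t') • e := by module
    rw [this, norm_smul, hne, mul_one, Real.norm_eq_abs]
  have hae := ae_mem_interior_cell hΩ hK
  rw [ae_restrict_iff' hΩ.measurableSet] at hae
  have hD := hasDerivAt_integral_of_dominated_loc_of_lip (𝕜 := ℝ) (μ := volume)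
    (F := fun t x => q (x + t • e) * φ x) (F' := fun x => pderiv i q x * φ x)
    (bound := fun x => M * |φ x|) (x₀ := (0 : ℝ)) (Metric.ball_mem_nhds 0 hδ)
    (Eventually.of_forall fun t =>
      ((hqm.comp (measurable_add_const _)).mul hφ.continuous.measurable).aestronglyMeasurable)
    (by
      simp only [zero_smul, add_zero]
      exact hφi.bdd_mul hqm.aestronglyMeasurable (ae_of_all _ hB))
    ((measurable_fderiv_apply_const ℝ q e).mul hφ.continuous.measurable).aestronglyMeasurable
    (ae_of_all _ fun x => by
      refine LipschitzOnWith.of_dist_le_mul fun t ht t' ht' => ?_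
      rw [Real.coe_nnabs, abs_mul, abs_of_nonneg hM0, abs_abs, Real.dist_eq, Real.dist_eq,
        ← sub_mul, abs_mul]
      by_cases hx : x ∈ tsupport φ
      · calc _ ≤ M * |t - t'| * |φ x| :=
              mul_le_mul_of_nonneg_right (hlip x hx t ht t' ht') (abs_nonneg _)
          _ = _ := by ring
      · simp [image_eq_zero_of_notMem_tsupport hx])
    (hφi.abs.const_mul M)
    (by
      filter_upwards [hae] with x hx
      by_cases hxφ : x ∈ tsupport φ
      · obtain ⟨hxΩ, s, hs, hxs⟩ := hx (hφΩ hxφ)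
        have hev : q =ᶠ[𝓝 x] A s := by
          filter_upwards [hΩ.mem_nhds hxΩ, mem_interior_iff_mem_nhds.1 hxs] with y hy hys
          rw [hq, indicator_of_mem hy, hpA s hs hys]
        rw [pderiv_eq_of_eventuallyEq hev]
        have hc : Tendsto (fun t : ℝ => x + t • e) (𝓝 0) (𝓝 x) := by
          have : Continuous fun t : ℝ => x + t • e := by fun_prop
          simpa using this.tendsto 0
        exact ((hasDerivAt_affine (A s) x e).congr_of_eventuallyEq
          (hc.eventually hev)).mul_const _
      · simp only [image_eq_zero_of_notMem_tsupport hxφ, mul_zero]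
        exact hasDerivAt_const _ _)
  have h1 : HasDerivAt (fun t : ℝ => mollify φ q (t • e)) (pderiv i (mollify φ q) 0) 0 := by
    have h2 := ((contDiff_mollify hφ hφc hqloc).differentiable (by simp) 0).hasFDerivAt
    have h3 : HasDerivAt (fun t : ℝ => t • e) e 0 := by
      simpa using (hasDerivAt_id (0 : ℝ)).smul_const e
    have h4 : HasFDerivAt (mollify φ q) (fderiv ℝ (mollify φ q) 0) ((0 : ℝ) • e) := by
      simpa using h2
    exact h4.comp_hasDerivAt 0 h3
  have h5 : (fun t : ℝ => mollify φ q (t • e)) = fun t => ∫ x, q (x + t • e) * φ x := by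
    funext t
    rw [mollify_eq]
    simp only [add_comm]
  rw [h5] at h1
  have h6 := h1.unique hD.2
  rw [pderiv_mollify hφ hφc hqloc, mollify] at h6
  simp only [sub_zero] at h6
  linarith

/-- Continuous piecewise affine functions belong to `H¹(Ω)`, with their classical derivatives on
each element as weak derivatives. -/
theorem exists_energySpace_of_piecewise (hΩ : IsOpen Ω) (hb : Bornology.IsBounded Ω)
    (hL : HasLipschitzBoundary Ω)
    {K : Geometry.SimplicialComplex ℝ E} (hK : IsTriangulation Ω K)
    {p : E → ℝ} {A : Finset E → (E →ᵃ[ℝ] ℝ)} (hp : ContinuousOn p (closure Ω))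
    (hpA : ∀ s ∈ hK.cells, EqOn p (A s) (convexHull ℝ (s : Set E))) :
    ∃ v : EnergySpace Ω, v ∈ feSpace Ω K ∧ ∀ᵐ x ∂(volume.restrict Ω), x ∈ Ω ∧ ∃ s ∈ hK.cells,
      x ∈ convexHull ℝ (s : Set E) ∧ v.toL2 x = A s x ∧
        ∀ i, v.grad i x = (A s).linear (EuclideanSpace.single i 1) := by
  set q := Ω.indicator p with hq
  set M := ∑ s ∈ hK.cells, ‖(A s).linear.toContinuousLinearMap‖ with hM
  have hM0 : 0 ≤ M := Finset.sum_nonneg fun _ _ => norm_nonneg _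
  have : IsFiniteMeasure (volume.restrict Ω) := ⟨by
    rw [Measure.restrict_apply_univ]; exact hb.measure_lt_top⟩
  have hqm : Measurable q := measurable_indicator_of_continuousOn hΩ hp
  obtain ⟨B, hB⟩ := hb.isCompact_closure.exists_bound_of_continuousOn hp
  have hq2 : MemLp q 2 (volume.restrict Ω) := by
    refine MemLp.of_bound hqm.aestronglyMeasurable B ?_
    filter_upwards [ae_restrict_mem hΩ.measurableSet] with x hx
    rw [hq, indicator_of_mem hx]
    exact hB x (subset_closure hx)
  have hev : ∀ x ∈ Ω, ∀ s ∈ hK.cells, x ∈ interior (convexHull ℝ (s : Set E)) →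
      ∀ i, pderiv i q x = (A s).linear (EuclideanSpace.single i 1) := by
    intro x hxΩ s hs hxs i
    refine pderiv_eq_of_eventuallyEq ?_ i
    filter_upwards [hΩ.mem_nhds hxΩ, mem_interior_iff_mem_nhds.1 hxs] with y hy hys
    rw [hq, indicator_of_mem hy, hpA s hs hys]
  have hD2 : ∀ i, MemLp (pderiv i q) 2 (volume.restrict Ω) := by
    intro i
    refine MemLp.of_bound (measurable_fderiv_apply_const ℝ q _).aestronglyMeasurable M ?_
    filter_upwards [ae_mem_interior_cell hΩ hK] with x ⟨hxΩ, s, hs, hxs⟩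
    rw [hev x hxΩ s hs hxs i]
    have h1 := (A s).linear.toContinuousLinearMap.le_opNorm (EuclideanSpace.single i 1)
    simp only [PiLp.norm_single, norm_one, mul_one, LinearMap.coe_toContinuousLinearMap'] at h1
    exact h1.trans (Finset.single_le_sum
      (f := fun s => ‖(A s).linear.toContinuousLinearMap‖) (fun _ _ => norm_nonneg _) hs)
  let P : H1 Ω := ⟨WithLp.toLp 2 (hq2.toLp, WithLp.toLp 2 fun i => (hD2 i).toLp), by
    intro i φ hφ hφc hφΩ
    have h0 := integral_mul_pderiv_of_piecewise hΩ hb hK hp hpA i hφ hφc hφΩ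
    have h1 : ∫ x in Ω, hq2.toLp q x * pderiv i φ x = ∫ x, q x * pderiv i φ x := by
      rw [integral_congr_ae (g := fun x => q x * pderiv i φ x)
        (by filter_upwards [hq2.coeFn_toLp] with x hx; rw [hx])]
      refine setIntegral_eq_integral_of_forall_compl_eq_zero fun x hx => ?_
      rw [hq, indicator_of_notMem hx, zero_mul]
    have h2 : ∫ x in Ω, (hD2 i).toLp (pderiv i q) x * φ x = ∫ x, pderiv i q x * φ x := by
      rw [integral_congr_ae (g := fun x => pderiv i q x * φ x)
        (by filter_upwards [(hD2 i).coeFn_toLp] with x hx; rw [hx])]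
      refine setIntegral_eq_integral_of_forall_compl_eq_zero fun x hx => ?_
      rw [image_eq_zero_of_notMem_tsupport fun h => hx (hφΩ h), mul_zero]
    change ∫ x in Ω, hq2.toLp q x * pderiv i φ x = -∫ x in Ω, (hD2 i).toLp (pderiv i q) x * φ x
    rw [h1, h2, h0]⟩
  obtain ⟨v, hv⟩ := surjective_toH1L hΩ hb hL P
  rw [toH1L_apply] at hv
  have hv0 : v.toL2 = hq2.toLp := by rw [EnergySpace.toL2, hv]; rfl
  have hv1 : ∀ i, v.grad i = (hD2 i).toLp := fun i => by rw [EnergySpace.grad, hv]; rfl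
  have hvp : v.toL2 =ᵐ[volume.restrict Ω] p := by
    rw [hv0]
    filter_upwards [hq2.coeFn_toLp, ae_restrict_mem hΩ.measurableSet] with x hx hxΩ
    rw [hx, hq, indicator_of_mem hxΩ]
  refine ⟨v, ⟨p, hp, fun s hs hc => ⟨A s, hpA s (hK.mem_cells.2 ⟨hs, hc⟩)⟩, hvp⟩, ?_⟩
  have hgr : ∀ᵐ x ∂(volume.restrict Ω), ∀ i, v.grad i x = pderiv i q x := by
    rw [ae_all_iff]
    intro i
    rw [hv1]
    exact (hD2 i).coeFn_toLp
  filter_upwards [hvp, hgr, ae_mem_interior_cell hΩ hK] with x h1 h2 ⟨hxΩ, s, hs, hxs⟩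
  have hxs' := interior_subset hxs
  exact ⟨hxΩ, s, hs, hxs', by rw [h1, hpA s hs hxs'], fun i => by
    rw [h2 i, hev x hxΩ s hs hxs i]⟩

end Piecewise

/-! ### Approximation of `H²` functions by finite elements -/

section Approximation

variable {d : ℕ} {Ω : Set (EuclideanSpace ℝ (Fin d))}

local notation "E" => EuclideanSpace ℝ (Fin d)

theorem norm_sub_le_meshWidth {K : Geometry.SimplicialComplex ℝ E} (hK : IsTriangulation Ω K)
    {s : Finset E} (hs : s ∈ K.faces) {x y : E} (hx : x ∈ convexHull ℝ (s : Set E))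
    (hy : y ∈ convexHull ℝ (s : Set E)) : ‖x - y‖ ≤ meshWidth K := by
  rw [← dist_eq_norm]
  refine (Metric.dist_le_diam_of_mem (s.finite_toSet.isCompact_convexHull ℝ).isBounded
    hx hy).trans ?_
  exact le_csSup (hK.finite.image _).bddAbove (mem_image_of_mem _ hs)

/-- The mesh width is positive because, for `d ≥ 1`, an element has at least two vertices. -/
theorem meshWidth_pos (hd : 1 ≤ d) (hne : Ω.Nonempty) {K : Geometry.SimplicialComplex ℝ E}
    (hK : IsTriangulation Ω K) : 0 < meshWidth K := by
  obtain ⟨x, hx⟩ := hne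
  have hx' := subset_closure hx
  rw [hK.closure_eq] at hx'
  simp only [mem_iUnion] at hx'
  obtain ⟨s, hs, -⟩ := hx'
  obtain ⟨hs, hc⟩ := hK.mem_cells.1 hs
  obtain ⟨a, ha, b, hb, hab⟩ := Finset.one_lt_card.1 (show 1 < s.card by omega)
  exact (norm_pos_iff.2 (sub_ne_zero.2 hab)).trans_le
    (norm_sub_le_meshWidth hK hs (subset_convexHull ℝ _ ha) (subset_convexHull ℝ _ hb))

/-- Distinct elements of a triangulation overlap in a null set, since their intersection lies in
a hyperplane. -/
theorem aedisjoint_cells {K : Geometry.SimplicialComplex ℝ E} (hK : IsTriangulation Ω K)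
    {s t : Finset E} (hs : s ∈ hK.cells) (ht : t ∈ hK.cells) (hst : s ≠ t) :
    AEDisjoint volume (convexHull ℝ (s : Set E)) (convexHull ℝ (t : Set E)) := by
  obtain ⟨hs, hsc⟩ := hK.mem_cells.1 hs
  obtain ⟨ht, htc⟩ := hK.mem_cells.1 ht
  obtain ⟨w, hws, hwt⟩ : ∃ w ∈ s, w ∉ t := by
    by_contra! hcon
    exact hst (Finset.eq_of_subset_of_card_le hcon (by omega))
  have hn := (K.indep hs).notMem_affineSpan_sdiff ⟨w, hws⟩ univ
  set H := affineSpan ℝ (((↑) : s → E) '' (univ \ {⟨w, hws⟩})) with hH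
  refine measure_mono_null ?_ (Measure.addHaar_affineSubspace volume H fun h => hn ?_)
  · refine (K.inter_subset_convexHull hs ht).trans ((convexHull_subset_affineSpan _).trans ?_)
    refine affineSpan_mono ℝ fun z hz => ⟨⟨z, hz.1⟩, ⟨mem_univ _, ?_⟩, rfl⟩
    rintro h
    have : z = w := congrArg Subtype.val h
    exact hwt (this ▸ hz.2)
  · rw [h]; exact AffineSubspace.mem_top _ _ _

/-- Summing a local estimate over the elements: each point lies in the neighbourhoods of radius
`R h` of elements whose total volume is at most that of a ball of radius `(R + 1) h`. -/
theorem lintegral_le_of_cells {K : Geometry.SimplicialComplex ℝ E}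
    (hK : IsTriangulation Ω K) {h R : ℝ} (hh : 0 < h) (hR : 0 ≤ R) (hmesh : meshWidth K = h)
    {y : Finset E → E} (hy : ∀ s ∈ hK.cells, y s ∈ convexHull ℝ (s : Set E))
    {F : E → ℝ≥0∞} (hF : Measurable F) {f : E → ℝ≥0∞} {c : ℝ≥0∞}
    (hf : ∀ᵐ x ∂(volume.restrict Ω), ∃ s ∈ hK.cells, x ∈ convexHull ℝ (s : Set E) ∧
      f x ≤ c * (ENNReal.ofReal (1 / volume.real (Metric.closedBall (0 : E) (h / 2))) *
        ∫⁻ z in Metric.closedBall (y s) (R * h), F z)) :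
    ∫⁻ x in Ω, f x ≤ c * ENNReal.ofReal ((2 * (R + 1)) ^ d) * ∫⁻ z, F z := by
  set b := ENNReal.ofReal (1 / volume.real (Metric.closedBall (0 : E) (h / 2))) with hb
  set S : Finset E → Set E := fun s => convexHull ℝ (s : Set E) with hS
  have hSm : ∀ s, MeasurableSet (S s) := fun s => (isClosed_convexHull_finset s).measurableSet
  set B : Finset E → Set E := fun s => Metric.closedBall (y s) (R * h) with hB
  have hBm : ∀ s, MeasurableSet (B s) := fun s =>
    (measurableSet_closedBall : MeasurableSet (Metric.closedBall (y s) (R * h)))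
  have hvol : ∀ z : E, b * volume (Metric.closedBall z ((R + 1) * h)) =
      ENNReal.ofReal ((2 * (R + 1)) ^ d) := by
    intro z
    have hp : 0 < volume.real (Metric.closedBall (0 : E) (h / 2)) :=
      ENNReal.toReal_pos (Metric.measure_closedBall_pos _ _ (by positivity)).ne'
        measure_closedBall_lt_top.ne
    have h1 : volume (Metric.closedBall z ((R + 1) * h)) = ENNReal.ofReal ((2 * (R + 1)) ^ d) *
        volume (Metric.closedBall (0 : E) (h / 2)) := by
      rw [Measure.addHaar_closedBall _ _ (by positivity),
        Measure.addHaar_closedBall _ _ (by positivity), ← mul_assoc,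
        ← ENNReal.ofReal_mul (by positivity)]
      simp only [finrank_euclideanSpace, Fintype.card_fin]
      rw [← mul_pow]
      congr 3; ring
    rw [h1, mul_left_comm, hb, ← ofReal_measureReal measure_closedBall_lt_top.ne,
      ← ENNReal.ofReal_mul (by positivity), one_div_mul_cancel hp.ne']
    simp
  -- Elements whose ball contains `z` lie in the ball of radius `(R + 1) h` about `z`, and do not
  -- overlap.
  have hcount : ∀ z, ∑ s ∈ hK.cells, (B s).indicator (fun _ => volume (S s)) z ≤
      volume (Metric.closedBall z ((R + 1) * h)) := by
    intro z
    classical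
    have h1 : ∑ s ∈ hK.cells, (B s).indicator (fun _ => volume (S s)) z =
        ∑ s ∈ hK.cells with z ∈ B s, volume (S s) := by
      rw [Finset.sum_filter]
      rfl
    rw [h1, ← measure_biUnion_finset₀ (fun s hs t ht hst => aedisjoint_cells hK
      (Finset.mem_filter.1 hs).1 (Finset.mem_filter.1 ht).1 hst)
      fun s _ => (hSm s).nullMeasurableSet]
    refine measure_mono (iUnion₂_subset fun s hs x hx => ?_)
    obtain ⟨hs, hzs⟩ := Finset.mem_filter.1 hs
    have h2 := norm_sub_le_meshWidth hK (hK.mem_cells.1 hs).1 hx (hy s hs)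
    rw [hmesh, ← dist_eq_norm] at h2
    have h3 := Metric.mem_closedBall.1 hzs
    rw [Metric.mem_closedBall]
    calc dist x z ≤ dist x (y s) + dist (y s) z := dist_triangle _ _ _
      _ ≤ h + R * h := add_le_add h2 (by rwa [dist_comm])
      _ = _ := by ring
  calc ∫⁻ x in Ω, f x
      ≤ ∫⁻ x in Ω, ∑ s ∈ hK.cells, (S s).indicator (fun _ => c * (b * ∫⁻ z in B s, F z)) x := by
        refine lintegral_mono_ae ?_
        filter_upwards [hf] with x ⟨s, hs, hxs, hfx⟩
        refine hfx.trans ?_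
        refine le_trans (le_of_eq ?_) (Finset.single_le_sum (f := fun s => (S s).indicator
          (fun _ => c * (b * ∫⁻ z in B s, F z)) x) (fun _ _ => bot_le) hs)
        rw [indicator_of_mem hxs]
    _ ≤ ∫⁻ x, ∑ s ∈ hK.cells, (S s).indicator (fun _ => c * (b * ∫⁻ z in B s, F z)) x :=
        setLIntegral_le_lintegral _ _
    _ = ∑ s ∈ hK.cells, c * (b * ∫⁻ z in B s, F z) * volume (S s) := by
        rw [lintegral_finsetSum _ fun s _ => measurable_const.indicator (hSm s)]
        exact Finset.sum_congr rfl fun s _ => lintegral_indicator_const (hSm s) _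
    _ = c * b * ∑ s ∈ hK.cells, ∫⁻ z, (B s).indicator (fun _ => volume (S s)) z * F z := by
        rw [Finset.mul_sum]
        refine Finset.sum_congr rfl fun s _ => ?_
        have : (fun z => (B s).indicator (fun _ => volume (S s)) z * F z) =
            (B s).indicator fun z => volume (S s) * F z := by
          funext z
          by_cases hz : z ∈ B s <;> simp [hz]
        rw [this, lintegral_indicator (hBm s), lintegral_const_mul _ hF]
        ring
    _ = c * b * ∫⁻ z, (∑ s ∈ hK.cells, (B s).indicator (fun _ => volume (S s)) z) * F z := by
        simp only [Finset.sum_mul]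
        rw [lintegral_finsetSum hK.cells (f := fun s z =>
          (B s).indicator (fun _ => volume (S s)) z * F z)
          fun s _ => (measurable_const.indicator (hBm s)).mul hF]
    _ ≤ c * b * ∫⁻ z, volume (Metric.closedBall (0 : E) ((R + 1) * h)) * F z := by
        gcongr with z
        refine (hcount z).trans_eq ?_
        rw [Measure.addHaar_closedBall_center]
    _ = c * (b * volume (Metric.closedBall (0 : E) ((R + 1) * h))) * ∫⁻ z, F z := by
        rw [lintegral_const_mul _ hF]; ring
    _ = _ := by rw [hvol]

theorem eLpNorm_two_sq {α : Type*} [MeasurableSpace α] {μ : Measure α} (f : α → ℝ) :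
    eLpNorm f 2 μ ^ 2 = ∫⁻ x, ‖f x‖ₑ ^ 2 ∂μ := by
  have := eLpNorm_nnreal_pow_eq_lintegral (μ := μ) (f := f) (p := 2) (by norm_num)
  norm_num at this
  exact_mod_cast this

theorem eLpNorm_le_of_lintegral_sq_le {α : Type*} [MeasurableSpace α] {μ : Measure α} {f : α → ℝ}
    {a : ℝ≥0∞} (h : ∫⁻ x, ‖f x‖ₑ ^ 2 ∂μ ≤ a ^ 2) : eLpNorm f 2 μ ≤ a := by
  rw [← eLpNorm_two_sq] at h
  exact (ENNReal.pow_le_pow_left_iff two_ne_zero).1 h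

/-- The `L²` form of `lintegral_le_of_cells`. -/
theorem eLpNorm_le_of_cells {K : Geometry.SimplicialComplex ℝ E}
    (hK : IsTriangulation Ω K) {h R : ℝ} (hh : 0 < h) (hR : 0 ≤ R) (hmesh : meshWidth K = h)
    {y : Finset E → E} (hy : ∀ s ∈ hK.cells, y s ∈ convexHull ℝ (s : Set E))
    {F : E → ℝ≥0∞} (hF : Measurable F) {Q : ℝ} (hQ : 0 ≤ Q)
    (hFi : ∫⁻ z, F z ≤ ENNReal.ofReal (Q ^ 2)) {m : ℝ} (hm : 0 ≤ m) {f : E → ℝ}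
    (hf : ∀ᵐ x ∂(volume.restrict Ω), ∃ s ∈ hK.cells, x ∈ convexHull ℝ (s : Set E) ∧
      |f x| ≤ m * √(ENNReal.ofReal (1 / volume.real (Metric.closedBall (0 : E) (h / 2))) *
        ∫⁻ z in Metric.closedBall (y s) (R * h), F z).toReal) :
    eLpNorm f 2 (volume.restrict Ω) ≤ ENNReal.ofReal (m * √((2 * (R + 1)) ^ d) * Q) := by
  have hsq : ∀ (a : ℝ) (n : ℝ≥0∞), n ≠ ⊤ → |a| ≤ m * √n.toReal →
      ‖a‖ₑ ^ 2 ≤ ENNReal.ofReal (m ^ 2) * n := by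
    intro a n hn ha
    rw [← ofReal_norm_sq, Real.norm_eq_abs]
    conv_rhs => rw [← ENNReal.ofReal_toReal hn]
    rw [← ENNReal.ofReal_mul (by positivity)]
    refine ENNReal.ofReal_le_ofReal ?_
    calc |a| ^ 2 ≤ (m * √n.toReal) ^ 2 := by gcongr
      _ = _ := by rw [mul_pow, Real.sq_sqrt ENNReal.toReal_nonneg]
  refine eLpNorm_le_of_lintegral_sq_le ?_
  refine (lintegral_le_of_cells hK hh hR hmesh hy hF
    (f := fun x => ‖f x‖ₑ ^ 2) (c := ENNReal.ofReal (m ^ 2)) ?_).trans ?_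
  · filter_upwards [hf] with x ⟨s, hs, hxs, hfx⟩
    exact ⟨s, hs, hxs, hsq _ _ (ENNReal.mul_ne_top ENNReal.ofReal_ne_top
      (((setLIntegral_le_lintegral _ _).trans hFi).trans_lt ENNReal.ofReal_lt_top).ne) hfx⟩
  · rw [← ENNReal.ofReal_mul (by positivity), ← ENNReal.ofReal_pow (by positivity)]
    calc _ ≤ ENNReal.ofReal (m ^ 2 * (2 * (R + 1)) ^ d) * ENNReal.ofReal (Q ^ 2) := by gcongr
      _ = ENNReal.ofReal ((m * √((2 * (R + 1)) ^ d) * Q) ^ 2) := by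
        rw [← ENNReal.ofReal_mul (by positivity), mul_pow _ Q, mul_pow m,
          Real.sq_sqrt (show 0 ≤ (2 * (R + 1)) ^ d by positivity)]

/-- The two error bounds of `affine_interpolation_le`, for a simplex of diameter `h ≤ ε` with an
inscribed ball of radius `ρ h`, have a common bound of first order in `h`. -/
theorem interpolation_const_le (d : ℕ) {ρ h ε m : ℝ} (hρ : 0 < ρ) (hh : 0 < h) (hε : h ≤ ε)
    (hm : 0 ≤ m) : d * (d * m) * h ^ 2 ≤ d * d * (ε + 1 / ρ) * h * m ∧
      d * (d * m) * h ^ 2 / (ρ * h) ≤ d * d * (ε + 1 / ρ) * h * m := by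
  have hρ' : 0 < 1 / ρ := by positivity
  have hε0 : 0 < ε := hh.trans_le hε
  constructor
  · calc _ = d * d * h * (h * m) := by ring
      _ ≤ d * d * (ε + 1 / ρ) * (h * m) := by gcongr; linarith
      _ = _ := by ring
  · calc _ = d * d * (1 / ρ) * (h * m) := by field_simp
      _ ≤ d * d * (ε + 1 / ρ) * (h * m) := by gcongr; linarith
      _ = _ := by ring

set_option maxHeartbeats 1000000 in
/-- Finite element approximation of a smooth function whose second derivatives are controlled by
local `L²` averages, over balls of radius of the order of the mesh width, of functions `G i j`. -/
theorem exists_fe_approx_smooth (hΩ : IsOpen Ω) (hb : Bornology.IsBounded Ω)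
    (hL : HasLipschitzBoundary Ω) {K : Geometry.SimplicialComplex ℝ E} (hK : IsTriangulation Ω K)
    {h ρ ε₀ : ℝ} (hmesh : meshWidth K = h) (hh : 0 < h) (hhε : h ≤ ε₀) (hρ : 0 < ρ)
    (hqu : ∀ s ∈ K.faces, s.card = d + 1 → ∃ x, Metric.closedBall x (ρ * h) ⊆
      convexHull ℝ (s : Set E)) {e : E} {g : E → ℝ} {G : Fin d → Fin d → E → ℝ} {Q : ℝ}
    (hQ : 0 ≤ Q) (hg : ContDiff ℝ ∞ g) (hGm : ∀ i j, Measurable (G i j))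
    (hG : ∀ i j, eLpNorm (G i j) 2 volume ≤ ENNReal.ofReal Q)
    (hpt : ∀ x ∈ closure Ω, ∀ i j, ∀ S, MeasurableSet S → Metric.closedBall (x + h • e) h ⊆ S →
      ‖pderiv j (pderiv i g) x‖ₑ ^ 2 ≤
        ENNReal.ofReal (1 / volume.real (Metric.closedBall (0 : E) (h / 2))) *
          ∫⁻ z in S, ‖G i j z‖ₑ ^ 2) :
    ∃ v ∈ feSpace Ω K,
      eLpNorm (fun x => v.toL2 x - g x) 2 (volume.restrict Ω) ≤ ENNReal.ofReal
        (d * d * (ε₀ + 1 / ρ) * h * √((2 * (‖e‖ + 2 + 1)) ^ d) * (d * Q)) ∧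
      ∀ i, eLpNorm (fun x => v.grad i x - pderiv i g x) 2 (volume.restrict Ω) ≤ ENNReal.ofReal
        (d * d * (ε₀ + 1 / ρ) * h * √((2 * (‖e‖ + 2 + 1)) ^ d) * (d * Q)) := by
  obtain ⟨p, A, hp, hpA⟩ := exists_interpolant hK g
  obtain ⟨v, hv, hvae⟩ := exists_energySpace_of_piecewise hΩ hb hL hK hp fun s hs => (hpA s hs).1
  have hR0 : 0 ≤ ‖e‖ + 2 := by positivity
  have hk0 : 0 ≤ d * d * (ε₀ + 1 / ρ) := by
    have := hh.trans_le hhε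
    positivity
  -- A ball of radius `h` about `x + h e`, with `x` in an element containing `y`, lies in the ball
  -- of radius `(‖e‖ + 2) h` about `y`.
  generalize hR : ‖e‖ + 2 = R at *
  generalize hk : d * d * (ε₀ + 1 / ρ) = k at *
  have hy : ∀ s : Finset E, ∃ y : E, s ∈ hK.cells → y ∈ convexHull ℝ (s : Set E) := by
    intro s
    by_cases hs : s ∈ hK.cells
    · obtain ⟨y, hy⟩ := Finset.card_pos.1 (show 0 < s.card by rw [(hK.mem_cells.1 hs).2]; omega)
      exact ⟨y, fun _ => subset_convexHull ℝ _ hy⟩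
    · exact ⟨0, fun h => absurd h hs⟩
  choose y hy using hy
  set F : E → ℝ≥0∞ := fun z => ∑ i, ∑ j, ‖G i j z‖ₑ ^ 2 with hF
  have hFm : Measurable F := by
    refine Finset.measurable_sum _ fun i _ => Finset.measurable_sum _ fun j _ => ?_
    exact (hGm i j).enorm.pow_const 2
  have hFi : ∫⁻ z, F z ≤ ENNReal.ofReal ((d * Q) ^ 2) := by
    have hi : ∀ i j, ∫⁻ z, ‖G i j z‖ₑ ^ 2 ≤ ENNReal.ofReal (Q ^ 2) := fun i j => by
      rw [← eLpNorm_two_sq, ENNReal.ofReal_pow (by positivity)]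
      gcongr
      exact hG i j
    rw [hF, lintegral_finsetSum _ fun i _ =>
      Finset.measurable_sum _ fun j _ => (hGm i j).enorm.pow_const 2]
    calc _ = ∑ i : Fin d, ∑ j : Fin d, ∫⁻ z, ‖G i j z‖ₑ ^ 2 :=
          Finset.sum_congr rfl fun i _ => lintegral_finsetSum _ fun j _ =>
            (hGm i j).enorm.pow_const 2
      _ ≤ ∑ i : Fin d, ∑ j : Fin d, ENNReal.ofReal (Q ^ 2) :=
          Finset.sum_le_sum fun i _ => Finset.sum_le_sum fun j _ => hi i j
      _ = ENNReal.ofReal ((d * Q) ^ 2) := by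
          simp only [Finset.sum_const, Finset.card_univ, Fintype.card_fin, nsmul_eq_mul]
          rw [← ENNReal.ofReal_natCast, ← ENNReal.ofReal_mul (by positivity),
            ← ENNReal.ofReal_mul (by positivity)]
          congr 1; ring
  set b := ENNReal.ofReal (1 / volume.real (Metric.closedBall (0 : E) (h / 2))) with hbdef
  set n : Finset E → ℝ≥0∞ := fun s => b * ∫⁻ z in Metric.closedBall (y s) (R * h), F z with hn
  have hnt : ∀ s, n s ≠ ⊤ := fun s => ENNReal.mul_ne_top ENNReal.ofReal_ne_top
    (((setLIntegral_le_lintegral _ _).trans hFi).trans_lt ENNReal.ofReal_lt_top).ne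
  -- `n s` bounds the squares of the second derivatives of `g` on the element `s`.
  have hsec : ∀ s ∈ hK.cells, ∀ x ∈ convexHull ℝ (s : Set E), ∀ i j,
      |pderiv j (pderiv i g) x| ≤ √(n s).toReal := by
    intro s hs x hx i j
    have hxΩ : x ∈ closure Ω := by
      rw [hK.closure_eq]
      exact mem_biUnion hs hx
    have h1 := hpt x hxΩ i j (Metric.closedBall (y s) (R * h))
      measurableSet_closedBall (by
        refine Metric.closedBall_subset_closedBall' ?_
        have h2 := norm_sub_le_meshWidth hK (hK.mem_cells.1 hs).1 hx (hy s hs)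
        calc h + dist (x + h • e) (y s) ≤ h + (‖x - y s‖ + h * ‖e‖) := by
              rw [dist_eq_norm, add_sub_right_comm]
              gcongr
              refine (norm_add_le _ _).trans_eq ?_
              rw [norm_smul, Real.norm_of_nonneg hh.le]
          _ ≤ h + (h + h * ‖e‖) := by gcongr; exact h2.trans_eq hmesh
          _ = R * h := by rw [← hR]; ring)
    refine Real.le_sqrt_of_sq_le ?_
    rw [sq_abs]
    refine (ENNReal.ofReal_le_iff_le_toReal (hnt s)).1 ?_
    rw [← sq_abs, ← Real.norm_eq_abs, ofReal_norm_sq]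
    refine h1.trans ?_
    simp only [hn]
    gcongr with z
    refine le_trans (le_trans ?_ (Finset.single_le_sum (f := fun j => ‖G i j z‖ₑ ^ 2)
      (fun _ _ => bot_le) (Finset.mem_univ j))) (Finset.single_le_sum
      (f := fun i => ∑ j, ‖G i j z‖ₑ ^ 2) (fun _ _ => bot_le) (Finset.mem_univ i))
    exact le_rfl
  have herr : ∀ s ∈ hK.cells, ∀ x ∈ convexHull ℝ (s : Set E),
      |A s x - g x| ≤ k * h * √(n s).toReal ∧
        ∀ i, |(A s).linear (EuclideanSpace.single i 1) - pderiv i g x| ≤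
          k * h * √(n s).toReal := by
    intro s hs x hx
    obtain ⟨hsf, hsc⟩ := hK.mem_cells.1 hs
    obtain ⟨c, hc⟩ := hqu s hsf hsc
    obtain ⟨h1, h2⟩ := affine_interpolation_le hg (Real.sqrt_nonneg _) (mul_pos hρ hh)
      (hsec s hs) (fun x hx y hy => norm_sub_le_meshWidth hK hsf hx hy) hc (hpA s hs).2 hx
    rw [hmesh] at h1 h2
    refine ⟨?_, fun i => ?_⟩
    · rw [abs_sub_comm, ← hk]
      exact h1.trans (interpolation_const_le d hρ hh hhε (Real.sqrt_nonneg _)).1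
    · rw [abs_sub_comm, ← hk]
      exact (h2 i).trans (interpolation_const_le d hρ hh hhε (Real.sqrt_nonneg _)).2
  have hint : ∀ f : E → ℝ, (∀ᵐ x ∂(volume.restrict Ω), ∃ s ∈ hK.cells,
      x ∈ convexHull ℝ (s : Set E) ∧ |f x| ≤ k * h * √(n s).toReal) →
      eLpNorm f 2 (volume.restrict Ω) ≤
        ENNReal.ofReal (k * h * √((2 * (R + 1)) ^ d) * (d * Q)) := by
    intro f hf
    exact eLpNorm_le_of_cells hK hh hR0 hmesh hy hFm (Q := d * Q)
      (by positivity) hFi (m := k * h) (by positivity) hf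
  refine ⟨v, hv, hint _ ?_, fun i => hint _ ?_⟩
  · filter_upwards [hvae] with x ⟨_, s, hs, hxs, h1, _⟩
    exact ⟨s, hs, hxs, by rw [h1]; exact (herr s hs x hxs).1⟩
  · filter_upwards [hvae] with x ⟨_, s, hs, hxs, _, h1⟩
    exact ⟨s, hs, hxs, by rw [h1]; exact (herr s hs x hxs).2 i⟩

/-- Finite element approximation of a function `χ Φ` with `Φ ∈ H²(Ω)` and `χ` a cut-off supported
in a set from which `Ω` can be entered by shifts: mollify at the scale of the mesh width, then
interpolate. -/
theorem exists_fe_approx_cut (hΩ : IsOpen Ω) (hb : Bornology.IsBounded Ω)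
    (hL : HasLipschitzBoundary Ω) {N : Set E} {e : E} {ε₀ : ℝ} (hε₀ : 0 < ε₀)
    (hN : HasInwardShifts Ω N e ε₀) {χ : E → ℝ} (hχ : ContDiff ℝ ∞ χ)
    (hχc : HasCompactSupport χ) (hχN : tsupport χ ⊆ N) {ρ : ℝ} (hρ : 0 < ρ) :
    ∃ C > 0, ∀ K : Geometry.SimplicialComplex ℝ E, IsTriangulation Ω K →
      (∀ s ∈ K.faces, s.card = d + 1 → ∃ x, Metric.closedBall x (ρ * meshWidth K) ⊆
        convexHull ℝ (s : Set E)) → 0 < meshWidth K → meshWidth K ≤ ε₀ →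
      ∀ (Φ : H2 Ω) (q : H1 Ω), q.1.fst =ᵐ[volume.restrict Ω] cut Ω χ Φ.1.fst.1.fst →
        (∀ i, q.1.snd i =ᵐ[volume.restrict Ω] cut Ω χ (Φ.1.fst.1.snd i) +
          cut Ω (pderiv i χ) Φ.1.fst.1.fst) →
        ∃ v ∈ feSpace Ω K, ‖v.toH1 - q‖ ≤ C * meshWidth K * ‖Φ‖ := by
  obtain ⟨C₀, hC₀, happ⟩ := exists_smooth_approx_H2 hΩ hN hχ hχc hχN
  set C₁ := d * d * (ε₀ + 1 / ρ) * √((2 * (‖e‖ + 2 + 1)) ^ d) * (d * C₀) with hC₁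
  have hC₁0 : 0 ≤ C₁ := by positivity
  clear_value C₁
  refine ⟨(d + 1) * (C₁ + C₀), by positivity, fun K hK hqu hh hhε Φ q hq0 hq1 => ?_⟩
  have hΦ := norm_nonneg Φ
  -- The averaging radius is the mesh width.
  generalize hmesh : meshWidth K = h at *
  obtain ⟨g, G, hg, hGm, hG, happ0, happ1, hpt⟩ := happ Φ h ⟨hh, hhε⟩
  generalize ‖Φ‖ = t at *
  obtain ⟨v, hv, hvg, hvg1⟩ := exists_fe_approx_smooth hΩ hb hL hK hmesh hh hhε hρ hqu
    (by positivity) hg hGm hG hpt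
  have hconst : d * d * (ε₀ + 1 / ρ) * h * √((2 * (‖e‖ + 2 + 1)) ^ d) * (d * (C₀ * t)) =
      C₁ * h * t := by rw [hC₁]; ring
  rw [hconst] at hvg
  simp only [hconst] at hvg1
  refine ⟨v, hv, ?_⟩
  have hfin : ∀ {a c : E → ℝ} {w : E → ℝ}, AEStronglyMeasurable a (volume.restrict Ω) →
      AEStronglyMeasurable c (volume.restrict Ω) → AEStronglyMeasurable w (volume.restrict Ω) →
      eLpNorm (fun x => a x - c x) 2 (volume.restrict Ω) ≤ ENNReal.ofReal (C₁ * h * t) →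
      eLpNorm (fun x => c x - w x) 2 (volume.restrict Ω) ≤ ENNReal.ofReal (C₀ * h * t) →
      eLpNorm (fun x => a x - w x) 2 (volume.restrict Ω) ≤
        ENNReal.ofReal ((C₁ + C₀) * h * t) := by
    intro a c w ha hc hw h1 h2
    have : (fun x => a x - w x) = (fun x => a x - c x) + fun x => c x - w x := by
      funext x; simp
    rw [this]
    refine (eLpNorm_add_le (ha.sub hc) (hc.sub hw) (by norm_num)).trans
      ((add_le_add h1 h2).trans ?_)
    rw [← ENNReal.ofReal_add (by positivity) (by positivity)]
    exact ENNReal.ofReal_le_ofReal (le_of_eq (by ring))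
  have hη : 0 ≤ (C₁ + C₀) * h * t := by positivity
  refine (norm_H1_le_of_forall hη ?_ fun i => ?_).trans_eq
    (show _ = (d + 1) * (C₁ + C₀) * h * t by ring)
  · refine norm_sub_le_of_ae (ae_eq_refl _) hq0 hη ?_
    exact hfin (Lp.aestronglyMeasurable _) hg.continuous.aestronglyMeasurable
      ((Lp.aestronglyMeasurable _).congr hq0) hvg happ0
  · refine norm_sub_le_of_ae (ae_eq_refl _) (hq1 i) hη ?_
    exact hfin (Lp.aestronglyMeasurable _) (contDiff_pderiv hg i).continuous.aestronglyMeasurable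
      ((Lp.aestronglyMeasurable _).congr (hq1 i)) (hvg1 i) (happ1 i)

/-- First-order approximation in `H¹(Ω)` of functions in `H²(Ω)`, uniformly in a quasi-uniform
family of triangulations. For coarse meshes the zero function is good enough. -/
theorem exists_fe_approx (hd : 1 ≤ d) (hΩ : IsPolygonalDomain Ω) {ι : Type*}
    (𝒯 : ι → Geometry.SimplicialComplex ℝ E) (h𝒯 : ∀ i, IsTriangulation Ω (𝒯 i))
    (hqu : IsQuasiUniform 𝒯) : ∃ C > 0, ∀ i, ∀ Φ : H2 Ω, ∃ v ∈ feSpace Ω (𝒯 i),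
      ‖Φ.1.fst - v.toH1‖ ≤ C * meshWidth (𝒯 i) * ‖Φ‖ := by
  obtain ⟨ρ, hρ, hqu⟩ := hqu
  have hne := hΩ.isConnected.nonempty
  obtain ⟨J, _, χ, N, e, ε, hχ, hχc, hχN, hε, hN, hsum⟩ :=
    exists_partition hΩ.isOpen hΩ.isBounded hΩ.lipschitz
  choose C hC hcut using fun k => exists_fe_approx_cut hΩ.isOpen hΩ.isBounded hΩ.lipschitz
    (hε k) (hN k) (hχ k) (hχc k) (hχN k) hρ
  refine ⟨1 + ∑ k, (C k + 1 / ε k), ?_, fun i Φ => ?_⟩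
  · have : 0 ≤ ∑ k, (C k + 1 / ε k) :=
      Finset.sum_nonneg fun k _ => by have := hC k; have := hε k; positivity
    positivity
  have hh := meshWidth_pos hd hne (h𝒯 i)
  have hle : ∀ k, C k + 1 / ε k ≤ ∑ k, (C k + 1 / ε k) := fun k =>
    Finset.single_le_sum (f := fun k => C k + 1 / ε k)
      (fun k _ => by have := hC k; have := hε k; positivity) (Finset.mem_univ k)
  by_cases hsmall : ∀ k, meshWidth (𝒯 i) ≤ ε k
  · choose q hq0 hq1 using fun k => exists_mul_H1 hΩ.isOpen (hχ k) (hχc k) Φ.1.fst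
    choose v hv hvq using fun k => hcut k (𝒯 i) (h𝒯 i) (hqu i) hh (hsmall k) Φ (q k)
      (hq0 k) (hq1 k)
    refine ⟨∑ k, v k, Submodule.sum_mem _ fun k _ => hv k, ?_⟩
    rw [← toH1L_apply, map_sum, eq_sum_of_partition hΩ.isOpen hχ hsum Φ.1.fst q hq0 hq1,
      ← Finset.sum_sub_distrib]
    calc _ ≤ ∑ k, ‖q k - toH1L Ω (v k)‖ := norm_sum_le _ _
      _ ≤ ∑ k, (C k + 1 / ε k) * (meshWidth (𝒯 i) * ‖Φ‖) := by
          refine Finset.sum_le_sum fun k _ => ?_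
          rw [norm_sub_rev, toH1L_apply]
          refine (hvq k).trans ?_
          rw [mul_assoc]
          have := hε k
          gcongr
          have : 0 < 1 / ε k := by positivity
          linarith
      _ ≤ _ := by
          rw [← Finset.sum_mul, mul_assoc]
          gcongr
          linarith
  · push Not at hsmall
    obtain ⟨k, hk⟩ := hsmall
    -- Here the mesh width is at least `ε k`, so that `‖Φ‖ ≤ (h / ε k) ‖Φ‖`.
    refine ⟨0, Submodule.zero_mem _, ?_⟩
    rw [← toH1L_apply, map_zero, sub_zero]
    refine (H2.norm_fst_le Φ).trans (le_mul_of_one_le_left (norm_nonneg _) ?_)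
    have h1 : 1 ≤ 1 / ε k * meshWidth (𝒯 i) := by
      rw [one_div, inv_mul_eq_div, one_le_div (hε k)]; exact hk.le
    refine h1.trans ?_
    gcongr
    have := hC k
    linarith [hle k]

end Approximation

/-! ### Galerkin projections and the energy estimate in Hilbert spaces -/

section Abstract

variable {V : Type*} [NormedAddCommGroup V] [NormedSpace ℝ V]

/-- The Galerkin projection onto a closed subspace with respect to a coercive form on a Hilbert
space, that is, on a complete normed space whose norm satisfies the parallelogram law. -/
theorem exists_galerkin [CompleteSpace V]
    (hV : ∀ x y : V, ‖x + y‖ * ‖x + y‖ + ‖x - y‖ * ‖x - y‖ = 2 * (‖x‖ * ‖x‖ + ‖y‖ * ‖y‖))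
    {B : V →L[ℝ] V →L[ℝ] ℝ} (hB : IsCoercive B) (W : Submodule ℝ V)
    (hW : IsClosed (W : Set V)) :
    ∃ R : V →L[ℝ] V, (∀ w, R w ∈ W) ∧ ∀ w, ∀ v ∈ W, B (R w) v = B w v := by
  -- The inner product recovered from the norm makes the Lax–Milgram operators available.
  let _ : InnerProductSpace ℝ V := InnerProductSpace.ofNorm ℝ hV
  have : CompleteSpace W := hW.completeSpace_coe
  have hBW : IsCoercive (B.bilinearComp W.subtypeL W.subtypeL) := by
    obtain ⟨C, hC, h⟩ := hB
    exact ⟨C, hC, fun u => by simpa using h u⟩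
  let e := hBW.continuousLinearEquivOfBilin
  let f := hB.continuousLinearEquivOfBilin
  refine ⟨W.subtypeL.comp ((e.symm : W →L[ℝ] W).comp
    (W.orthogonalProjectionOnto.comp (f : V →L[ℝ] V))), fun w => ?_, fun w v hv => ?_⟩
  · simp
  · have h1 := hBW.continuousLinearEquivOfBilin_apply
      (e.symm (W.orthogonalProjectionOnto (f w))) ⟨v, hv⟩
    have h2 := hB.continuousLinearEquivOfBilin_apply w v
    change B (e.symm (W.orthogonalProjectionOnto (f w)) : V) v = B w v
    have h3 : B.bilinearComp W.subtypeL W.subtypeL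
        (e.symm (W.orthogonalProjectionOnto (f w))) ⟨v, hv⟩ =
      B (e.symm (W.orthogonalProjectionOnto (f w)) : V) v := rfl
    rw [← h3, ← h1, ← h2]
    change ⟪e (e.symm (W.orthogonalProjectionOnto (f w))), (⟨v, hv⟩ : W)⟫_ℝ = _
    rw [e.apply_symm_apply]
    exact Submodule.inner_orthogonalProjectionOnto_eq_of_mem_right (⟨v, hv⟩ : W) (f w)

/-- The Lax–Milgram theorem. -/
theorem exists_laxMilgram [CompleteSpace V]
    (hV : ∀ x y : V, ‖x + y‖ * ‖x + y‖ + ‖x - y‖ * ‖x - y‖ = 2 * (‖x‖ * ‖x‖ + ‖y‖ * ‖y‖))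
    {B : V →L[ℝ] V →L[ℝ] ℝ} (hB : IsCoercive B) (ℓ : V →L[ℝ] ℝ) :
    ∃ φ, ∀ v, B φ v = ℓ v := by
  let _ : InnerProductSpace ℝ V := InnerProductSpace.ofNorm ℝ hV
  refine ⟨hB.continuousLinearEquivOfBilin.symm ((InnerProductSpace.toDual ℝ V).symm ℓ),
    fun v => ?_⟩
  rw [← hB.continuousLinearEquivOfBilin_apply, ContinuousLinearEquiv.apply_symm_apply,
    InnerProductSpace.toDual_symm_apply]

/-- Céa's lemma. -/
theorem norm_sub_le_of_galerkin {B : V →L[ℝ] V →L[ℝ] ℝ} {α : ℝ} (hα : 0 < α)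
    (hB : ∀ v, α * ‖v‖ ^ 2 ≤ B v v) {W : Submodule ℝ V} {w r v : V} (hr : r ∈ W) (hv : v ∈ W)
    (horth : ∀ z ∈ W, B r z = B w z) : ‖r - w‖ ≤ ‖B‖ / α * ‖v - w‖ := by
  have h1 : B (r - w) (r - w) = B (r - w) (v - w) := by
    have h2 := horth (r - v) (W.sub_mem hr hv)
    simp only [map_sub, sub_apply] at h2 ⊢
    linarith
  have h3 := (hB (r - w)).trans (h1.le.trans ((le_abs_self _).trans (B.le_opNorm₂ _ _)))
  rcases eq_or_lt_of_le (norm_nonneg (r - w)) with h0 | h0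
  · rw [← h0]; positivity
  · rw [div_mul_eq_mul_div, le_div_iff₀ hα]
    refine le_of_mul_le_mul_right ?_ h0
    calc _ = α * ‖r - w‖ ^ 2 := by ring
      _ ≤ _ := h3
      _ = _ := by ring

/-- The energy estimate for a continuous function `θ` that satisfies the evolution equation
`m(θ', v) + a(θ, v) = -m(f, v)` in integrated form. As `θ` need not be differentiable, the
increments of `m(θ, θ)` over short intervals are compared with those of the right-hand side. -/
theorem energy_estimate [CompleteSpace V] {a m : V →L[ℝ] V →L[ℝ] ℝ} {α : ℝ} (hα : 0 < α)
    (ha : ∀ v, α * ‖v‖ ^ 2 ≤ a v v) (hm : ∀ v w, m v w = m w v) {W : Submodule ℝ V} {T : ℝ}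
    {θ f : ℝ → V} {δ : ℝ → ℝ} (hθ : ContinuousOn θ (Icc 0 T)) (hθW : ∀ t ∈ Icc 0 T, θ t ∈ W)
    (hf : IntervalIntegrable f volume 0 T) (hδ0 : ∀ t, 0 ≤ δ t)
    (hδ : IntervalIntegrable δ volume 0 T)
    (hδ2 : IntervalIntegrable (fun t => δ t ^ 2) volume 0 T)
    (hfδ : ∀ t v, |m (f t) v| ≤ δ t * ‖v‖) (h0 : θ 0 = 0)
    (heq : ∀ t ∈ Icc 0 T, ∀ v ∈ W,
      m (θ t) v + a (∫ s in (0 : ℝ)..t, θ s) v + m (∫ s in (0 : ℝ)..t, f s) v = 0)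
    {t : ℝ} (ht : t ∈ Icc 0 T) :
    m (θ t) (θ t) ≤ 1 / (2 * α) * ∫ s in (0 : ℝ)..t, δ s ^ 2 := by
  have hT : 0 ≤ T := ht.1.trans ht.2
  obtain ⟨B, hB⟩ := isCompact_Icc.exists_bound_of_continuousOn hθ
  have hB0 : 0 ≤ B := (norm_nonneg _).trans (hB t ht)
  have sub : ∀ {g : ℝ → V}, IntervalIntegrable g volume 0 T → ∀ {x y}, x ∈ Icc 0 T → y ∈ Icc 0 T →
      IntervalIntegrable g volume x y := fun hg x y hx hy =>
    hg.mono_set (by rw [uIcc_of_le hT]; exact uIcc_subset_Icc hx hy)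
  have subR : ∀ {g : ℝ → ℝ}, IntervalIntegrable g volume 0 T → ∀ {x y}, x ∈ Icc 0 T →
      y ∈ Icc 0 T → IntervalIntegrable g volume x y := fun hg x y hx hy =>
    hg.mono_set (by rw [uIcc_of_le hT]; exact uIcc_subset_Icc hx hy)
  have hθi : IntervalIntegrable θ volume 0 T := by
    apply ContinuousOn.intervalIntegrable
    rwa [uIcc_of_le hT]
  have hzero : (0 : ℝ) ∈ Icc 0 T := ⟨le_rfl, hT⟩
  -- `η` bounds the oscillation of `θ` on the short intervals; the terms with `η` vanish in the
  -- limit.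
  set k : ℝ → ℝ → ℝ := fun η s => 1 / (2 * α) * δ s ^ 2 + 3 * η * (δ s + ‖a‖ * B) with hk
  have hki : ∀ η, IntervalIntegrable (k η) volume 0 T := fun η =>
    (hδ2.const_mul _).add ((hδ.add intervalIntegrable_const).const_mul _)
  -- By symmetry `m(θ y, θ y) - m(θ x, θ x) = m(θ y - θ x, w)` with `w = θ y + θ x`, and `w` is
  -- close to `2 θ r` for all `r` between `x` and `y`; so `w` serves as a test function on the
  -- interval.
  have step : ∀ η, 0 ≤ η → ∀ x ∈ Icc 0 T, ∀ y ∈ Icc 0 T, x ≤ y →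
      (∀ r ∈ Icc x y, ‖θ r - θ x‖ ≤ η) →
      m (θ y) (θ y) - m (θ x) (θ x) ≤ ∫ s in x..y, k η s := by
    intro η hη x hx y hy hxy hosc
    set w := θ y + θ x with hw
    have hwW : w ∈ W := W.add_mem (hθW y hy) (hθW x hx)
    have e1 : m (θ y) (θ y) - m (θ x) (θ x) = m (θ y) w - m (θ x) w := by
      simp only [hw, map_add]
      rw [hm (θ y) (θ x)]; ring
    have i1 : IntervalIntegrable (fun s => a (θ s) w) volume x y :=
      ⟨(a.flip w).integrable_comp (sub hθi hx hy).1, (a.flip w).integrable_comp (sub hθi hx hy).2⟩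
    have i2 : IntervalIntegrable (fun s => m (f s) w) volume x y :=
      ⟨(m.flip w).integrable_comp (sub hf hx hy).1, (m.flip w).integrable_comp (sub hf hx hy).2⟩
    have e2 : m (θ y) w - m (θ x) w = ∫ s in x..y, -(a (θ s) w + m (f s) w) := by
      have e3 := heq y hy w hwW
      have e4 := heq x hx w hwW
      have e5 := intervalIntegral.integral_interval_sub_left (sub hθi hzero hy) (sub hθi hzero hx)
      have e6 := intervalIntegral.integral_interval_sub_left (sub hf hzero hy) (sub hf hzero hx)
      have e7 := (a.flip w).intervalIntegral_comp_comm (sub hθi hx hy)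
      have e8 := (m.flip w).intervalIntegral_comp_comm (sub hf hx hy)
      simp only [ContinuousLinearMap.flip_apply] at e7 e8
      rw [intervalIntegral.integral_neg, intervalIntegral.integral_add i1 i2, e7, e8, ← e5, ← e6]
      simp only [map_sub, sub_apply]
      linarith
    rw [e1, e2]
    refine intervalIntegral.integral_mono_on hxy (i1.add i2).neg (subR (hki η) hx hy) fun r hr => ?_
    have hrT : r ∈ Icc 0 T := ⟨hx.1.trans hr.1, hr.2.trans hy.2⟩
    set z := w - (2 : ℝ) • θ r with hz
    have hzn : ‖z‖ ≤ 3 * η := by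
      have : z = (θ y - θ x) - (2 : ℝ) • (θ r - θ x) := by rw [hz, hw]; module
      rw [this]
      refine (norm_sub_le _ _).trans ?_
      rw [norm_smul, Real.norm_of_nonneg (by norm_num : (0 : ℝ) ≤ 2)]
      linarith [hosc y (right_mem_Icc.2 hxy), hosc r hr]
    have hwz : w = (2 : ℝ) • θ r + z := by rw [hz]; abel
    have h1 : a (θ r) w = 2 * a (θ r) (θ r) + a (θ r) z := by
      rw [hwz]; simp
    have h2 : |a (θ r) z| ≤ ‖a‖ * B * (3 * η) := (a.le_opNorm₂ _ _).trans (by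
      gcongr; exact hB r hrT)
    have h3 : ‖w‖ ≤ 2 * ‖θ r‖ + 3 * η := by
      rw [hwz]
      refine (norm_add_le _ _).trans ?_
      rw [norm_smul, Real.norm_of_nonneg (by norm_num : (0 : ℝ) ≤ 2)]
      linarith
    have h4 := (hfδ r w).trans (mul_le_mul_of_nonneg_left h3 (hδ0 r))
    have h5 := ha (θ r)
    -- Young's inequality, with weights that let the coercivity term absorb `‖θ r‖ ^ 2`.
    have h6 : 2 * δ r * ‖θ r‖ ≤ 2 * α * ‖θ r‖ ^ 2 + 1 / (2 * α) * δ r ^ 2 := by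
      have : 0 ≤ 1 / (2 * α) * (2 * α * ‖θ r‖ - δ r) ^ 2 := by positivity
      have e : 1 / (2 * α) * (2 * α * ‖θ r‖ - δ r) ^ 2 =
        2 * α * ‖θ r‖ ^ 2 - 2 * δ r * ‖θ r‖ + 1 / (2 * α) * δ r ^ 2 := by field_simp; ring
      linarith
    have h7 := neg_abs_le (a (θ r) z)
    have h8 := neg_abs_le (m (f r) w)
    simp only [hk]
    rw [h1]
    linarith
  -- The intervals of small oscillation are chained together by continuous induction.
  have main : ∀ η, 0 < η → m (θ t) (θ t) ≤ ∫ s in (0 : ℝ)..t, k η s := by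
    intro η hη
    set S := {t | m (θ t) (θ t) ≤ ∫ s in (0 : ℝ)..t, k η s} with hS
    have hcl : IsClosed (S ∩ Icc 0 T) := by
      have : S ∩ Icc 0 T = {t ∈ Icc 0 T | m (θ t) (θ t) ≤ ∫ s in (0 : ℝ)..t, k η s} := by
        ext t; simp [hS, and_comm]
      rw [this]
      refine isClosed_Icc.isClosed_le ?_ ?_
      · exact (m.continuous.comp_continuousOn hθ).clm_apply hθ
      · have := intervalIntegral.continuousOn_primitive_interval (μ := volume) (f := k η)
          (a := 0) (b := T) (by rw [uIcc_of_le hT]; exact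
            (intervalIntegrable_iff_integrableOn_Icc_of_le hT).1 (hki η))
        rwa [uIcc_of_le hT] at this
    refine (hcl.Icc_subset_of_forall_exists_gt (show (0 : ℝ) ∈ S by simp [hS, h0]) ?_) ht
    rintro x ⟨hxS, hx0, hxT⟩ y hy
    have hx : x ∈ Icc 0 T := ⟨hx0, hxT.le⟩
    have hev : ∀ᶠ r in 𝓝[≥] x, ‖θ r - θ x‖ ≤ η := by
      have hc : ContinuousWithinAt θ (Icc x T) x :=
        (hθ x hx).mono (Icc_subset_Icc hx0 le_rfl)
      rw [ContinuousWithinAt, nhdsWithin_Icc_eq_nhdsGE hxT] at hc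
      have := hc.eventually (Metric.ball_mem_nhds (θ x) hη)
      filter_upwards [this] with r hr
      rw [← dist_eq_norm]
      exact (Metric.mem_ball.1 hr).le
    obtain ⟨c, hxc, hc⟩ := mem_nhdsGE_iff_exists_Icc_subset.1 hev
    set y' := min (min y c) T with hy'
    have hxy' : x < y' := lt_min (lt_min hy hxc) hxT
    have hy'T : y' ∈ Icc 0 T := ⟨hx0.trans hxy'.le, min_le_right _ _⟩
    refine ⟨y', ?_, hxy', (min_le_left _ _).trans (min_le_left _ _)⟩
    have h1 := step η hη.le x hx y' hy'T hxy'.le fun r hr =>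
      hc ⟨hr.1, hr.2.trans ((min_le_left _ _).trans (min_le_right _ _))⟩
    have h2 : m (θ x) (θ x) ≤ ∫ s in (0 : ℝ)..x, k η s := hxS
    have h3 := intervalIntegral.integral_add_adjacent_intervals (subR (hki η) hzero hx)
      (subR (hki η) hx hy'T)
    change m (θ y') (θ y') ≤ ∫ s in (0 : ℝ)..y', k η s
    linarith
  have hlim : Tendsto (fun η : ℝ => ∫ s in (0 : ℝ)..t, k η s) (𝓝[>] 0)
      (𝓝 (1 / (2 * α) * ∫ s in (0 : ℝ)..t, δ s ^ 2)) := by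
    have e : ∀ η, ∫ s in (0 : ℝ)..t, k η s = 1 / (2 * α) * (∫ s in (0 : ℝ)..t, δ s ^ 2) +
        3 * η * ∫ s in (0 : ℝ)..t, (δ s + ‖a‖ * B) := by
      intro η
      rw [intervalIntegral.integral_add ((subR hδ2 hzero ht).const_mul _)
        (((subR hδ hzero ht).add intervalIntegrable_const).const_mul _),
        intervalIntegral.integral_const_mul, intervalIntegral.integral_const_mul]
    simp only [e]
    have : Continuous fun η : ℝ => 1 / (2 * α) * (∫ s in (0 : ℝ)..t, δ s ^ 2) +
        3 * η * ∫ s in (0 : ℝ)..t, (δ s + ‖a‖ * B) := by fun_prop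
    simpa using (this.tendsto 0).mono_left nhdsWithin_le_nhds
  refine ge_of_tendsto hlim ?_
  filter_upwards [self_mem_nhdsWithin] with η hη using main η hη

/-- The Aubin–Nitsche duality argument: the error `r - w` of a Galerkin projection, tested against
the data of the dual problem solved by `φ`. -/
theorem abs_le_of_duality {B : V →L[ℝ] V →L[ℝ] ℝ} {α : ℝ} (hα : 0 < α)
    (hB : ∀ v, α * ‖v‖ ^ 2 ≤ B v v) (hsymm : ∀ v w, B v w = B w v) {W : Submodule ℝ V}
    {w r φ vw vφ : V} (hr : r ∈ W) (hvw : vw ∈ W) (hvφ : vφ ∈ W)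
    (horth : ∀ z ∈ W, B r z = B w z) :
    |B φ (r - w)| ≤ ‖B‖ * (‖B‖ / α * ‖vw - w‖) * ‖vφ - φ‖ := by
  have e : B φ (r - w) = -B (r - w) (vφ - φ) := by
    have := horth vφ hvφ
    rw [hsymm]
    simp only [map_sub, sub_apply] at this ⊢
    linarith
  rw [e, abs_neg]
  refine (B.le_opNorm₂ _ _).trans ?_
  gcongr
  exact norm_sub_le_of_galerkin hα hB hr hvw horth

/-- Uniqueness of the Galerkin projection. Testing with `Z` determines it even in the closure of
`Z`, which spares a proof that `Z` is closed. -/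
theorem eq_of_galerkin {B : V →L[ℝ] V →L[ℝ] ℝ} {α : ℝ} (hα : 0 < α)
    (hB : ∀ v, α * ‖v‖ ^ 2 ≤ B v v) {Z : Submodule ℝ V} {w r r' : V}
    (hr : r ∈ Z.topologicalClosure) (hr' : r' ∈ Z.topologicalClosure)
    (h : ∀ v ∈ Z, B r v = B w v) (h' : ∀ v ∈ Z, B r' v = B w v) : r = r' := by
  have hle : Z.topologicalClosure ≤ (B (r - r')).ker :=
    Z.topologicalClosure_minimal (fun v hv => by
      rw [LinearMap.mem_ker]
      simp [h v hv, h' v hv]) (B (r - r')).isClosed_ker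
  have h0 : B (r - r') (r - r') = 0 := hle (sub_mem hr hr')
  have h1 := hB (r - r')
  rw [h0] at h1
  have h2 : ‖r - r'‖ ^ 2 ≤ 0 := nonpos_of_mul_nonpos_right h1 hα
  have h3 : ‖r - r'‖ = 0 := pow_eq_zero_iff two_ne_zero |>.1 (le_antisymm h2 (sq_nonneg _))
  exact sub_eq_zero.1 (norm_eq_zero.1 h3)

/-- A semidiscrete solution satisfies the evolution equation in integrated form. -/
theorem semidiscrete_integrated {a m : V →L[ℝ] V →L[ℝ] ℝ} {T : ℝ} {Z : Submodule ℝ V} {y : ℝ → V}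
    (hy : ContinuousOn y (Icc 0 T))
    (heq : ∀ t ∈ Ioc 0 T, ∃ y', HasDerivWithinAt y y' (Icc 0 T) t ∧
      ∀ v ∈ Z, m y' v + a (y t) v = 0) {v : V} (hv : v ∈ Z) {t : ℝ} (ht : t ∈ Icc 0 T) :
    m (y t) v + ∫ s in (0 : ℝ)..t, a (y s) v = m (y 0) v := by
  have hy' : ContinuousOn y (Icc 0 t) := hy.mono (Icc_subset_Icc le_rfl ht.2)
  have hint : IntervalIntegrable (fun s => -a (y s) v) volume 0 t := by
    apply ContinuousOn.intervalIntegrable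
    rw [uIcc_of_le ht.1]
    exact ((a.flip v).continuous.comp_continuousOn hy').neg
  have := intervalIntegral.integral_eq_sub_of_hasDeriv_right_of_le ht.1
    (f := fun s => m (y s) v) (f' := fun s => -a (y s) v)
    ((m.flip v).continuous.comp_continuousOn hy') (fun s hs => by
      have hsT : s < T := hs.2.trans_le ht.2
      obtain ⟨y', hd, he⟩ := heq s ⟨hs.1, hsT.le⟩
      have hd' := hd.hasDerivAt (Icc_mem_nhds hs.1 hsT)
      have h1 : HasDerivAt (fun s => m (y s) v) (m y' v) s :=
        (m.flip v).hasFDerivAt.comp_hasDerivAt s hd'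
      have h2 : m y' v = -a (y s) v := by linarith [he v hv]
      rw [h2] at h1
      exact h1.hasDerivWithinAt) hint
  rw [intervalIntegral.integral_neg] at this
  linarith

/-- Convergence of the semidiscretisation of an abstract evolution equation, given an estimate of
the error of the Ritz projection with constant `D` in the dual norms that are at stake. Here `A`
and `G` play the roles of the inclusion into `L₂(Ω)` and of the trace operator, and `N` that of the
norm of `H^{1/2}(Γ)`. The error is split as `uh - u = (uh - R u) + (R u - u)`; the first term obeys
the discrete evolution equation with right-hand side `-(R u - u)'` and is controlled by the energy
estimate. -/
theorem exists_semidiscrete_error [CompleteSpace V] {H₁ H₂ X : Type*}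
    [NormedAddCommGroup H₁] [InnerProductSpace ℝ H₁] [NormedAddCommGroup H₂]
    [InnerProductSpace ℝ H₂] [NormedAddCommGroup X] [NormedSpace ℝ X] [CompleteSpace X]
    (A : V →L[ℝ] H₁) (G : V →L[ℝ] H₂) (J : X →L[ℝ] V) (N : H₂ → ℝ)
    {a m : V →L[ℝ] V →L[ℝ] ℝ} {α μ T C₄ C₅ : ℝ} (hα : 0 < α) (hμ : 0 < μ) (hC₄ : 0 ≤ C₄)
    (hC₅ : 0 ≤ C₅) (ha : ∀ v, α * ‖v‖ ^ 2 ≤ a v v)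
    (hm : ∀ v w, m v w = ⟪A v, A w⟫_ℝ + μ * ⟪G v, G w⟫_ℝ) (hN0 : ∀ g, 0 ≤ N g)
    (hN : ∀ v, N (G v) ≤ C₄ * ‖v‖) (hGN : ∀ g ∈ range G, ‖g‖ ≤ C₅ * N g)
    {u : ℝ → V} {U U' : ℝ → X} (hU' : MemLp U' 2 (volume.restrict (Ioc 0 T)))
    (hu : ∀ t ∈ Icc 0 T, u t = J (U t)) (hU : ∀ t ∈ Icc 0 T, U t = U 0 + ∫ s in (0 : ℝ)..t, U' s)
    (hweak : ∀ v, ∀ t ∈ Icc 0 T, m (u t) v + ∫ s in (0 : ℝ)..t, a (u s) v = m (u 0) v) :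
    ∃ K, 0 ≤ K ∧ ∀ (Z : Submodule ℝ V) (R : V →L[ℝ] V) (D : ℝ), 0 ≤ D →
      (∀ w, R w ∈ Z.topologicalClosure) →
      (∀ w, ∀ v ∈ Z.topologicalClosure, a (R w) v = a w v) →
      (∀ x, ∀ g, ∀ g' ∈ range G, |⟪g, A (R (J x) - J x)⟫_ℝ + ⟪g', G (R (J x) - J x)⟫_ℝ| ≤
        D * ‖x‖ * (‖g‖ + N g')) →
      ∀ y : ℝ → V, (∀ t ∈ Icc 0 T, y t ∈ Z) → ContinuousOn y (Icc 0 T) →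
      (∀ t ∈ Ioc 0 T, ∃ y', HasDerivWithinAt y y' (Icc 0 T) t ∧
        ∀ v ∈ Z, m y' v + a (y t) v = 0) →
      (∀ v ∈ Z, a (y 0) v = a (u 0) v) →
      ∀ t ∈ Icc 0 T, ‖A (y t - u t)‖ ≤ D * K ∧
        ∀ g ∈ range G, |⟪G (y t - u t), g⟫_ℝ| ≤ D * K * N g := by
  -- For `T < 0` the time interval is empty.
  rcases lt_or_ge T 0 with hT | hT
  · exact ⟨0, le_rfl, fun Z R D _ _ _ _ y _ _ _ _ t ht => absurd (ht.1.trans ht.2) hT.not_ge⟩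
  have hzero : (0 : ℝ) ∈ Icc 0 T := ⟨le_rfl, hT⟩
  have hmsymm : ∀ v w, m v w = m w v := fun v w => by
    rw [hm, hm, real_inner_comm, real_inner_comm (G w)]
  have hU'i : IntervalIntegrable U' volume 0 T := by
    rw [intervalIntegrable_iff_integrableOn_Ioc_of_le hT]
    exact hU'.integrable (by norm_num)
  have hU'n : IntervalIntegrable (fun s => ‖U' s‖) volume 0 T := hU'i.norm
  have hU'2 : IntervalIntegrable (fun s => ‖U' s‖ ^ 2) volume 0 T := by
    rw [intervalIntegrable_iff_integrableOn_Ioc_of_le hT]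
    exact hU'.norm.integrable_sq
  have hUc : ContinuousOn U (Icc 0 T) := by
    have h1 := intervalIntegral.continuousOn_primitive_interval (μ := volume) (f := U')
      (a := 0) (b := T) (by rw [uIcc_of_le hT]; exact
        (intervalIntegrable_iff_integrableOn_Icc_of_le hT).1 hU'i)
    rw [uIcc_of_le hT] at h1
    exact (continuousOn_const.add h1).congr hU
  obtain ⟨b, hb⟩ := isCompact_Icc.exists_bound_of_continuousOn hUc
  have hb0 : 0 ≤ b := (norm_nonneg _).trans (hb 0 hzero)
  set c := ‖A‖ + C₄ * μ with hc
  have hc0 : 0 ≤ c := by positivity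
  set I := ∫ s in (0 : ℝ)..T, ‖U' s‖ ^ 2 with hI
  have hI0 : 0 ≤ I := intervalIntegral.integral_nonneg hT fun _ _ => sq_nonneg _
  set Q := 1 / (2 * α) * (c ^ 2 * I) with hQ
  have hQ0 : 0 ≤ Q := by positivity
  refine ⟨√Q + √(Q / μ) * C₅ + b, by positivity, ?_⟩
  intro Z R D hD hRZ hR hRD y hyZ hy heq hy0 t ht
  have subX : ∀ {x}, x ∈ Icc 0 T → IntervalIntegrable U' volume 0 x := fun hx =>
    hU'i.mono_set (by rw [uIcc_of_le hT]; exact uIcc_subset_Icc hzero hx)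
  have hZcl := Z.le_topologicalClosure
  have huc : ContinuousOn u (Icc 0 T) := (J.continuous.comp_continuousOn hUc).congr hu
  set f : ℝ → V := fun s => R (J (U' s)) - J (U' s) with hf
  set L : X →L[ℝ] V := R.comp J - J with hL
  have hfL : ∀ s, f s = L (U' s) := fun s => rfl
  set θ : ℝ → V := fun s => y s - R (u s) with hθ
  have hθc : ContinuousOn θ (Icc 0 T) := hy.sub (R.continuous.comp_continuousOn huc)
  have hθZ : ∀ s ∈ Icc 0 T, θ s ∈ Z.topologicalClosure := fun s hs =>
    sub_mem (hZcl (hyZ s hs)) (hRZ _)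
  have hfi : IntervalIntegrable f volume 0 T :=
    ⟨L.integrable_comp hU'i.1, L.integrable_comp hU'i.2⟩
  have h0 : θ 0 = 0 := sub_eq_zero.2 (eq_of_galerkin hα ha (w := u 0) (hZcl (hyZ 0 hzero)) (hRZ _)
    hy0 fun v hv => hR _ v (hZcl hv))
  set δ : ℝ → ℝ := fun s => D * c * ‖U' s‖ with hδ
  have hfδ : ∀ s v, |m (f s) v| ≤ δ s * ‖v‖ := by
    intro s v
    -- With `A v` and `μ G v` as data, the Ritz error estimate bounds `m(f s, v)` in a dual norm.
    have h1 := hRD (U' s) (A v) (G (μ • v)) ⟨_, rfl⟩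
    have h2 : m (f s) v = ⟪A v, A (R (J (U' s)) - J (U' s))⟫_ℝ +
        ⟪G (μ • v), G (R (J (U' s)) - J (U' s))⟫_ℝ := by
      rw [hmsymm, hm, map_smul, real_inner_smul_left]
    rw [h2]
    refine h1.trans ?_
    have h3 : ‖A v‖ + N (G (μ • v)) ≤ c * ‖v‖ := by
      have h4 := hN (μ • v)
      rw [norm_smul, Real.norm_of_nonneg hμ.le] at h4
      calc _ ≤ ‖A‖ * ‖v‖ + C₄ * (μ * ‖v‖) := add_le_add (A.le_opNorm v) h4
        _ = _ := by rw [hc]; ring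
    calc _ ≤ D * ‖U' s‖ * (c * ‖v‖) := by gcongr
      _ = _ := by rw [hδ]; ring
  -- Subtract the equations of `y` and `u`; since `a(R u, v) = a(u, v)`, only the time derivative of
  -- `R u - u` is left as right-hand side.
  have hident : ∀ t ∈ Icc 0 T, ∀ v ∈ Z.topologicalClosure,
      m (θ t) v + a (∫ s in (0 : ℝ)..t, θ s) v + m (∫ s in (0 : ℝ)..t, f s) v = 0 := by
    intro t ht
    set ℓ : V →L[ℝ] ℝ := m (θ t) + a (∫ s in (0 : ℝ)..t, θ s) + m (∫ s in (0 : ℝ)..t, f s) with hℓ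
    suffices hle : Z.topologicalClosure ≤ ℓ.ker from fun v hv => hle hv
    refine Z.topologicalClosure_minimal (fun v hv => ?_) ℓ.isClosed_ker
    have hts : Icc 0 t ⊆ Icc 0 T := Icc_subset_Icc le_rfl ht.2
    have ci : ∀ {g : ℝ → V}, ContinuousOn g (Icc 0 T) → IntervalIntegrable g volume 0 t := by
      intro g hg
      apply ContinuousOn.intervalIntegrable
      rw [uIcc_of_le ht.1]
      exact hg.mono hts
    have ai : ∀ {g : ℝ → V}, ContinuousOn g (Icc 0 T) →
        IntervalIntegrable (fun s => a (g s) v) volume 0 t := fun hg =>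
      ⟨(a.flip v).integrable_comp (ci hg).1, (a.flip v).integrable_comp (ci hg).2⟩
    have e1 := semidiscrete_integrated hy heq hv ht
    have e2 := hweak v t ht
    have e3 : a (∫ s in (0 : ℝ)..t, θ s) v =
        (∫ s in (0 : ℝ)..t, a (y s) v) - ∫ s in (0 : ℝ)..t, a (u s) v := by
      rw [← intervalIntegral.integral_sub (ai hy) (ai huc)]
      have := (a.flip v).intervalIntegral_comp_comm (ci hθc)
      simp only [ContinuousLinearMap.flip_apply] at this
      rw [← this]
      refine intervalIntegral.integral_congr fun s _ => ?_
      simp only [hθ, map_sub, sub_apply, hR (u s) v (hZcl hv)]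
    have e4 : u t = u 0 + J (∫ s in (0 : ℝ)..t, U' s) := by
      rw [hu t ht, hu 0 hzero, hU t ht, map_add]
    have e5 : ∫ s in (0 : ℝ)..t, f s = R (J (∫ s in (0 : ℝ)..t, U' s)) -
        J (∫ s in (0 : ℝ)..t, U' s) := by
      simp only [hfL]
      rw [L.intervalIntegral_comp_comm (subX ht)]
      rfl
    have e6 : y 0 = R (u 0) := sub_eq_zero.1 h0
    change m (θ t) v + a (∫ s in (0 : ℝ)..t, θ s) v + m (∫ s in (0 : ℝ)..t, f s) v = 0
    rw [e3, e5]
    rw [e4] at e2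
    rw [e6] at e1
    simp only [hθ, e4, map_add, map_sub, add_apply, sub_apply] at e1 e2 ⊢
    linarith
  have henergy := energy_estimate hα ha hmsymm hθc hθZ hfi (fun s => by positivity)
    (hU'n.const_mul _) (by simpa only [hδ, mul_pow] using hU'2.const_mul _) hfδ h0 hident ht
  have hmθ : m (θ t) (θ t) ≤ D ^ 2 * Q := by
    refine henergy.trans ?_
    have h1 : ∫ s in (0 : ℝ)..t, δ s ^ 2 = (D * c) ^ 2 * ∫ s in (0 : ℝ)..t, ‖U' s‖ ^ 2 := by
      simp only [hδ, mul_pow _ ‖_‖]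
      exact intervalIntegral.integral_const_mul _ _
    have h2 : ∫ s in (0 : ℝ)..t, ‖U' s‖ ^ 2 ≤ I :=
      intervalIntegral.integral_mono_interval le_rfl ht.1 ht.2
        (ae_of_all _ fun _ => sq_nonneg _) hU'2
    rw [h1, hQ]
    calc _ ≤ 1 / (2 * α) * ((D * c) ^ 2 * I) := by gcongr
      _ = _ := by ring
  rw [hm, real_inner_self_eq_norm_sq, real_inner_self_eq_norm_sq] at hmθ
  -- Both components of `θ` are bounded in `L²`, by the energy norm.
  have hAθ : ‖A (θ t)‖ ≤ D * √Q := by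
    refine le_of_sq_le_sq ?_ (by positivity)
    rw [mul_pow, Real.sq_sqrt hQ0]
    nlinarith [mul_nonneg hμ.le (sq_nonneg ‖G (θ t)‖)]
  have hGθ : ‖G (θ t)‖ ≤ D * √(Q / μ) := by
    refine le_of_sq_le_sq ?_ (by positivity)
    rw [mul_pow, Real.sq_sqrt (by positivity), ← mul_div_assoc, le_div_iff₀ hμ]
    nlinarith [sq_nonneg ‖A (θ t)‖]
  have hsplit : y t - u t = θ t + (R (J (U t)) - J (U t)) := by
    simp only [hθ, hu t ht]; abel
  have hK1 : 0 ≤ √(Q / μ) * C₅ := by positivity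
  have hKQ := Real.sqrt_nonneg Q
  refine ⟨?_, fun g hg => ?_⟩
  · rw [hsplit, map_add]
    refine (norm_add_le _ _).trans ?_
    -- The dual norm of the bulk component is its `L²` norm: take the component itself as data.
    have h1 := hRD (U t) (A (R (J (U t)) - J (U t))) 0 ⟨0, map_zero G⟩
    have hN00 : N 0 = 0 := le_antisymm (by simpa using hN 0) (hN0 0)
    rw [inner_zero_left, add_zero, real_inner_self_eq_norm_sq, hN00, add_zero, abs_of_nonneg
      (sq_nonneg _)] at h1
    have h2 : ‖A (R (J (U t)) - J (U t))‖ ≤ D * b := by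
      rcases eq_or_lt_of_le (norm_nonneg (A (R (J (U t)) - J (U t)))) with h0 | h0
      · rw [← h0]; positivity
      · rw [sq] at h1
        exact (le_of_mul_le_mul_right h1 h0).trans (by gcongr; exact hb t ht)
    calc _ ≤ D * √Q + D * b := add_le_add hAθ h2
      _ = D * (√Q + 0 + b) := by ring
      _ ≤ _ := by gcongr
  · rw [hsplit, map_add, inner_add_left]
    refine (abs_add_le _ _).trans ?_
    have h1 := hRD (U t) 0 g hg
    rw [inner_zero_left, zero_add, norm_zero, zero_add, real_inner_comm] at h1
    have h2 : |⟪G (θ t), g⟫_ℝ| ≤ D * √(Q / μ) * (C₅ * N g) :=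
      (abs_real_inner_le_norm _ _).trans (by
        have := hN0 g
        gcongr
        exact hGN g hg)
    have h3 := hN0 g
    calc _ ≤ D * √(Q / μ) * (C₅ * N g) + D * b * N g := by
          refine add_le_add h2 (h1.trans ?_)
          gcongr
          exact hb t ht
      _ = D * (0 + √(Q / μ) * C₅ + b) * N g := by ring
      _ ≤ _ := by gcongr

end Abstract

/-- The bilinear form `(u, v) ↦ ⟪A u, A v⟫` defined by a bounded operator `A` into a Hilbert
space. -/
noncomputable def innerComp {V F : Type*} [NormedAddCommGroup V] [NormedSpace ℝ V]
    [NormedAddCommGroup F] [InnerProductSpace ℝ F] (A : V →L[ℝ] F) : V →L[ℝ] V →L[ℝ] ℝ :=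
  (isBoundedBilinearMap_inner (𝕜 := ℝ) (E := F)).toContinuousLinearMap.bilinearComp A A

theorem innerComp_apply {V F : Type*} [NormedAddCommGroup V] [NormedSpace ℝ V]
    [NormedAddCommGroup F] [InnerProductSpace ℝ F] (A : V →L[ℝ] F) (u v : V) :
    innerComp A u v = ⟪A u, A v⟫_ℝ := rfl

/-- A bijective bounded operator with a lower bound has a bounded inverse, through which bounded
operators lift. -/
theorem exists_lift {V X Y : Type*} [NormedAddCommGroup V] [NormedSpace ℝ V]
    [NormedAddCommGroup X] [NormedSpace ℝ X] [NormedAddCommGroup Y] [NormedSpace ℝ Y]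
    (A : V →L[ℝ] Y) (hA : Function.Surjective A) {C : ℝ} (hC : ∀ v, ‖v‖ ≤ C * ‖A v‖)
    (f : X →L[ℝ] Y) : ∃ J : X →L[ℝ] V, ∀ x, A (J x) = f x := by
  have hinj : Function.Injective A := (injective_iff_map_eq_zero A).2 fun v hv =>
    norm_eq_zero.1 (le_antisymm (by simpa [hv] using hC v) (norm_nonneg _))
  let e := LinearEquiv.ofBijective (A : V →ₗ[ℝ] Y) ⟨hinj, hA⟩
  have he : ∀ p, A (e.symm p) = p := fun p => e.apply_symm_apply p
  refine ⟨(LinearMap.mkContinuous (e.symm : Y →ₗ[ℝ] V) C fun p => ?_).comp f, fun x => he _⟩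
  have := hC (e.symm p)
  rwa [he] at this

/-- Second-order convergence of the semidiscretisation of an evolution equation of the form
`μ`-weighted time derivative plus elliptic form, in terms of an approximation property of the
discrete space `Z` with constant `h` and of the regularity of the dual problem. -/
theorem exists_semidiscrete_error_of_regularity {V H₁ H₂ X n : Type*} [NormedAddCommGroup V]
    [NormedSpace ℝ V] [CompleteSpace V] [NormedAddCommGroup H₁] [InnerProductSpace ℝ H₁]
    [NormedAddCommGroup H₂] [InnerProductSpace ℝ H₂] [NormedAddCommGroup X] [NormedSpace ℝ X]
    [CompleteSpace X] [Fintype n] (A : V →L[ℝ] H₁) (P : n → V →L[ℝ] H₁) (G : V →L[ℝ] H₂)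
    (J : X →L[ℝ] V) (N : H₂ → ℝ)
    (hV : ∀ x y : V, ‖x + y‖ * ‖x + y‖ + ‖x - y‖ * ‖x - y‖ = 2 * (‖x‖ * ‖x‖ + ‖y‖ * ‖y‖))
    {κ μ T α C₃ C₄ C₅ : ℝ} (hα : 0 < α) (hμ : 0 < μ) (hC₃ : 0 ≤ C₃) (hC₄ : 0 ≤ C₄)
    (hC₅ : 0 ≤ C₅) (hcoer : ∀ v, α * ‖v‖ ^ 2 ≤ ∑ i, ‖P i v‖ ^ 2 + κ * ‖G v‖ ^ 2)
    (hN0 : ∀ g, 0 ≤ N g) (hN : ∀ v, N (G v) ≤ C₄ * ‖v‖) (hGN : ∀ g ∈ range G, ‖g‖ ≤ C₅ * N g)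
    (hreg : ∀ g, ∀ g' ∈ range G, ∀ φ,
      (∀ v, ∑ i, ⟪P i φ, P i v⟫_ℝ + κ * ⟪G φ, G v⟫_ℝ = ⟪g, A v⟫_ℝ + ⟪g', G v⟫_ℝ) →
      ∃ x, J x = φ ∧ ‖x‖ ≤ C₃ * (‖g‖ + N g'))
    {u : ℝ → V} {U U' : ℝ → X} (hU' : MemLp U' 2 (volume.restrict (Ioc 0 T)))
    (hu : ∀ t ∈ Icc 0 T, u t = J (U t)) (hU : ∀ t ∈ Icc 0 T, U t = U 0 + ∫ s in (0 : ℝ)..t, U' s)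
    (hweak : ∀ v, ∀ t ∈ Icc 0 T, (⟪A (u t), A v⟫_ℝ + μ * ⟪G (u t), G v⟫_ℝ) +
      ∫ s in (0 : ℝ)..t, (∑ i, ⟪P i (u s), P i v⟫_ℝ + κ * ⟪G (u s), G v⟫_ℝ) =
        ⟪A (u 0), A v⟫_ℝ + μ * ⟪G (u 0), G v⟫_ℝ) :
    ∃ K, 0 ≤ K ∧ ∀ (Z : Submodule ℝ V) (h : ℝ), 0 ≤ h →
      (∀ x, ∃ v ∈ Z, ‖v - J x‖ ≤ h * ‖x‖) →
      ∀ y : ℝ → V, (∀ t ∈ Icc 0 T, y t ∈ Z) → ContinuousOn y (Icc 0 T) →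
      (∀ t ∈ Ioc 0 T, ∃ y', HasDerivWithinAt y y' (Icc 0 T) t ∧ ∀ v ∈ Z,
        (⟪A y', A v⟫_ℝ + μ * ⟪G y', G v⟫_ℝ) +
          (∑ i, ⟪P i (y t), P i v⟫_ℝ + κ * ⟪G (y t), G v⟫_ℝ) = 0) →
      (∀ v ∈ Z, ∑ i, ⟪P i (y 0), P i v⟫_ℝ + κ * ⟪G (y 0), G v⟫_ℝ =
        ∑ i, ⟪P i (u 0), P i v⟫_ℝ + κ * ⟪G (u 0), G v⟫_ℝ) →
      ∀ t ∈ Icc 0 T, ‖A (y t - u t)‖ ≤ K * h ^ 2 ∧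
        ∀ g ∈ range G, |⟪G (y t - u t), g⟫_ℝ| ≤ K * h ^ 2 * N g := by
  set a : V →L[ℝ] V →L[ℝ] ℝ := (∑ i, innerComp (P i)) + κ • innerComp G with ha
  set m : V →L[ℝ] V →L[ℝ] ℝ := innerComp A + μ • innerComp G with hm
  have ha' : ∀ v w, a v w = ∑ i, ⟪P i v, P i w⟫_ℝ + κ * ⟪G v, G w⟫_ℝ := fun v w => by
    simp [ha, innerComp_apply]
  have hm' : ∀ v w, m v w = ⟪A v, A w⟫_ℝ + μ * ⟪G v, G w⟫_ℝ := fun v w => by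
    simp [hm, innerComp_apply]
  clear_value a m
  have hcoer' : ∀ v, α * ‖v‖ ^ 2 ≤ a v v := fun v => by
    simp only [ha', real_inner_self_eq_norm_sq]
    exact hcoer v
  have hsymm : ∀ v w, a v w = a w v := fun v w => by
    simp only [ha', fun i => real_inner_comm (P i w) (P i v), real_inner_comm (G w) (G v)]
  have hcoercive : IsCoercive a := ⟨α, hα, fun v => by rw [mul_assoc, ← sq]; exact hcoer' v⟩
  simp only [← ha', ← hm'] at hreg hweak ⊢
  obtain ⟨K, hK, hconv⟩ := exists_semidiscrete_error A G J N hα hμ hC₄ hC₅ hcoer' hm' hN0 hN hGN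
    hU' hu hU hweak
  refine ⟨‖a‖ * (‖a‖ / α) * C₃ * K, by positivity, ?_⟩
  intro Z h hh happ y hyZ hy heq hy0 t ht
  -- `R` is the Ritz projection; the closure makes it exist before `Z` is known to be closed.
  obtain ⟨R, hRZ, hR⟩ := exists_galerkin hV hcoercive Z.topologicalClosure
    Z.isClosed_topologicalClosure
  have hZcl := Z.le_topologicalClosure
  have hres := hconv Z R (‖a‖ * (‖a‖ / α) * C₃ * h ^ 2) (by positivity) hRZ hR ?_ y hyZ hy heq
    hy0 t ht
  · rw [show ‖a‖ * (‖a‖ / α) * C₃ * h ^ 2 * K = ‖a‖ * (‖a‖ / α) * C₃ * K * h ^ 2 by ring] at hres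
    exact hres
  intro x g g' hg'
  -- The dual problem with data `g` and `g'`.
  obtain ⟨φ, hφ⟩ := exists_laxMilgram hV hcoercive
    ((innerSL ℝ g : H₁ →L[ℝ] ℝ).comp A + (innerSL ℝ g' : H₂ →L[ℝ] ℝ).comp G)
  have hφ' : ∀ v, a φ v = ⟪g, A v⟫_ℝ + ⟪g', G v⟫_ℝ := hφ
  obtain ⟨xφ, rfl, hxφ⟩ := hreg g g' hg' φ hφ'
  obtain ⟨vw, hvw, hw⟩ := happ x
  obtain ⟨vφ, hvφ, hφa⟩ := happ xφ
  rw [← hφ']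
  refine (abs_le_of_duality hα hcoer' hsymm (hRZ (J x)) (hZcl hvw) (hZcl hvφ) (hR (J x))).trans ?_
  have h0 := hN0 g'
  calc _ ≤ ‖a‖ * (‖a‖ / α * (h * ‖x‖)) * (h * (C₃ * (‖g‖ + N g'))) := by
        gcongr
        exact hφa.trans (by gcongr)
    _ = _ := by ring

/-! ### Operators on the energy space -/

section Energy

variable {d : ℕ} {Ω : Set (EuclideanSpace ℝ (Fin d))}

local notation "E" => EuclideanSpace ℝ (Fin d)

/-- `v ↦ v` from the energy space to `L₂(Ω)`. -/
noncomputable def toL2L (Ω : Set E) : EnergySpace Ω →L[ℝ] L2Bulk Ω :=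
  (WithLp.fstL 2 ℝ (L2Bulk Ω) (PiLp 2 fun _ : Fin d => L2Bulk Ω)).comp
    ((H1 Ω).subtypeL.comp (toH1L Ω))

/-- `v ↦ ∂ᵢ v` from the energy space to `L₂(Ω)`. -/
noncomputable def gradL (Ω : Set E) (i : Fin d) : EnergySpace Ω →L[ℝ] L2Bulk Ω :=
  ((PiLp.proj 2 (fun _ : Fin d => L2Bulk Ω) i : _ →L[ℝ] _).comp
    (WithLp.sndL 2 ℝ (L2Bulk Ω) (PiLp 2 fun _ : Fin d => L2Bulk Ω))).comp
    ((H1 Ω).subtypeL.comp (toH1L Ω))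

/-- The trace operator on the energy space. -/
noncomputable def traceL (Ω : Set E) : EnergySpace Ω →L[ℝ] L2Bdry Ω :=
  (WithLp.sndL 2 ℝ (H1 Ω) (L2Bdry Ω)).comp (smoothGraph Ω).topologicalClosure.subtypeL

/-- The norm of the energy space comes from an inner product. -/
theorem EnergySpace.parallelogram (x y : EnergySpace Ω) :
    ‖x + y‖ * ‖x + y‖ + ‖x - y‖ * ‖x - y‖ = 2 * (‖x‖ * ‖x‖ + ‖y‖ * ‖y‖) := by
  have h1 := parallelogram_law_with_norm ℝ x.toH1 y.toH1
  have h2 := parallelogram_law_with_norm ℝ x.trace y.trace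
  simp only [← sq] at h1 h2 ⊢
  rw [(x + y).norm_sq, (x - y).norm_sq, x.norm_sq, y.norm_sq]
  change ‖x.toH1 + y.toH1‖ ^ 2 + ‖x.trace + y.trace‖ ^ 2 +
    (‖x.toH1 - y.toH1‖ ^ 2 + ‖x.trace - y.trace‖ ^ 2) = _
  linarith

/-- Coercivity of the form `a`, by Friedrichs' inequality. -/
theorem exists_coercive (hd : 1 ≤ d) (hΩ : IsOpen Ω) (hb : Bornology.IsBounded Ω) {κ : ℝ}
    (hκ : 0 < κ) : ∃ α > 0, ∀ v : EnergySpace Ω,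
      α * ‖v‖ ^ 2 ≤ ∑ i, ‖v.grad i‖ ^ 2 + κ * ‖v.trace‖ ^ 2 := by
  obtain ⟨C, hC, h⟩ := exists_friedrichs hd hΩ hb
  refine ⟨min 1 κ / (C + 1), by positivity, fun v => ?_⟩
  have h1 := h v
  have h2 : ‖v‖ ^ 2 ≤ (C + 1) * (∑ i, ‖v.grad i‖ ^ 2 + ‖v.trace‖ ^ 2) := by
    rw [v.norm_sq, norm_toH1_sq]; linarith
  have h3 : 0 ≤ ∑ i, ‖v.grad i‖ ^ 2 := Finset.sum_nonneg fun _ _ => sq_nonneg _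
  rw [div_mul_eq_mul_div, div_le_iff₀ (by positivity)]
  calc min 1 κ * ‖v‖ ^ 2
      ≤ min 1 κ * ((C + 1) * (∑ i, ‖v.grad i‖ ^ 2 + ‖v.trace‖ ^ 2)) := by gcongr
    _ = (min 1 κ * ∑ i, ‖v.grad i‖ ^ 2 + min 1 κ * ‖v.trace‖ ^ 2) * (C + 1) := by ring
    _ ≤ (1 * ∑ i, ‖v.grad i‖ ^ 2 + κ * ‖v.trace‖ ^ 2) * (C + 1) := by
        gcongr
        · exact min_le_left _ _
        · exact min_le_right _ _
    _ = _ := by ring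

theorem hHalfNorm_nonneg (g : L2Bdry Ω) : 0 ≤ hHalfNorm g :=
  Real.iInf_nonneg fun _ => norm_nonneg _

/-- The trace operator has norm at most one from `H¹(Ω)` to `H^{1/2}(Γ)`. -/
theorem hHalfNorm_trace_le (v : EnergySpace Ω) : hHalfNorm v.trace ≤ ‖v.toH1‖ :=
  ciInf_le ⟨0, by rintro _ ⟨w, rfl⟩; exact norm_nonneg _⟩
    (⟨v, rfl⟩ : {w : EnergySpace Ω // w.trace = v.trace})

theorem norm_toH1_le (v : EnergySpace Ω) : ‖v.toH1‖ ≤ ‖v‖ :=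
  le_of_sq_le_sq (by rw [v.norm_sq]; linarith [sq_nonneg ‖v.trace‖]) (norm_nonneg _)

/-- The embedding of `H^{1/2}(Γ)` into `L₂(Γ)` is continuous, by the trace inequality. -/
theorem exists_norm_le_hHalfNorm (hΩ : IsOpen Ω) (hb : Bornology.IsBounded Ω)
    (hL : HasLipschitzBoundary Ω) : ∃ C > 0, ∀ g ∈ HHalf Ω, ‖g‖ ≤ C * hHalfNorm g := by
  obtain ⟨C, hC, h⟩ := exists_trace_le hΩ hb hL
  have hs : 0 < √C := Real.sqrt_pos.2 hC
  refine ⟨√C, hs, ?_⟩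
  rintro _ ⟨w, rfl⟩
  rw [mul_comm, ← div_le_iff₀ hs]
  have : Nonempty {v : EnergySpace Ω // v.trace = w.trace} := ⟨⟨w, rfl⟩⟩
  refine le_ciInf fun v => ?_
  rw [div_le_iff₀ hs]
  refine le_of_sq_le_sq ?_ (by positivity)
  refine (le_of_eq (by rw [v.2])).trans ((h v.1).trans_eq ?_)
  rw [mul_pow, Real.sq_sqrt hC.le, mul_comm]

/-! Shortcut instances: found through the submodule instances alone, unification of the norms of
`EnergySpace Ω` and `H2 Ω` has to unfold several layers of `WithLp`. -/

noncomputable instance EnergySpace.instNormedAddCommGroup (Ω : Set E) :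
    NormedAddCommGroup (EnergySpace Ω) :=
  (smoothGraph Ω).topologicalClosure.normedAddCommGroup

set_option synthInstance.maxHeartbeats 400000 in
noncomputable instance EnergySpace.instNormedSpace (Ω : Set E) :
    @NormedSpace ℝ (EnergySpace Ω) _
      (EnergySpace.instNormedAddCommGroup Ω).toSeminormedAddCommGroup :=
  (smoothGraph Ω).topologicalClosure.normedSpace

noncomputable instance H2.instNormedAddCommGroup (Ω : Set E) : NormedAddCommGroup (H2 Ω) :=
  (H2 Ω).normedAddCommGroup

set_option synthInstance.maxHeartbeats 400000 in
noncomputable instance H2.instNormedSpace (Ω : Set E) :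
    @NormedSpace ℝ (H2 Ω) _ (H2.instNormedAddCommGroup Ω).toSeminormedAddCommGroup :=
  (H2 Ω).normedSpace

set_option synthInstance.maxHeartbeats 400000 in
set_option maxHeartbeats 1000000 in
/-- `H²(Ω)` as a space of functions in the energy space. -/
theorem exists_H2_inclusion (hΩ : IsOpen Ω) (hb : Bornology.IsBounded Ω)
    (hL : HasLipschitzBoundary Ω) :
    ∃ J : H2 Ω →L[ℝ] EnergySpace Ω, ∀ Φ v, J Φ = v ↔ Φ.1.fst = v.toH1 := by
  obtain ⟨C, hC, hanti⟩ := exists_antilipschitz_toH1L hΩ hb hL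
  obtain ⟨J, hJ⟩ := exists_lift (toH1L Ω) (surjective_toH1L hΩ hb hL) hanti
    ((WithLp.fstL 2 ℝ (H1 Ω) (PiLp 2 fun _ : Fin d × Fin d => L2Bulk Ω)).comp (H2 Ω).subtypeL)
  refine ⟨J, fun Φ v => ?_⟩
  have h1 : (J Φ).toH1 = Φ.1.fst := hJ Φ
  refine ⟨fun h => by rw [← h, h1], fun h => ?_⟩
  have h2 : ‖J Φ - v‖ ≤ C * ‖(J Φ - v).toH1‖ := hanti _
  have h3 : (J Φ - v).toH1 = 0 := by
    change (J Φ).toH1 - v.toH1 = 0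
    rw [h1, h, sub_self]
  rw [h3, norm_zero, mul_zero] at h2
  exact sub_eq_zero.1 (norm_eq_zero.1 (le_antisymm h2 (norm_nonneg _)))

end Energy

end WentzellFEM

set_option synthInstance.maxHeartbeats 400000 in
set_option maxHeartbeats 2000000 in
theorem mainTheorem2 {d : ℕ} (hd : 1 ≤ d) (Ω : Set (EuclideanSpace ℝ (Fin d)))
    (hΩ : IsPolygonalDomain Ω) (κ μ T : ℝ) (hκ : 0 < κ) (hμ : 0 < μ) (hT : 0 < T)
    (hreg : RobinRegularity Ω κ)
    {ι : Type*} (𝒯 : ι → Geometry.SimplicialComplex ℝ (EuclideanSpace ℝ (Fin d)))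
    (h𝒯 : ∀ i, IsTriangulation Ω (𝒯 i)) (hqu : IsQuasiUniform 𝒯)
    (u : ℝ → EnergySpace Ω) (hu : IsWeakSolution κ μ T u) (hu_reg : IsH1InTimeH2 T u) :
    ∃ C : ℝ, ∀ i, ∀ uh : ℝ → EnergySpace Ω,
      IsSemidiscreteSolution κ μ T (feSpace Ω (𝒯 i)) uh →
      IsRitzProjection κ (feSpace Ω (𝒯 i)) (u 0) (uh 0) →
      ∀ t ∈ Icc 0 T,
        ENNReal.ofReal (‖(uh t - u t).toL2‖ ^ 2)
            + ENNReal.ofReal μ * hNegHalfNorm (uh t - u t).trace ^ 2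
          ≤ ENNReal.ofReal (C * meshWidth (𝒯 i) ^ 4) := by
  obtain ⟨J, hJ⟩ := exists_H2_inclusion hΩ.isOpen hΩ.isBounded hΩ.lipschitz
  obtain ⟨α, hα, hcoer⟩ := exists_coercive hd hΩ.isOpen hΩ.isBounded hκ
  obtain ⟨C₅, hC₅, hGN⟩ := exists_norm_le_hHalfNorm hΩ.isOpen hΩ.isBounded hΩ.lipschitz
  obtain ⟨Ca, hCa, hanti⟩ := exists_antilipschitz_toH1L hΩ.isOpen hΩ.isBounded hΩ.lipschitz
  obtain ⟨Cf, hCf, happ⟩ := exists_fe_approx hd hΩ 𝒯 h𝒯 hqu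
  obtain ⟨C₂, hC₂⟩ := hreg
  obtain ⟨U, U', hU', hU⟩ := hu_reg
  have : CompleteSpace (EnergySpace Ω) :=
    (smoothGraph Ω).isClosed_topologicalClosure.completeSpace_coe
  -- The regularity constant `C₂` may be replaced by `|C₂|`, which has a square root.
  obtain ⟨K, hK, hconv⟩ := exists_semidiscrete_error_of_regularity (toL2L Ω) (gradL Ω) (traceL Ω) J
    hHalfNorm EnergySpace.parallelogram (κ := κ) (μ := μ) (T := T) (C₃ := √|C₂|) (C₄ := 1) hα hμ
    (Real.sqrt_nonneg _) zero_le_one hC₅.le hcoer hHalfNorm_nonneg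
    (fun v => by rw [one_mul]; exact (hHalfNorm_trace_le v).trans (norm_toH1_le v)) hGN
    (fun g g' hg' φ hφ => by
      obtain ⟨Φ, hΦ, hΦn⟩ := hC₂ g g' hg' φ hφ
      refine ⟨Φ, (hJ Φ φ).2 hΦ, le_of_sq_le_sq (hΦn.trans ?_)
        (mul_nonneg (Real.sqrt_nonneg _) (add_nonneg (norm_nonneg _) (hHalfNorm_nonneg _)))⟩
      rw [mul_pow, Real.sq_sqrt (abs_nonneg _)]
      refine mul_le_mul (le_abs_self _) ?_ (by positivity) (abs_nonneg _)
      nlinarith [mul_nonneg (norm_nonneg g) (hHalfNorm_nonneg g')])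
    hU' (fun t ht => ((hJ (U t) (u t)).2 (hU t ht).1.symm).symm) (fun t ht => (hU t ht).2) hu.eq
  refine ⟨(1 + μ) * (K * (Ca * Cf) ^ 2) ^ 2, fun i uh huh hR t ht => ?_⟩
  -- The finite element approximation holds in `H¹(Ω)`; `Ca` transfers it to the energy space.
  set h := meshWidth (𝒯 i) with hh
  have hh0 : 0 ≤ h := by
    rw [hh]
    exact (meshWidth_pos hd hΩ.isConnected.nonempty (h𝒯 i)).le
  obtain ⟨h1, h2⟩ := hconv (feSpace Ω (𝒯 i)) (Ca * Cf * h) (by positivity) (fun Φ => by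
      obtain ⟨v, hv, hvn⟩ := happ i Φ
      refine ⟨v, hv, (hanti _).trans ?_⟩
      have h1 : (v - J Φ).toH1 = v.toH1 - Φ.1.fst := by
        rw [(hJ Φ _).1 rfl]; rfl
      rw [h1, norm_sub_rev, mul_assoc, mul_assoc]
      refine mul_le_mul_of_nonneg_left ?_ hCa.le
      rw [← mul_assoc]
      exact hvn) uh huh.mem huh.continuousOn huh.eq hR.2 t ht
  set e := uh t - u t
  have h3 : hNegHalfNorm e.trace ≤ ENNReal.ofReal (K * (Ca * Cf * h) ^ 2) := by
    refine iSup_le fun ψ => ENNReal.ofReal_le_ofReal ((h2 ψ.1 ψ.2.1).trans ?_)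
    exact mul_le_of_le_one_right (by positivity) ψ.2.2
  calc _ ≤ ENNReal.ofReal ((K * (Ca * Cf * h) ^ 2) ^ 2) +
        ENNReal.ofReal μ * ENNReal.ofReal (K * (Ca * Cf * h) ^ 2) ^ 2 := by
        gcongr
        exact h1
    _ = ENNReal.ofReal ((1 + μ) * (K * (Ca * Cf) ^ 2) ^ 2 * h ^ 4) := by
        rw [← ENNReal.ofReal_pow (by positivity), ← ENNReal.ofReal_mul hμ.le,
          ← ENNReal.ofReal_add (by positivity) (by positivity)]
        congr 1
        ring
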